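/- Let $d\ge 2$ be an integer, $\mu\ge 0$, $\gamma>-1$, $\beta\ge 0$, $n\in\mathbb N_0$, and set $\alpha=\beta+\mu+\frac{d-1}{2}$. Let $\mathbb V^{d+1}=\{(x,t)\in\mathbb R^d\times\mathbb R:\ \|x\|^2\le t,\ 0\le t\le 1\}$ be the solid paraboloid with weight $$W_{\beta,\gamma,\mu}(x,t)=t^{\beta}(1-t)^{\gamma}(t-\|x\|^2)^{\mu-\frac12},$$ and let $\mathbb U=\{(x_1,x_2)\in\mathbb R^2:\ x_1^2\le x_2\le 1\}$ be the parabolic domain with weight $$U_{a,b}(x_1,x_2)=(1-x_2)^{a}(x_2-x_1^2)^{b-\frac12},\qquad a>-1,\ b>-\tfrac12 .$$ For a weight $w$ on a domain $D$ let $\langle f,g\rangle=\big(\int_D w\big)^{-1}\int_D f\,g\,w$, let $\mathcal V_n(D,w)$ be the space of polynomials of total degree at most $n$ that are orthogonal to all polynomials of total degree less than $n$, and let $\mathbf P_n(w;\cdot,\cdot)$ be the reproducing kernel of $\mathcal V_n(D,w)$ with respect to $\langle\cdot,\cdot\rangle$: $\mathbf P_n(w;p,\cdot)\in\mathcal V_n(D,w)$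 and $\langle f,\mathbf P_n(w;p,\cdot)\rangle=f(p)$ for all $f\in\mathcal V_n(D,w)$. Put $$c_\lambda=\frac{\Gamma(\lambda+1)}{\Gamma(\frac12)\Gamma(\lambda+\frac12)}=\Big(\int_{-1}^1(1-t^2)^{\lambda-\frac12}dt\Big)^{-1},\qquad c'_{a,b}=\frac{2^{-a-b-1}\,\Gamma(a+b+2)}{\Gamma(a+1)\Gamma(b+1)}=\Big(\int_{-1}^1(1-t)^a(1+t)^b\,dt\Big)^{-1},$$ and, for $(x,t),(y,s)\in\mathbb V^{d+1}$, $$\xi_0(x,t,y,s;u)=\frac{\langle x,y\rangle+u\sqrt{t-\|x\|^2}\sqrt{s-\|y\|^2}}{\sqrt{st}},\qquad \xi(x,t,y,s;z,u)=\tfrac{1-z_1}{2}\,\xi_0(x,t,y,s;u)+\tfrac{1+z_1}{2}\,z_2$$ (when $st=0$, read $\xi_0$ as $0$; its value is then immaterial). Then the kernels $\mathbf P_n(W_{\beta,\gamma,\mu})$ and $\mathbf P_n(U_{\gamma,\alpha})$ exist and are unique, and for all $(x,t),(y,s)\in\mathbb V^{d+1}$ the following hold, all integrals being absolutely convergent.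 If $\beta>0$ and $\mu>0$, then $$\mathbf P_n\big(W_{\beta,\gamma,\mu};(x,t),(y,s)\big)=c'_{\mu+\frac{d-1}{2},\beta-1}\,c_\beta\,c_{\mu-\frac12}\int_{[-1,1]^3}\mathbf P_n\big(U_{\gamma,\alpha};(\sqrt t,t),(\sqrt s\,\xi(x,t,y,s;z,u),s)\big)(1-z_1)^{\mu+\frac{d-1}{2}}(1+z_1)^{\beta-1}(1-z_2^2)^{\beta-\frac12}(1-u^2)^{\mu-1}\,dz\,du .$$ If $\beta=0$ and $\mu>0$, then $$\mathbf P_n\big(W_{0,\gamma,\mu};(x,t),(y,s)\big)=c_{\mu-\frac12}\int_{-1}^{1}\mathbf P_n\big(U_{\gamma,\mu+\frac{d-1}{2}};(\sqrt t,t),(\sqrt s\,\xi_0(x,t,y,s;u),s)\big)(1-u^2)^{\mu-1}\,du .$$ If $\mu=0$, both identities hold in the limit sense: $c_{\mu-\frac12}$ and $(1-u^2)^{\mu-1}$ are replaced by $c_{\nu-\frac12}$ and $(1-u^2)^{\nu-1}$ with $\nu>0$, every other occurrence of $\mu$ is set to $0$, and the right-hand side then converges to the left-hand side as $\nu\to0^+$.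 Equivalently, $c_{\mu-\frac12}\int_{-1}^1 f(u)(1-u^2)^{\mu-1}du$ is replaced by $\frac{f(1)+f(-1)}{2}$; that is, for $\beta>0$, $$\mathbf P_n\big(W_{\beta,\gamma,0};(x,t),(y,s)\big)=c'_{\frac{d-1}{2},\beta-1}\,c_\beta\int_{[-1,1]^2}\tfrac12\sum_{u=\pm1}\mathbf P_n\big(U_{\gamma,\beta+\frac{d-1}{2}};(\sqrt t,t),(\sqrt s\,\xi(x,t,y,s;z,u),s)\big)(1-z_1)^{\frac{d-1}{2}}(1+z_1)^{\beta-1}(1-z_2^2)^{\beta-\frac12}\,dz ,$$ and for $\beta=0$, $$\mathbf P_n\big(W_{0,\gamma,0};(x,t),(y,s)\big)=\tfrac12\sum_{u=\pm1}\mathbf P_n\big(U_{\gamma,\frac{d-1}{2}};(\sqrt t,t),(\sqrt s\,\xi_0(x,t,y,s;u),s)\big).$$ -/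

import Mathlib

open MeasureTheory Set Filter Topology

noncomputable section

namespace Paraboloid

/-! Orthogonal polynomials for a weight `w` on a domain `D`. Points live in a measure space `P`;
`c p : σ → ℝ` is the list of Cartesian coordinates of the point `p`, at which a polynomial in the
variables `σ` is evaluated. -/

/-- The normalized inner product `(∫_D w)⁻¹ ∫_D f g w`, so that `⟨1, 1⟩ = 1`. -/
def wInner {P σ : Type} [MeasureSpace P] (c : P → σ → ℝ) (D : Set P) (w : P → ℝ)
    (f g : MvPolynomial σ ℝ) : ℝ :=
  (∫ p in D, w p)⁻¹ * ∫ p in D, MvPolynomial.eval (c p) f * MvPolynomial.eval (c p) g * w p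

/-- The space of orthogonal polynomials of degree `n`: polynomials of total degree at most `n`
that are orthogonal to every polynomial of smaller total degree. -/
def orthoPoly {P σ : Type} [MeasureSpace P] (c : P → σ → ℝ) (D : Set P) (w : P → ℝ) (n : ℕ) :
    Set (MvPolynomial σ ℝ) :=
  {f | f.totalDegree ≤ n ∧ ∀ g : MvPolynomial σ ℝ, g.totalDegree < n → wInner c D w f g = 0}

/-- `K` is the reproducing kernel of the space of orthogonal polynomials of degree `n`: for each
point `p`, `K p` is (the function given by) an element of that space, and the inner product
with it is evaluation at `p`. As the elements of the space are polynomials, `p` and the second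
argument of `K` run over the whole ambient space, not only over `D`. -/
def IsReproducingKernel {P σ : Type} [MeasureSpace P] (c : P → σ → ℝ) (D : Set P) (w : P → ℝ)
    (n : ℕ) (K : P → P → ℝ) : Prop :=
  ∀ p, ∃ k ∈ orthoPoly c D w n, (∀ q, K p q = MvPolynomial.eval (c q) k) ∧
    ∀ f ∈ orthoPoly c D w n, wInner c D w f k = MvPolynomial.eval (c p) f

/-! The parabolic domain in the plane. -/

/-- Cartesian coordinates in the plane. -/
def coordU (p : ℝ × ℝ) : Fin 2 → ℝ := ![p.1, p.2]

/-- The parabolic domain `x₁² ≤ x₂ ≤ 1`. -/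
def domainU : Set (ℝ × ℝ) := {p | p.1 ^ 2 ≤ p.2 ∧ p.2 ≤ 1}

/-- The weight `U_{a,b}(x) = (1 - x₂)^a (x₂ - x₁²)^(b - 1/2)`. -/
def weightU (a b : ℝ) (p : ℝ × ℝ) : ℝ := (1 - p.2) ^ a * (p.2 - p.1 ^ 2) ^ (b - 1 / 2)

/-- `K` is the reproducing kernel `P_n(U_{a,b}; ·, ·)`. -/
def IsKernelU (a b : ℝ) (n : ℕ) (K : ℝ × ℝ → ℝ × ℝ → ℝ) : Prop :=
  IsReproducingKernel coordU domainU (weightU a b) n K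

/-! The solid paraboloid. -/

/-- Cartesian coordinates of `(x, t) ∈ ℝ^d × ℝ`; the variable `none` stands for `t`. -/
def coordV {d : ℕ} (p : EuclideanSpace ℝ (Fin d) × ℝ) : Option (Fin d) → ℝ :=
  fun i => i.elim p.2 (fun j => p.1 j)

/-- The solid paraboloid `‖x‖² ≤ t`, `0 ≤ t ≤ 1`. -/
def domainV (d : ℕ) : Set (EuclideanSpace ℝ (Fin d) × ℝ) :=
  {p | ‖p.1‖ ^ 2 ≤ p.2 ∧ 0 ≤ p.2 ∧ p.2 ≤ 1}

/-- The weight `W_{β,γ,μ}(x,t) = t^β (1 - t)^γ (t - ‖x‖²)^(μ - 1/2)`. -/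
def weightW {d : ℕ} (β γ μ : ℝ) (p : EuclideanSpace ℝ (Fin d) × ℝ) : ℝ :=
  p.2 ^ β * (1 - p.2) ^ γ * (p.2 - ‖p.1‖ ^ 2) ^ (μ - 1 / 2)

/-- `K` is the reproducing kernel `P_n(W_{β,γ,μ}; ·, ·)` on the solid paraboloid in `ℝ^(d+1)`. -/
def IsKernelW {d : ℕ} (β γ μ : ℝ) (n : ℕ)
    (K : EuclideanSpace ℝ (Fin d) × ℝ → EuclideanSpace ℝ (Fin d) × ℝ → ℝ) : Prop :=
  IsReproducingKernel coordV (domainV d) (weightW β γ μ) n K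

/-- `c_l = Γ(l+1) / (Γ(1/2) Γ(l+1/2))`, the reciprocal of `∫_{-1}^1 (1 - t²)^(l - 1/2) dt`. -/
def gegenbauerConst (l : ℝ) : ℝ :=
  Real.Gamma (l + 1) / (Real.Gamma (1 / 2) * Real.Gamma (l + 1 / 2))

/-- `c'_{a,b} = 2^(-a-b-1) Γ(a+b+2) / (Γ(a+1) Γ(b+1))`, the reciprocal of
`∫_{-1}^1 (1 - t)^a (1 + t)^b dt`. -/
def jacobiConst (a b : ℝ) : ℝ :=
  2 ^ (-a - b - 1) * (Real.Gamma (a + b + 2) / (Real.Gamma (a + 1) * Real.Gamma (b + 1)))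

/-- `ξ₀(x,t,y,s;u) = (⟨x,y⟩ + u √(t - ‖x‖²) √(s - ‖y‖²)) / √(st)` (it is `0` if `st = 0`). -/
def xi0 {d : ℕ} (x : EuclideanSpace ℝ (Fin d)) (t : ℝ) (y : EuclideanSpace ℝ (Fin d)) (s : ℝ)
    (u : ℝ) : ℝ :=
  (inner ℝ x y + u * √(t - ‖x‖ ^ 2) * √(s - ‖y‖ ^ 2)) / √(s * t)

/-- `ξ(x,t,y,s;z,u) = (1 - z₁)/2 · ξ₀(x,t,y,s;u) + (1 + z₁)/2 · z₂`. -/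
def xi {d : ℕ} (x : EuclideanSpace ℝ (Fin d)) (t : ℝ) (y : EuclideanSpace ℝ (Fin d)) (s : ℝ)
    (z₁ z₂ u : ℝ) : ℝ :=
  (1 - z₁) / 2 * xi0 x t y s u + (1 + z₁) / 2 * z₂

/-- The interval `[-1, 1]`. -/
def I : Set ℝ := Icc (-1) 1

/-- The function of `(z₁, z₂)` by which the kernel is multiplied when `β > 0`. -/
def zWeight (d : ℕ) (β μ z₁ z₂ : ℝ) : ℝ :=
  (1 - z₁) ^ (μ + ((d : ℝ) - 1) / 2) * (1 + z₁) ^ (β - 1) * (1 - z₂ ^ 2) ^ (β - 1 / 2)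

end Paraboloid

end

/-! Both kernels come from positive moment functionals `L` (solid paraboloid) and `M` (parabolic
domain) on polynomials. Suppose `A` sends polynomials in `(v, s)` to polynomials in `(y, s)`, has an
adjoint `Q` in the sense `L (f * A h) = M (Q f * h)`, and neither map raises the degree. Then `A`
and `Q` preserve orthogonality to lower degree, and `A` carries the representative of a functional
`φ` to the representative of `φ ∘ Q` (`IsDegreeAdjoint.repr`). So it is enough to recognise the
integral on the right-hand side as such an `A`, and to check that `Q` followed by evaluation at
`(√t, t)` is evaluation at `(x, t)`. Uniqueness of representatives does the rest.

The average splits into two steps. Write `l = μ + (d-1)/2`.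

Ball step (`isDegreeAdjoint_ball`). Write `x = √t ω` and `‖ω‖² + c² = 1`; then `√s ξ₀ = ⟨ω, y⟩ + c u
√(s - ‖y‖²)`. The mean over `u` leads from the weight `s^b (1-s)^γ (s-v²)^(l-1/2)` in the plane to
`s^b (1-s)^γ (s-‖y‖²)^(μ-1/2)`. Moments of the paraboloid are Gaussian means times factors that
depend only on degrees and on the power of the defect `s - ‖y‖²`. Adjointness thus becomes an
identity for a Gaussian vector on `E × ℝ`, namely its invariance under a reflection exchanging `(ω,
c)` and `(0, 1)`.

Segment step (`isDegreeAdjoint_segment`), for `β > 0`. The mean over `z` replaces `v` by a random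
point between `v` and `√s z₂`. Scaling out `s` leaves one variable, where the average maps
`C_n^{l+β+1}` to `C_n^{l+1}` (`gegAvg_geg`): the generating function has a Beta product formula, and
`C_j^β` has mean zero for `j > 0`. Testing against the differences `C_a^σ - C_{a-2}^σ` shows that
the adjoint keeps degree, parity and the value at `1` (`exists_adjoint`).

Two degenerate cases remain. At `t = 0` the kernel of the plane domain does not depend on `v`, so
the value of `ξ₀` is irrelevant. For `μ = 0` everything is phrased through moments, which are
continuous in the parameter; the limit measure is half the sum of the point masses at `±1`. -/

noncomputable section

namespace Paraboloid

/-! ### Integrals of homogeneous functions over the solid paraboloid. -/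

section Fibration

variable {E : Type*} [NormedAddCommGroup E] [InnerProductSpace ℝ E] [FiniteDimensional ℝ E]
  [MeasurableSpace E] [BorelSpace E]

/-- The function `f(y) g(s) (s - ‖y‖²)^κ`, extended by zero from the solid paraboloid. -/
def parFun (κ : ℝ) (f : E → ℝ) (g : ℝ → ℝ) : E × ℝ → ℝ :=
  indicator {p : E × ℝ | ‖p.1‖ ^ 2 ≤ p.2} fun p => f p.1 * g p.2 * (p.2 - ‖p.1‖ ^ 2) ^ κ

lemma measurableSet_parabola : MeasurableSet {p : E × ℝ | ‖p.1‖ ^ 2 ≤ p.2} :=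
  (isClosed_le (by fun_prop) (by fun_prop)).measurableSet

lemma aestronglyMeasurable_parFun (κ : ℝ) {f : E → ℝ} {g : ℝ → ℝ} (hf : Continuous f)
    (hg : Measurable g) : AEStronglyMeasurable (parFun κ f g) (volume.prod volume) := by
  refine Measurable.aestronglyMeasurable ?_
  refine Measurable.indicator ?_ measurableSet_parabola
  have := hf.measurable
  fun_prop

/-- The density of the Gamma distribution, up to normalization. -/
def gammaFun (κ : ℝ) : ℝ → ℝ := indicator (Ici 0) fun σ => Real.exp (-σ) * σ ^ κ

lemma gammaFun_nonneg (κ σ : ℝ) : 0 ≤ gammaFun κ σ := by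
  refine indicator_nonneg (fun x hx => ?_) σ
  have : (0 : ℝ) ≤ x := hx
  positivity

lemma integrable_gammaFun {κ : ℝ} (hκ : -1 < κ) : Integrable (gammaFun κ) := by
  rw [gammaFun, integrable_indicator_iff measurableSet_Ici, integrableOn_Ici_iff_integrableOn_Ioi]
  simpa using Real.GammaIntegral_convergent (s := κ + 1) (by linarith)

lemma integral_gammaFun {κ : ℝ} (hκ : -1 < κ) : ∫ σ, gammaFun κ σ = Real.Gamma (κ + 1) := by
  rw [gammaFun, integral_indicator measurableSet_Ici, integral_Ici_eq_integral_Ioi,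
    Real.Gamma_eq_integral (by linarith)]
  simp

/-- With `σ = s - ‖y‖²` as variable, the weight `exp (-s)` splits into a Gaussian in `y` and a Gamma
density in `σ`. -/
lemma parFun_exp (κ : ℝ) (f : E → ℝ) (p : E × ℝ) :
    parFun κ f (fun s => Real.exp (-s)) p =
      f p.1 * Real.exp (-‖p.1‖ ^ 2) * gammaFun κ (p.2 - ‖p.1‖ ^ 2) := by
  by_cases h : ‖p.1‖ ^ 2 ≤ p.2
  · rw [parFun, indicator_of_mem (by exact h), gammaFun, indicator_of_mem (by simpa using h)]
    have : Real.exp (-p.2) = Real.exp (-‖p.1‖ ^ 2) * Real.exp (-(p.2 - ‖p.1‖ ^ 2)) := by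
      rw [← Real.exp_add]; ring_nf
    rw [this]; ring
  · rw [parFun, indicator_of_notMem (by exact h), gammaFun, indicator_of_notMem (by simpa using h)]
    simp

lemma integrable_parFun_exp {κ : ℝ} (hκ : -1 < κ) {f : E → ℝ} (hf : Continuous f)
    (hi : Integrable fun y => f y * Real.exp (-‖y‖ ^ 2)) :
    Integrable (parFun κ f fun s => Real.exp (-s)) (volume.prod volume) := by
  rw [integrable_prod_iff (aestronglyMeasurable_parFun κ hf (by fun_prop))]
  simp only [parFun_exp]
  refine ⟨Eventually.of_forall fun y => ((integrable_gammaFun hκ).comp_sub_right _).const_mul _, ?_⟩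
  have : (fun y : E => ∫ s, ‖f y * Real.exp (-‖y‖ ^ 2) * gammaFun κ (s - ‖y‖ ^ 2)‖) =
      fun y => ‖f y * Real.exp (-‖y‖ ^ 2)‖ * Real.Gamma (κ + 1) := by
    ext y
    simp only [norm_mul (f y * Real.exp (-‖y‖ ^ 2)), Real.norm_of_nonneg (gammaFun_nonneg κ _)]
    rw [integral_const_mul, integral_sub_right_eq_self (gammaFun κ), integral_gammaFun hκ]
  rw [this]
  exact hi.norm.mul_const _

lemma integral_parFun_exp {κ : ℝ} (hκ : -1 < κ) {f : E → ℝ} (hf : Continuous f)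
    (hi : Integrable fun y => f y * Real.exp (-‖y‖ ^ 2)) :
    ∫ p, parFun κ f (fun s => Real.exp (-s)) p ∂(volume.prod volume) =
      (∫ y, f y * Real.exp (-‖y‖ ^ 2)) * Real.Gamma (κ + 1) := by
  rw [integral_prod _ (integrable_parFun_exp hκ hf hi)]
  simp only [parFun_exp]
  rw [← integral_mul_const]
  congr 1; ext y
  rw [integral_const_mul, integral_sub_right_eq_self (gammaFun κ), integral_gammaFun hκ]

/-- The function `f(y) (1 - ‖y‖²)^κ`, extended by zero from the unit ball. -/
def ballFun (κ : ℝ) (f : E → ℝ) : E → ℝ :=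
  indicator {y : E | ‖y‖ ^ 2 ≤ 1} fun y => f y * (1 - ‖y‖ ^ 2) ^ κ

/-- A function that is homogeneous of degree `k` under positive scalings. -/
def PosHomogeneous (k : ℕ) (f : E → ℝ) : Prop := ∀ (r : ℝ) (y : E), 0 < r → f (r • y) = r ^ k * f y

/-- The slice at height `s` is a ball of radius `√s`; homogeneity of `f` pulls the scale out as a
power of `s`. -/
lemma parFun_slice {κ : ℝ} {k : ℕ} {f : E → ℝ} (hk : PosHomogeneous k f) (g : ℝ → ℝ) {s : ℝ}
    (hs : 0 < s) (y : E) :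
    parFun κ f g (y, s) = g s * s ^ (κ + (k : ℝ) / 2) * ballFun κ f ((√s)⁻¹ • y) := by
  have h0 : 0 < √s := Real.sqrt_pos.2 hs
  have hn : ‖(√s)⁻¹ • y‖ ^ 2 = ‖y‖ ^ 2 / s := by
    rw [norm_smul, mul_pow, norm_inv, inv_pow, Real.norm_of_nonneg h0.le, Real.sq_sqrt hs.le]
    ring
  by_cases h : ‖y‖ ^ 2 ≤ s
  · have hm : ‖(√s)⁻¹ • y‖ ^ 2 ≤ 1 := by rw [hn, div_le_one hs]; exact h
    rw [parFun, indicator_of_mem (by exact h), ballFun, indicator_of_mem (by exact hm), hn,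
      hk _ _ (by positivity)]
    have h1 : s - ‖y‖ ^ 2 = s * (1 - ‖y‖ ^ 2 / s) := by field_simp
    have h2 : 0 ≤ 1 - ‖y‖ ^ 2 / s := by rw [sub_nonneg, div_le_one hs]; exact h
    have h3 : s ^ ((k : ℝ) / 2) * (√s)⁻¹ ^ k = 1 := by
      rw [Real.sqrt_eq_rpow, ← Real.rpow_natCast, ← Real.rpow_neg hs.le, ← Real.rpow_mul hs.le,
        ← Real.rpow_add hs]
      ring_nf; simp
    simp only
    rw [h1, Real.mul_rpow hs.le h2, Real.rpow_add hs]
    linear_combination (-f y * g s * s ^ κ * (1 - ‖y‖ ^ 2 / s) ^ κ) * h3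
  · have hm : ¬ ‖(√s)⁻¹ • y‖ ^ 2 ≤ 1 := by rw [hn, div_le_one hs]; exact h
    rw [parFun, indicator_of_notMem (by exact h), ballFun, indicator_of_notMem (by exact hm)]
    simp

lemma parFun_slice_neg {κ : ℝ} {f : E → ℝ} (g : ℝ → ℝ) {s : ℝ} (hs : s < 0) (y : E) :
    parFun κ f g (y, s) = 0 := by
  rw [parFun, indicator_of_notMem]
  simp only [mem_ofPred_eq, not_le]
  exact hs.trans_le (by positivity)

/-- No estimate near the sphere is needed: by Fubini almost every slice of the exponentially
weighted function is integrable, and one slice at positive height is already a rescaled multiple of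
`ballFun κ f`. -/
lemma integrable_ballFun {κ : ℝ} (hκ : -1 < κ) {k : ℕ} {f : E → ℝ} (hf : Continuous f)
    (hk : PosHomogeneous k f) (hi : Integrable fun y => f y * Real.exp (-‖y‖ ^ 2)) :
    Integrable (ballFun κ f) := by
  have h := (integrable_parFun_exp hκ hf hi).prod_left_ae
  have h2 : ∃ᵐ s : ℝ, s ∈ Ioi (0 : ℝ) := frequently_ae_mem_iff.2 (by simp)
  obtain ⟨s, hs0, hs⟩ := (h2.and_eventually h).exists
  have hs0 : 0 < s := hs0
  simp only [parFun_slice hk _ hs0] at hs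
  have h3 : Real.exp (-s) * s ^ (κ + (k : ℝ) / 2) ≠ 0 := by positivity
  have h4 := (integrable_const_mul_iff (IsUnit.mk0 _ h3) _).1 hs
  exact (integrable_comp_smul_iff volume _ (inv_ne_zero (Real.sqrt_pos.2 hs0).ne')).1 h4

lemma integral_parFun_slice (κ : ℝ) {k : ℕ} {f : E → ℝ} (hk : PosHomogeneous k f) (g : ℝ → ℝ)
    {s : ℝ} (hs : 0 < s) :
    ∫ y, parFun κ f g (y, s) =
      g s * s ^ (κ + ((Module.finrank ℝ E : ℝ) + k) / 2) * ∫ y, ballFun κ f y := by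
  simp only [parFun_slice hk g hs]
  rw [integral_const_mul, Measure.integral_comp_smul]
  have h0 : 0 < √s := Real.sqrt_pos.2 hs
  have : |((√s)⁻¹ ^ Module.finrank ℝ E)⁻¹| = s ^ ((Module.finrank ℝ E : ℝ) / 2) := by
    rw [abs_of_pos (by positivity), inv_pow, inv_inv, Real.sqrt_eq_rpow, ← Real.rpow_natCast,
      ← Real.rpow_mul hs.le]
    ring_nf
  have h2 : κ + ((Module.finrank ℝ E : ℝ) + k) / 2 =
    (κ + (k : ℝ) / 2) + (Module.finrank ℝ E : ℝ) / 2 := by ring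
  rw [this, smul_eq_mul, h2, Real.rpow_add hs (κ + (k : ℝ) / 2)]
  ring

lemma integrable_parFun {κ : ℝ} (hκ : -1 < κ) {k : ℕ} {f : E → ℝ} (hf : Continuous f)
    (hk : PosHomogeneous k f) (hi : Integrable fun y => f y * Real.exp (-‖y‖ ^ 2)) {g : ℝ → ℝ}
    (hg : Measurable g)
    (hgi : IntegrableOn (fun s => g s * s ^ (κ + ((Module.finrank ℝ E : ℝ) + k) / 2)) (Ioi 0)) :
    Integrable (parFun κ f g) (volume.prod volume) := by
  rw [integrable_prod_iff' (aestronglyMeasurable_parFun κ hf hg)]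
  have hne : ∀ᵐ s : ℝ, s ≠ 0 := by simp [ae_iff]
  have hn : ∀ p : E × ℝ, ‖parFun κ f g p‖ = parFun κ (fun y => ‖f y‖) (fun s => ‖g s‖) p := by
    intro p
    by_cases h : ‖p.1‖ ^ 2 ≤ p.2
    · rw [parFun, parFun, indicator_of_mem (by exact h), indicator_of_mem (by exact h), norm_mul,
        norm_mul, Real.norm_of_nonneg (Real.rpow_nonneg (sub_nonneg.2 h) _)]
    · rw [parFun, parFun, indicator_of_notMem (by exact h), indicator_of_notMem (by exact h),
        norm_zero]
  have hk' : PosHomogeneous k fun y => ‖f y‖ := fun r y hr => by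
    simp only [hk r y hr]
    rw [norm_mul, norm_pow, Real.norm_of_nonneg hr.le]
  constructor
  · filter_upwards [hne] with s hs
    rcases lt_or_gt_of_ne hs with hs | hs
    · simp only [parFun_slice_neg g hs]; exact integrable_zero _ _ _
    · simp only [parFun_slice hk g hs]
      exact ((integrable_comp_smul_iff volume _ (inv_ne_zero (Real.sqrt_pos.2 hs).ne')).2
        (integrable_ballFun hκ hf hk hi)).const_mul _
  · simp only [hn]
    have h1 : Integrable (indicator (Ioi 0) fun s : ℝ => ‖g s‖ *
        s ^ (κ + ((Module.finrank ℝ E : ℝ) + k) / 2) * ∫ y, ballFun κ (fun y => ‖f y‖) y) := by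
      rw [integrable_indicator_iff measurableSet_Ioi]
      refine Integrable.mul_const ?_ _
      refine (integrableOn_congr_fun (fun s (hs : 0 < s) => ?_) measurableSet_Ioi).1 hgi.norm
      rw [norm_mul, Real.norm_of_nonneg (Real.rpow_nonneg hs.le _)]
    refine h1.congr ?_
    filter_upwards [hne] with s hs
    rcases lt_or_gt_of_ne hs with hs | hs
    · simp only [parFun_slice_neg _ hs]; simp [hs.le]
    · rw [indicator_of_mem (by exact hs), integral_parFun_slice κ hk' _ hs]

lemma integral_parFun_eq {κ : ℝ} {k : ℕ} {f : E → ℝ}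
    (hk : PosHomogeneous k f) {g : ℝ → ℝ} (hi : Integrable (parFun κ f g) (volume.prod volume)) :
    ∫ p, parFun κ f g p ∂(volume.prod volume) =
      (∫ y, ballFun κ f y) *
        ∫ s in Ioi 0, g s * s ^ (κ + ((Module.finrank ℝ E : ℝ) + k) / 2) := by
  rw [integral_prod_symm _ hi, ← integral_const_mul, ← integral_indicator measurableSet_Ioi]
  refine integral_congr_ae ?_
  have hne : ∀ᵐ s : ℝ, s ≠ 0 := by simp [ae_iff]
  filter_upwards [hne] with s hs
  rcases lt_or_gt_of_ne hs with hs | hs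
  · simp only [parFun_slice_neg _ hs]; simp [hs.le]
  · rw [indicator_of_mem (by exact hs), integral_parFun_slice κ hk _ hs]; ring

/-- The integral with weight `exp (-s)` is computed twice, by the shift `s = σ + ‖y‖²` and by
horizontal slices. Each way produces one Gamma function, hence the quotient. -/
lemma integral_ballFun {κ : ℝ} (hκ : -1 < κ) {k : ℕ} {f : E → ℝ} (hf : Continuous f)
    (hk : PosHomogeneous k f) (hi : Integrable fun y => f y * Real.exp (-‖y‖ ^ 2)) :
    ∫ y, ballFun κ f y = (∫ y, f y * Real.exp (-‖y‖ ^ 2)) *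
      (Real.Gamma (κ + 1) / Real.Gamma (κ + 1 + ((Module.finrank ℝ E : ℝ) + k) / 2)) := by
  have h1 := integral_parFun_exp hκ hf hi
  rw [integral_parFun_eq hk (integrable_parFun_exp hκ hf hi)] at h1
  have h2 : 0 < κ + 1 + ((Module.finrank ℝ E : ℝ) + k) / 2 := by
    have : 0 < κ + 1 := by linarith
    positivity
  rw [Real.Gamma_eq_integral h2]
  rw [← mul_div_assoc, ← h1, show κ + 1 + ((Module.finrank ℝ E : ℝ) + k) / 2 - 1 =
    κ + ((Module.finrank ℝ E : ℝ) + k) / 2 by ring, mul_div_cancel_right₀]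
  rw [show κ + ((Module.finrank ℝ E : ℝ) + k) / 2 = κ + 1 + ((Module.finrank ℝ E : ℝ) + k) / 2 - 1
    by ring, ← Real.Gamma_eq_integral h2]
  exact (Real.Gamma_pos_of_pos h2).ne'

/-- `∫_0^1 s^x (1-s)^γ ds`. -/
def betaInt (γ x : ℝ) : ℝ := ∫ s in Icc (0 : ℝ) 1, s ^ x * (1 - s) ^ γ

lemma ofReal_betaIntegrand (γ x : ℝ) {s : ℝ} (hs : s ∈ Icc (0 : ℝ) 1) :
    ((s ^ x * (1 - s) ^ γ : ℝ) : ℂ) =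
      (s : ℂ) ^ (((x + 1 : ℝ) : ℂ) - 1) * (1 - (s : ℂ)) ^ (((γ + 1 : ℝ) : ℂ) - 1) := by
  rw [Complex.ofReal_mul, Complex.ofReal_cpow hs.1, Complex.ofReal_cpow (sub_nonneg.2 hs.2)]
  push_cast
  simp

lemma integrableOn_betaInt {γ x : ℝ} (hγ : -1 < γ) (hx : -1 < x) :
    IntegrableOn (fun s : ℝ => s ^ x * (1 - s) ^ γ) (Icc 0 1) := by
  have h := Complex.betaIntegral_convergent (u := ((x + 1 : ℝ) : ℂ)) (v := ((γ + 1 : ℝ) : ℂ))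
    (by simp; linarith) (by simp; linarith)
  rw [intervalIntegrable_iff_integrableOn_Icc_of_le zero_le_one] at h
  refine ((integrableOn_congr_fun (fun s hs => ?_) measurableSet_Icc).1 h.re)
  rw [← ofReal_betaIntegrand γ x hs]
  simp

lemma betaInt_eq {γ x : ℝ} (hγ : -1 < γ) (hx : -1 < x) : betaInt γ x =
    Real.Gamma (x + 1) * Real.Gamma (γ + 1) / Real.Gamma (x + γ + 2) := by
  have h := Complex.betaIntegral_eq_Gamma_mul_div ((x + 1 : ℝ) : ℂ) ((γ + 1 : ℝ) : ℂ)
    (by simp; linarith) (by simp; linarith)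
  rw [Complex.betaIntegral, intervalIntegral.integral_of_le zero_le_one,
    ← integral_Icc_eq_integral_Ioc,
    ← setIntegral_congr_fun measurableSet_Icc (fun s hs => ofReal_betaIntegrand γ x hs),
    integral_complex_ofReal, ← Complex.ofReal_add, Complex.Gamma_ofReal, Complex.Gamma_ofReal,
    Complex.Gamma_ofReal] at h
  rw [betaInt, show x + γ + 2 = x + 1 + (γ + 1) by ring]
  exact_mod_cast h

lemma betaInt_pos {γ x : ℝ} (hγ : -1 < γ) (hx : -1 < x) : 0 < betaInt γ x := by
  rw [betaInt_eq hγ hx]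
  have h1 := Real.Gamma_pos_of_pos (show 0 < x + 1 by linarith)
  have h2 := Real.Gamma_pos_of_pos (show 0 < γ + 1 by linarith)
  have h3 := Real.Gamma_pos_of_pos (show 0 < x + γ + 2 by linarith)
  positivity

/-- The solid paraboloid over a Euclidean space. -/
def parDomain (E : Type*) [NormedAddCommGroup E] : Set (E × ℝ) := {p | ‖p.1‖ ^ 2 ≤ p.2 ∧ p.2 ≤ 1}

/-- The weight `s^b (1 - s)^γ (s - ‖y‖²)^κ`. -/
def parWeight (b γ κ : ℝ) (p : E × ℝ) : ℝ := p.2 ^ b * (1 - p.2) ^ γ * (p.2 - ‖p.1‖ ^ 2) ^ κ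

lemma measurableSet_parDomain : MeasurableSet (parDomain E) :=
  measurableSet_parabola.inter (measurableSet_le measurable_snd measurable_const)

lemma indicator_parDomain (b γ κ : ℝ) (j : ℕ) (f : E → ℝ) :
    indicator (parDomain E) (fun p : E × ℝ => f p.1 * p.2 ^ j * parWeight b γ κ p) =
      parFun κ f (indicator (Icc 0 1) fun s => s ^ j * s ^ b * (1 - s) ^ γ) := by
  ext p
  by_cases h : ‖p.1‖ ^ 2 ≤ p.2
  · rw [parFun, indicator_of_mem (show p ∈ {p : E × ℝ | ‖p.1‖ ^ 2 ≤ p.2} from h)]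
    by_cases h1 : p.2 ≤ 1
    · rw [indicator_of_mem (show p ∈ parDomain E from ⟨h, h1⟩),
        indicator_of_mem (show p.2 ∈ Icc (0 : ℝ) 1 from ⟨le_trans (by positivity) h, h1⟩), parWeight]
      ring
    · rw [indicator_of_notMem (show p ∉ parDomain E from fun h' => h1 h'.2),
        indicator_of_notMem (show p.2 ∉ Icc (0 : ℝ) 1 from fun h' => h1 h'.2)]
      ring
  · rw [parFun, indicator_of_notMem (show p ∉ {p : E × ℝ | ‖p.1‖ ^ 2 ≤ p.2} from h),
      indicator_of_notMem (show p ∉ parDomain E from fun h' => h h'.1)]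

variable {b γ κ : ℝ} {k j : ℕ} {f : E → ℝ}

lemma integrand_parWeight_eq (e : ℝ) {s : ℝ} (hs : s ∈ Ioi (0 : ℝ)) :
    indicator (Icc 0 1) (fun s => s ^ j * s ^ b * (1 - s) ^ γ) s * s ^ e =
      indicator (Icc 0 1) (fun s => s ^ (b + e + j) * (1 - s) ^ γ) s := by
  by_cases h : s ∈ Icc (0 : ℝ) 1
  · have hs' : 0 < s := hs
    rw [indicator_of_mem h, indicator_of_mem h, Real.rpow_add hs', Real.rpow_add hs',
      Real.rpow_natCast]
    ring
  · rw [indicator_of_notMem h, indicator_of_notMem h, zero_mul]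

lemma integrable_parFun_weight (hγ : -1 < γ) (hκ : -1 < κ)
    (hb : -1 < b + κ + (Module.finrank ℝ E : ℝ) / 2) (hf : Continuous f)
    (hk : PosHomogeneous k f) (hi : Integrable fun y => f y * Real.exp (-‖y‖ ^ 2)) :
    Integrable (parFun κ f (indicator (Icc 0 1) fun s => s ^ j * s ^ b * (1 - s) ^ γ))
      (volume.prod volume) := by
  refine integrable_parFun hκ hf hk hi (Measurable.indicator (by fun_prop) measurableSet_Icc) ?_
  refine (integrableOn_congr_fun (fun s hs => integrand_parWeight_eq _ hs) measurableSet_Ioi).2 ?_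
  refine Integrable.integrableOn ?_
  rw [integrable_indicator_iff measurableSet_Icc]
  refine integrableOn_betaInt hγ ?_
  have : (0 : ℝ) ≤ k := by positivity
  have : (0 : ℝ) ≤ j := by positivity
  linarith

lemma integrableOn_parWeight (hγ : -1 < γ) (hκ : -1 < κ)
    (hb : -1 < b + κ + (Module.finrank ℝ E : ℝ) / 2) (hf : Continuous f)
    (hk : PosHomogeneous k f) (hi : Integrable fun y => f y * Real.exp (-‖y‖ ^ 2)) :
    IntegrableOn (fun p : E × ℝ => f p.1 * p.2 ^ j * parWeight b γ κ p) (parDomain E)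
      (volume.prod volume) := by
  rw [← integrable_indicator_iff measurableSet_parDomain, indicator_parDomain]
  exact integrable_parFun_weight hγ hκ hb hf hk hi

/-- Apart from its Gaussian integral, `f` enters only through its degree `k`. This is what later
reduces identities on the paraboloid to Gaussian ones. The condition `hb` is integrability at the
vertex. -/
lemma integral_parWeight (hγ : -1 < γ) (hκ : -1 < κ)
    (hb : -1 < b + κ + (Module.finrank ℝ E : ℝ) / 2) (hf : Continuous f)
    (hk : PosHomogeneous k f) (hi : Integrable fun y => f y * Real.exp (-‖y‖ ^ 2)) :
    ∫ p in parDomain E, f p.1 * p.2 ^ j * parWeight b γ κ p ∂(volume.prod volume) =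
      (∫ y, f y * Real.exp (-‖y‖ ^ 2)) *
      (Real.Gamma (κ + 1) / Real.Gamma (κ + 1 + ((Module.finrank ℝ E : ℝ) + k) / 2)) *
      betaInt γ (b + κ + (Module.finrank ℝ E : ℝ) / 2 + j + k / 2) := by
  rw [← integral_indicator measurableSet_parDomain, indicator_parDomain,
    integral_parFun_eq hk (integrable_parFun_weight hγ hκ hb hf hk hi),
    integral_ballFun hκ hf hk hi,
    setIntegral_congr_fun measurableSet_Ioi (fun s hs => integrand_parWeight_eq _ hs),
    setIntegral_indicator measurableSet_Icc, betaInt]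
  congr 1
  have h : Ioi (0 : ℝ) ∩ Icc 0 1 = Ioc 0 1 := by
    ext s; simp only [mem_inter_iff, mem_Ioi, mem_Icc, mem_Ioc]
    constructor
    · exact fun h => ⟨h.1, h.2.2⟩
    · exact fun h => ⟨h.1, h.1.le, h.2⟩
  rw [h, integral_Icc_eq_integral_Ioc]
  congr 1; ext s
  ring_nf

end Fibration

end Paraboloid

end

noncomputable section

namespace Paraboloid

open MvPolynomial

/-! ### Orthogonal polynomials of a moment functional and adjoint pairs of operators. -/

section Functional

variable {σ τ : Type} (L : MvPolynomial σ ℝ →ₗ[ℝ] ℝ) (n : ℕ)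

/-- Polynomials of degree at most `n` that are orthogonal to lower degree for `(f, g) ↦ L (f g)`. -/
def orthoSubmodule : Submodule ℝ (MvPolynomial σ ℝ) where
  carrier := {f | f.totalDegree ≤ n ∧ ∀ g : MvPolynomial σ ℝ, g.totalDegree < n → L (f * g) = 0}
  add_mem' {f g} hf hg := ⟨(totalDegree_add f g).trans (max_le hf.1 hg.1), fun h hh => by
    rw [add_mul, map_add, hf.2 h hh, hg.2 h hh, add_zero]⟩
  zero_mem' := ⟨by simp, by simp⟩
  smul_mem' r f hf := ⟨(totalDegree_smul_le r f).trans hf.1, fun h hh => by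
    rw [smul_mul_assoc, map_smul, hf.2 h hh, smul_zero]⟩

lemma mem_orthoSubmodule {f : MvPolynomial σ ℝ} : f ∈ orthoSubmodule L n ↔
    f.totalDegree ≤ n ∧ ∀ g : MvPolynomial σ ℝ, g.totalDegree < n → L (f * g) = 0 := Iff.rfl

instance [Finite σ] : Module.Finite ℝ (orthoSubmodule L n) := by
  have : orthoSubmodule L n ≤ restrictTotalDegree σ ℝ n := fun f hf =>
    (mem_restrictTotalDegree _ _ _).2 hf.1
  exact Submodule.finiteDimensional_of_le this

variable {L}

lemma orthoSubmodule_eq_of_repr (hL : ∀ f, L (f * f) = 0 → f = 0) {k k' : MvPolynomial σ ℝ}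
    (hk : k ∈ orthoSubmodule L n) (hk' : k' ∈ orthoSubmodule L n)
    (h : ∀ f ∈ orthoSubmodule L n, L (f * k) = L (f * k')) : k = k' := by
  refine sub_eq_zero.1 (hL _ ?_)
  have := h _ (sub_mem hk hk')
  rw [mul_sub, map_sub, this, sub_self]

/-- Riesz representation in finite dimension: definiteness makes the map to the dual injective,
hence surjective. -/
lemma exists_repr [Finite σ] (hL : ∀ f, L (f * f) = 0 → f = 0) (φ : MvPolynomial σ ℝ →ₗ[ℝ] ℝ) :
    ∃ k ∈ orthoSubmodule L n, ∀ f ∈ orthoSubmodule L n, L (f * k) = φ f := by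
  let V := orthoSubmodule L n
  let B : V →ₗ[ℝ] Module.Dual ℝ V :=
    LinearMap.mk₂ ℝ (fun k f : V => L ((f : MvPolynomial σ ℝ) * k))
      (fun _ _ _ => by simp [mul_add]) (fun _ _ _ => by simp)
      (fun _ _ _ => by simp [add_mul]) (fun _ _ _ => by simp)
  have hB : Function.Injective B := by
    rw [injective_iff_map_eq_zero]
    intro k hk
    have : L ((k : MvPolynomial σ ℝ) * k) = 0 := by
      simpa [B] using congrArg (fun l => l k) hk
    exact Subtype.ext (hL _ this)
  obtain ⟨k, hk⟩ := (LinearMap.injective_iff_surjective_of_finrank_eq_finrank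
    Subspace.dual_finrank_eq.symm).1 hB (φ.comp V.subtype)
  refine ⟨k, k.2, fun f hf => ?_⟩
  simpa [B] using congrArg (fun l => l ⟨f, hf⟩) hk

/-- `A` and `Q` do not raise the degree and are adjoint with respect to `L` and `M`. -/
structure IsDegreeAdjoint (L : MvPolynomial σ ℝ →ₗ[ℝ] ℝ) (M : MvPolynomial τ ℝ →ₗ[ℝ] ℝ)
    (A : MvPolynomial τ ℝ →ₗ[ℝ] MvPolynomial σ ℝ) (Q : MvPolynomial σ ℝ →ₗ[ℝ] MvPolynomial τ ℝ) :
    Prop where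
  left_degree : ∀ h, (A h).totalDegree ≤ h.totalDegree
  right_degree : ∀ f, (Q f).totalDegree ≤ f.totalDegree
  adjoint : ∀ f h, L (f * A h) = M (Q f * h)

lemma IsDegreeAdjoint.comp {υ : Type} {L : MvPolynomial σ ℝ →ₗ[ℝ] ℝ} {M : MvPolynomial τ ℝ →ₗ[ℝ] ℝ}
    {N : MvPolynomial υ ℝ →ₗ[ℝ] ℝ}
    {A : MvPolynomial τ ℝ →ₗ[ℝ] MvPolynomial σ ℝ} {Q : MvPolynomial σ ℝ →ₗ[ℝ] MvPolynomial τ ℝ}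
    {A' : MvPolynomial υ ℝ →ₗ[ℝ] MvPolynomial τ ℝ} {Q' : MvPolynomial τ ℝ →ₗ[ℝ] MvPolynomial υ ℝ}
    (h : IsDegreeAdjoint L M A Q) (h' : IsDegreeAdjoint M N A' Q') :
    IsDegreeAdjoint L N (A ∘ₗ A') (Q' ∘ₗ Q) where
  left_degree g := (h.left_degree _).trans (h'.left_degree _)
  right_degree g := (h'.right_degree _).trans (h.right_degree _)
  adjoint f g := by simp only [LinearMap.comp_apply]; rw [h.adjoint, h'.adjoint]

/-- Since neither operator raises the degree, orthogonality to lower degree passes through the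
adjoint identity in both directions. With `φ` a point evaluation this turns one reproducing kernel
into another. -/
lemma IsDegreeAdjoint.repr {n : ℕ} {L : MvPolynomial σ ℝ →ₗ[ℝ] ℝ} {M : MvPolynomial τ ℝ →ₗ[ℝ] ℝ}
    {A : MvPolynomial τ ℝ →ₗ[ℝ] MvPolynomial σ ℝ} {Q : MvPolynomial σ ℝ →ₗ[ℝ] MvPolynomial τ ℝ}
    (h : IsDegreeAdjoint L M A Q) {k : MvPolynomial τ ℝ} (hk : k ∈ orthoSubmodule M n)
    {φ : MvPolynomial τ ℝ →ₗ[ℝ] ℝ} (hφ : ∀ f ∈ orthoSubmodule M n, M (f * k) = φ f) :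
    A k ∈ orthoSubmodule L n ∧ ∀ f ∈ orthoSubmodule L n, L (f * A k) = φ (Q f) := by
  refine ⟨⟨(h.left_degree k).trans hk.1, fun g hg => ?_⟩, fun f hf => ?_⟩
  · rw [mul_comm, h.adjoint, mul_comm]
    exact hk.2 _ ((h.right_degree g).trans_lt hg)
  · rw [h.adjoint]
    refine hφ _ ⟨(h.right_degree f).trans hf.1, fun g hg => ?_⟩
    rw [← h.adjoint]
    exact hf.2 _ ((h.left_degree g).trans_lt hg)

/-- The linear map with prescribed values on monomials. -/
def monoMap (φ : (σ →₀ ℕ) → MvPolynomial τ ℝ) : MvPolynomial σ ℝ →ₗ[ℝ] MvPolynomial τ ℝ :=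
  (basisMonomials σ ℝ).constr ℝ φ

lemma monoMap_monomial (φ : (σ →₀ ℕ) → MvPolynomial τ ℝ) (m : σ →₀ ℕ) (r : ℝ) :
    monoMap φ (monomial m r) = r • φ m := by
  have : monomial m r = r • basisMonomials σ ℝ m := by
    rw [coe_basisMonomials, smul_monomial, smul_eq_mul, mul_one]
  rw [this, map_smul, monoMap, Module.Basis.constr_basis]

lemma totalDegree_monoMap_le {φ : (σ →₀ ℕ) → MvPolynomial τ ℝ}
    (hφ : ∀ m, (φ m).totalDegree ≤ m.degree) (f : MvPolynomial σ ℝ) :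
    (monoMap φ f).totalDegree ≤ f.totalDegree := by
  conv_lhs => rw [f.as_sum, map_sum]
  refine totalDegree_finsetSum_le fun m hm => ?_
  rw [monoMap_monomial]
  exact ((totalDegree_smul_le _ _).trans (hφ m)).trans (le_totalDegree hm)

lemma linearMap_ext_monomial {M : Type*} [AddCommMonoid M] [Module ℝ M]
    {l l' : MvPolynomial σ ℝ →ₗ[ℝ] M} (h : ∀ m, l (monomial m 1) = l' (monomial m 1)) : l = l' :=
  (basisMonomials σ ℝ).ext fun m => by simpa using h m

lemma isDegreeAdjoint_monoMap {L : MvPolynomial σ ℝ →ₗ[ℝ] ℝ} {M : MvPolynomial τ ℝ →ₗ[ℝ] ℝ}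
    {φ : (τ →₀ ℕ) → MvPolynomial σ ℝ} {ψ : (σ →₀ ℕ) → MvPolynomial τ ℝ}
    (hφ : ∀ m, (φ m).totalDegree ≤ m.degree) (hψ : ∀ m, (ψ m).totalDegree ≤ m.degree)
    (h : ∀ m m', L (monomial m 1 * φ m') = M (ψ m * monomial m' 1)) :
    IsDegreeAdjoint L M (monoMap φ) (monoMap ψ) where
  left_degree := totalDegree_monoMap_le hφ
  right_degree := totalDegree_monoMap_le hψ
  adjoint f g := by
    have key (m) : L ∘ₗ LinearMap.mulLeft ℝ (monomial m 1) ∘ₗ monoMap φ =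
        M ∘ₗ LinearMap.mulLeft ℝ (ψ m) :=
      linearMap_ext_monomial fun m' => by simpa [monoMap_monomial] using h m m'
    have key' : L ∘ₗ LinearMap.mulRight ℝ (monoMap φ g) =
        M ∘ₗ LinearMap.mulRight ℝ g ∘ₗ monoMap ψ :=
      linearMap_ext_monomial fun m => by
        simpa [monoMap_monomial] using LinearMap.congr_fun (key m) g
    simpa using LinearMap.congr_fun key' f

end Functional

/-! ### Reproducing kernels of a weight: existence and uniqueness. -/

section Weight

variable {P σ : Type} [MeasureSpace P] {c : P → σ → ℝ} {D : Set P} {w : P → ℝ}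

/-- The normalized integral against a weight for which all polynomials are integrable. -/
def weightFun (hw : ∀ f, IntegrableOn (fun p => eval (c p) f * w p) D) :
    MvPolynomial σ ℝ →ₗ[ℝ] ℝ where
  toFun f := (∫ p in D, w p)⁻¹ * ∫ p in D, eval (c p) f * w p
  map_add' f g := by
    simp only [map_add, add_mul]
    rw [integral_add (hw f) (hw g), mul_add]
  map_smul' r f := by
    simp only [smul_eval, mul_assoc, RingHom.id_apply, smul_eq_mul]
    rw [integral_const_mul]; ring

lemma weightFun_apply (hw : ∀ f, IntegrableOn (fun p => eval (c p) f * w p) D)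
    (f : MvPolynomial σ ℝ) :
    weightFun hw f = (∫ p in D, w p)⁻¹ * ∫ p in D, eval (c p) f * w p := rfl

lemma wInner_eq (hw : ∀ f, IntegrableOn (fun p => eval (c p) f * w p) D) (f g : MvPolynomial σ ℝ) :
    wInner c D w f g = weightFun hw (f * g) := by
  simp [wInner, weightFun_apply]

lemma mem_orthoPoly (hw : ∀ f, IntegrableOn (fun p => eval (c p) f * w p) D) {n : ℕ}
    {f : MvPolynomial σ ℝ} : f ∈ orthoPoly c D w n ↔ f ∈ orthoSubmodule (weightFun hw) n := by
  simp only [orthoPoly, mem_ofPred_eq, wInner_eq hw, mem_orthoSubmodule]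

/-- Evaluation at a point as a linear functional. -/
def evalFun (a : σ → ℝ) : MvPolynomial σ ℝ →ₗ[ℝ] ℝ := (aeval a).toLinearMap

lemma evalFun_apply (a : σ → ℝ) (f : MvPolynomial σ ℝ) : evalFun a f = eval a f := by
  simp [evalFun, aeval_eq_eval]

lemma isReproducingKernel_iff (hw : ∀ f, IntegrableOn (fun p => eval (c p) f * w p) D) {n : ℕ}
    {K : P → P → ℝ} : IsReproducingKernel c D w n K ↔
      ∀ p, ∃ k ∈ orthoSubmodule (weightFun hw) n, (∀ q, K p q = eval (c q) k) ∧
        ∀ f ∈ orthoSubmodule (weightFun hw) n, weightFun hw (f * k) = evalFun (c p) f := by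
  simp only [IsReproducingKernel, mem_orthoPoly hw, wInner_eq hw, evalFun_apply]

lemma IsReproducingKernel.eq_eval (hw : ∀ f, IntegrableOn (fun p => eval (c p) f * w p) D)
    (hL : ∀ f, weightFun hw (f * f) = 0 → f = 0) {n : ℕ} {K : P → P → ℝ}
    (hK : IsReproducingKernel c D w n K) {k : MvPolynomial σ ℝ}
    (hk : k ∈ orthoSubmodule (weightFun hw) n) {p : P}
    (h : ∀ f ∈ orthoSubmodule (weightFun hw) n, weightFun hw (f * k) = evalFun (c p) f) (q : P) :
    K p q = eval (c q) k := by
  obtain ⟨k', hk', hK', h'⟩ := (isReproducingKernel_iff hw).1 hK p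
  rw [hK', orthoSubmodule_eq_of_repr n hL hk hk' fun f hf => (h f hf).trans (h' f hf).symm]

lemma existsUnique_kernel [Finite σ] (hw : ∀ f, IntegrableOn (fun p => eval (c p) f * w p) D)
    (hL : ∀ f, weightFun hw (f * f) = 0 → f = 0) (n : ℕ) :
    ∃! K : P → P → ℝ, IsReproducingKernel c D w n K := by
  choose k hk h using fun p => exists_repr n hL (evalFun (c p))
  refine ⟨fun p q => eval (c q) (k p), (isReproducingKernel_iff hw).2
    fun p => ⟨k p, hk p, fun _ => rfl, h p⟩, fun K hK => ?_⟩
  ext p q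
  exact hK.eq_eval hw hL (hk p) (h p) q

/-- If the integral of `f² w` vanishes, then `f` vanishes almost everywhere on `O`, by continuity
everywhere on `O`, and so on a product of infinite sets, which forces `f = 0`. -/
lemma weightFun_definite [TopologicalSpace P] [OpensMeasurableSpace P]
    [(volume : Measure P).IsOpenPosMeasure]
    (hw : ∀ f, IntegrableOn (fun p => eval (c p) f * w p) D) (hD : MeasurableSet D)
    (hc : Continuous c) (hw0 : ∀ p ∈ D, 0 ≤ w p)
    {O : Set P} (hO : IsOpen O) (hOD : O ⊆ D) (hwO : ∀ p ∈ O, 0 < w p)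
    (s : σ → Set ℝ) (hs : ∀ i, (s i).Infinite) (hsO : ∀ a ∈ Set.pi univ s, ∃ p ∈ O, c p = a)
    (f : MvPolynomial σ ℝ) (hf : weightFun hw (f * f) = 0) : f = 0 := by
  have key : ∀ g : MvPolynomial σ ℝ, ∫ p in D, eval (c p) (g * g) * w p = 0 → g = 0 := by
    intro g hg
    have hnn : 0 ≤ᵐ[volume.restrict D] fun p => eval (c p) (g * g) * w p :=
      (ae_restrict_iff' hD).2 (Eventually.of_forall fun p hp => by
        simp only [map_mul]; exact mul_nonneg (mul_self_nonneg _) (hw0 p hp))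
    have h0 := ae_restrict_of_ae_restrict_of_subset hOD
      ((integral_eq_zero_iff_of_nonneg_ae hnn (hw (g * g))).1 hg)
    have h1 : (fun p => eval (c p) g) =ᵐ[volume.restrict O] fun _ => 0 := by
      filter_upwards [h0, ae_restrict_mem hO.measurableSet] with p hp hpO
      have := (hwO p hpO).ne'
      simpa [this] using hp
    have h2 := Measure.eqOn_open_of_ae_eq h1 hO
      ((MvPolynomial.continuous_eval g).comp hc).continuousOn continuousOn_const
    refine funext_set s hs fun a ha => ?_
    obtain ⟨p, hp, rfl⟩ := hsO a ha
    simpa using h2 hp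
  rw [weightFun_apply] at hf
  rcases mul_eq_zero.1 hf with h | h
  -- A zero normalizing integral would have inverse `0`; `key` for the polynomial `1` excludes this.
  · exact absurd (key 1 (by simpa using inv_eq_zero.1 h)) one_ne_zero
  · exact key f h

end Weight

end Paraboloid

end

noncomputable section

namespace Paraboloid

/-! ### Gaussian means, moments and rotation invariance. -/

section Gaussian

variable {E : Type*} [NormedAddCommGroup E] [InnerProductSpace ℝ E] [FiniteDimensional ℝ E]
  [MeasurableSpace E] [BorelSpace E]

lemma integrable_exp_neg_mul_sq_norm {b : ℝ} (hb : 0 < b) :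
    Integrable fun y : E => Real.exp (-b * ‖y‖ ^ 2) := by
  have h := (GaussianFourier.integrable_cexp_neg_mul_sq_norm_add (V := E) (b := (b : ℂ))
    (by simpa using hb) 0 0).norm
  refine h.congr (Eventually.of_forall fun y => ?_)
  simp only [Complex.norm_exp]
  simp [← Complex.ofReal_pow]

/-- Half of the Gaussian absorbs the power: `r^k ≤ 1 + r^(2k) ≤ (1 + k! 2^k) exp (r²/2)`. -/
lemma integrable_norm_pow_mul_gaussian (k : ℕ) :
    Integrable fun y : E => ‖y‖ ^ k * Real.exp (-‖y‖ ^ 2) := by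
  refine ((integrable_exp_neg_mul_sq_norm (E := E) (b := 1 / 2) (by norm_num)).const_mul
    (1 + k.factorial * 2 ^ k)).mono' (by fun_prop) (Eventually.of_forall fun y => ?_)
  set r := ‖y‖
  have hr : 0 ≤ r := norm_nonneg y
  rw [Real.norm_of_nonneg (by positivity)]
  have h1 : (r ^ 2 / 2) ^ k / k.factorial ≤ Real.exp (r ^ 2 / 2) :=
    Real.pow_div_factorial_le_exp _ (by positivity) k
  have h2 : r ^ k ≤ 1 + (r ^ 2) ^ k := by
    have : r ^ k = r ^ k * 1 := by ring
    nlinarith [sq_nonneg (r ^ k - 1), sq_nonneg (r ^ k), pow_nonneg hr k,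
      (by ring : (r ^ 2) ^ k = (r ^ k) ^ 2)]
  have h3 : (r ^ 2) ^ k ≤ k.factorial * 2 ^ k * Real.exp (r ^ 2 / 2) := by
    have h4 : (r ^ 2) ^ k = k.factorial * 2 ^ k * ((r ^ 2 / 2) ^ k / k.factorial) := by
      rw [div_pow]; field_simp
    rw [h4]; gcongr
  have h5 : 1 ≤ Real.exp (r ^ 2 / 2) := Real.one_le_exp (by positivity)
  have h6 : Real.exp (-r ^ 2) = Real.exp (-(1 / 2) * r ^ 2) * Real.exp (-(r ^ 2 / 2)) := by
    rw [← Real.exp_add]; ring_nf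
  have h7 : Real.exp (r ^ 2 / 2) * Real.exp (-(r ^ 2 / 2)) = 1 := by
    rw [← Real.exp_add]; simp
  calc r ^ k * Real.exp (-r ^ 2)
      ≤ ((1 + k.factorial * 2 ^ k) * Real.exp (r ^ 2 / 2)) * Real.exp (-r ^ 2) := by
        gcongr; linarith
    _ = (1 + k.factorial * 2 ^ k) * Real.exp (-(1 / 2) * r ^ 2) := by
        rw [h6]; linear_combination (1 + k.factorial * 2 ^ k) * Real.exp (-(1 / 2) * r ^ 2) * h7

/-- A bound `C` on the unit ball gives `|f y| ≤ C ‖y‖^k` everywhere. -/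
lemma PosHomogeneous.integrable {k : ℕ} {f : E → ℝ} (hk : PosHomogeneous k f) (hf : Continuous f) :
    Integrable fun y => f y * Real.exp (-‖y‖ ^ 2) := by
  obtain ⟨C, hC⟩ := (isCompact_closedBall (0 : E) 1).exists_bound_of_continuousOn hf.continuousOn
  refine ((integrable_norm_pow_mul_gaussian (E := E) k).const_mul C).mono' (by fun_prop)
    (Eventually.of_forall fun y => ?_)
  rw [norm_mul, Real.norm_of_nonneg (Real.exp_pos _).le, ← mul_assoc]
  gcongr
  rcases eq_or_ne y 0 with rfl | hy
  · rcases k.eq_zero_or_pos with rfl | hk0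
    · simpa using hC 0 (by simp)
    -- Homogeneity concerns positive factors only; scaling by `2` forces `f 0 = 0` when `k > 0`.
    · have h := hk 2 0 (by norm_num)
      have h2 : (1 : ℝ) < 2 ^ k := one_lt_pow₀ (by norm_num) hk0.ne'
      rw [smul_zero] at h
      have : f 0 = 0 := by
        have : (2 ^ k - 1) * f 0 = 0 := by linarith
        exact (mul_eq_zero.1 this).resolve_left (by linarith)
      rw [this]; simp [hk0.ne']
  · have hy' : 0 < ‖y‖ := norm_pos_iff.2 hy
    have h := hk ‖y‖ (‖y‖⁻¹ • y) hy'
    rw [smul_inv_smul₀ hy'.ne'] at h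
    rw [h, norm_mul, norm_pow, norm_norm, mul_comm]
    gcongr
    exact hC _ (by simp [norm_smul, hy'.ne'])

lemma PosHomogeneous.mul {k l : ℕ} {f g : E → ℝ} (hf : PosHomogeneous k f)
    (hg : PosHomogeneous l g) : PosHomogeneous (k + l) fun y => f y * g y := fun r y hr => by
  simp only [hf r y hr, hg r y hr]; ring

lemma PosHomogeneous.pow {k : ℕ} {f : E → ℝ} (hf : PosHomogeneous k f) (n : ℕ) :
    PosHomogeneous (k * n) fun y => f y ^ n := fun r y hr => by
  simp only [hf r y hr]; ring

lemma posHomogeneous_inner (ω : E) : PosHomogeneous 1 fun y => inner ℝ ω y := fun r y _ => by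
  simp [inner_smul_right]

lemma posHomogeneous_pow (n : ℕ) : PosHomogeneous n fun v : ℝ => v ^ n := fun r y _ => by
  simp [mul_pow]

/-- The mean of a function under the Gaussian distribution with density proportional to
`exp (-‖y‖²)`. -/
def gaussMean (f : E → ℝ) : ℝ :=
  (∫ y : E, Real.exp (-‖y‖ ^ 2))⁻¹ * ∫ y, f y * Real.exp (-‖y‖ ^ 2)

lemma integral_gaussian_pos : 0 < ∫ y : E, Real.exp (-‖y‖ ^ 2) := by
  have h := integrable_norm_pow_mul_gaussian (E := E) 0
  simp only [pow_zero, one_mul] at h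
  rw [integral_pos_iff_support_of_nonneg (fun y => (Real.exp_pos _).le) h]
  have : Function.support (fun y : E => Real.exp (-‖y‖ ^ 2)) = univ := by
    ext y; simp [(Real.exp_pos _).ne']
  rw [this]; exact Measure.measure_univ_pos.2 (NeZero.ne _)

/-- The moments of the one-dimensional Gaussian distribution with density `π^(-1/2) exp (-v²)`. -/
def gaussMoment : ℕ → ℝ
  | 0 => 1
  | 1 => 0
  | n + 2 => (n + 1) / 2 * gaussMoment n

lemma gaussMoment_odd {n : ℕ} (hn : Odd n) : gaussMoment n = 0 := by
  obtain ⟨m, rfl⟩ := hn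
  induction m with
  | zero => rfl
  | succ m ih => rw [show 2 * (m + 1) + 1 = (2 * m + 1) + 2 by ring, gaussMoment, ih, mul_zero]

/-- The recursion of `gaussMoment` is integration by parts: the derivative of `v^(n+1) exp (-v²)`
has integral zero. -/
lemma gaussMean_pow (n : ℕ) : gaussMean (fun v : ℝ => v ^ n) = gaussMoment n := by
  have hi (n : ℕ) : Integrable fun v : ℝ => v ^ n * Real.exp (-‖v‖ ^ 2) :=
    (posHomogeneous_pow n).integrable (by fun_prop)
  simp only [Real.norm_eq_abs, sq_abs] at hi
  have he (v : ℝ) : HasDerivAt (fun v : ℝ => Real.exp (-v ^ 2)) (-2 * v * Real.exp (-v ^ 2)) v := by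
    have h : HasDerivAt (fun v : ℝ => -v ^ 2) (-(2 * v)) v := by
      convert! (hasDerivAt_pow 2 v).neg using 1
      simp
    convert! h.exp using 1
    ring
  simp only [gaussMean, Real.norm_eq_abs, sq_abs]
  have hpos : (∫ v : ℝ, Real.exp (-v ^ 2)) ≠ 0 := by
    simpa using (integral_gaussian_pos (E := ℝ)).ne'
  induction n using gaussMoment.induct with
  | case1 => simp [gaussMoment, hpos]
  | case2 =>
    have h := integral_eq_zero_of_hasDerivAt_of_integrable he
      ((hi 1).const_mul (-2) |>.congr (Eventually.of_forall fun v => by simp [mul_assoc]))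
      ((hi 0).congr (Eventually.of_forall fun v => by simp))
    have h2 : ∫ v : ℝ, v ^ 1 * Real.exp (-v ^ 2) = 0 := by
      simp only [mul_assoc] at h
      rw [integral_const_mul] at h
      simpa using h
    rw [h2, gaussMoment, mul_zero]
  | case3 n ih =>
    have hd (v : ℝ) : HasDerivAt (fun v : ℝ => v ^ (n + 1) * Real.exp (-v ^ 2))
        ((n + 1) * (v ^ n * Real.exp (-v ^ 2)) - 2 * (v ^ (n + 2) * Real.exp (-v ^ 2))) v := by
      convert! (hasDerivAt_pow (n + 1) v).mul (he v) using 1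
      push_cast; simp; ring
    have h := integral_eq_zero_of_hasDerivAt_of_integrable hd
      (((hi n).const_mul _).sub ((hi (n + 2)).const_mul _)) (hi (n + 1))
    rw [integral_sub ((hi n).const_mul _) ((hi (n + 2)).const_mul _), integral_const_mul,
      integral_const_mul] at h
    have h2 : ∫ v : ℝ, v ^ (n + 2) * Real.exp (-v ^ 2) =
        (n + 1) / 2 * ∫ v : ℝ, v ^ n * Real.exp (-v ^ 2) := by linarith
    rw [h2, gaussMoment, ← ih]; ring

lemma integral_comp_isometry_prod (R : WithLp 2 (E × ℝ) ≃ₗᵢ[ℝ] WithLp 2 (E × ℝ))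
    (H : E × ℝ → ℝ) :
    ∫ p, H p ∂(volume.prod volume) =
      ∫ p, H (R (WithLp.toLp 2 p)).ofLp ∂(volume.prod volume) := by
  have h1 := WithLp.volume_preserving_symm_measurableEquiv_toLp_prod E ℝ
  have h2 (H : E × ℝ → ℝ) : ∫ p, H p ∂(volume.prod volume) = ∫ q : WithLp 2 (E × ℝ), H q.ofLp :=
    (h1.integral_comp' H).symm
  rw [h2 H, h2, ← (R.measurePreserving).integral_comp
    (R.toHomeomorph.toMeasurableEquiv.measurableEmbedding)]

/-- Under the standard Gaussian on `E × ℝ`, the pair `(y, ⟨ω, y⟩ + c v)` with `‖ω‖² + c² = 1` has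
the same distribution as `(v ω + T y, v)` for some linear map `T`. -/
lemma exists_gaussian_rotation (ω : E) (c : ℝ) (h : ‖ω‖ ^ 2 + c ^ 2 = 1) :
    ∃ T : E →L[ℝ] E, ∀ H : E → ℝ → ℝ,
      ∫ p : E × ℝ, H p.1 (inner ℝ ω p.1 + c * p.2) *
          (Real.exp (-‖p.1‖ ^ 2) * Real.exp (-‖p.2‖ ^ 2)) ∂(volume.prod volume) =
        ∫ p : E × ℝ, H (p.2 • ω + T p.1) p.2 *
          (Real.exp (-‖p.1‖ ^ 2) * Real.exp (-‖p.2‖ ^ 2)) ∂(volume.prod volume) := by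
  let e : WithLp 2 (E × ℝ) := WithLp.toLp 2 (ω, c)
  let n : WithLp 2 (E × ℝ) := WithLp.toLp 2 (0, 1)
  have hen : ‖e‖ = ‖n‖ := by
    rw [← sq_eq_sq₀ (norm_nonneg _) (norm_nonneg _), WithLp.prod_norm_sq_eq_of_L2,
      WithLp.prod_norm_sq_eq_of_L2]
    simp [e, n, h]
  -- `e` and `n` are unit vectors, so the reflection in the hyperplane orthogonal to `e - n`
  -- exchanges them.
  let R := Submodule.reflection (ℝ ∙ (e - n))ᗮ
  have hR : R e = n := Submodule.reflection_sub hen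
  have hR' : R n = e := by rw [← hR]; exact Submodule.reflection_reflection _ _
  let T : E →L[ℝ] E := ((WithLp.fstL 2 ℝ E ℝ).comp (R.toLinearIsometry.toContinuousLinearMap)).comp
    ((WithLp.prodContinuousLinearEquiv 2 ℝ E ℝ).symm.toContinuousLinearMap.comp
      (ContinuousLinearMap.inl ℝ E ℝ))
  refine ⟨T, fun H => ?_⟩
  rw [integral_comp_isometry_prod R]
  congr 1; ext ⟨y, v⟩
  -- Split `(y, v) = v n + (y, 0)`; `R n = e` has `E`-component `ω`, and `T` records what `R` does
  -- to `(y, 0)`.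
  have h1 : (R (WithLp.toLp 2 (y, v))).ofLp.1 = v • ω + T y := by
    have : (WithLp.toLp 2 (y, v) : WithLp 2 (E × ℝ)) = v • n + WithLp.toLp 2 (y, 0) := by
      refine WithLp.ofLp_injective 2 (Prod.ext ?_ ?_) <;> simp [n]
    rw [this, map_add, map_smul, hR']
    rfl
  have h2 : inner ℝ ω (R (WithLp.toLp 2 (y, v))).ofLp.1 + c * (R (WithLp.toLp 2 (y, v))).ofLp.2 =
      v := by
    -- As `e = R n` and `R` is an isometry, this is the inner product of `n` with `(y, v)`.
    have : inner ℝ e (R (WithLp.toLp 2 (y, v))) = v := by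
      rw [← hR', R.inner_map_map]
      simp [n]
    rw [WithLp.prod_inner_apply] at this
    simpa [e, mul_comm] using this
  have h3 : ‖(R (WithLp.toLp 2 (y, v))).ofLp.1‖ ^ 2 + ‖(R (WithLp.toLp 2 (y, v))).ofLp.2‖ ^ 2 =
      ‖y‖ ^ 2 + ‖v‖ ^ 2 := by
    have := WithLp.prod_norm_sq_eq_of_L2 (R (WithLp.toLp 2 (y, v)))
    rw [R.norm_map, WithLp.prod_norm_sq_eq_of_L2] at this
    exact this.symm
  have h4 (a b : ℝ) : Real.exp (-a ^ 2) * Real.exp (-b ^ 2) = Real.exp (-(a ^ 2 + b ^ 2)) := by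
    rw [← Real.exp_add]; ring_nf
  simp only [h4]
  rw [h3, h2, h1]

end Gaussian

end Paraboloid

end

noncomputable section

namespace Paraboloid

/-! ### Normalized moments of the solid paraboloid. -/

section ParMean

variable {E : Type*} [NormedAddCommGroup E] [InnerProductSpace ℝ E] [FiniteDimensional ℝ E]
  [MeasurableSpace E] [BorelSpace E]

/-- The normalized integral over the solid paraboloid. -/
def parMean (b γ κ : ℝ) (F : E × ℝ → ℝ) : ℝ :=
  (∫ p in parDomain E, parWeight b γ κ p ∂(volume.prod volume))⁻¹ *
    ∫ p in parDomain E, F p * parWeight b γ κ p ∂(volume.prod volume)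

variable {b γ κ : ℝ} {k : ℕ} {f : E → ℝ}

lemma parWeight_mul_pow (hκ : -1 < κ) (q : ℕ) {p : E × ℝ} (hp : p ∈ parDomain E) :
    (p.2 - ‖p.1‖ ^ 2) ^ q * parWeight b γ κ p = parWeight b γ (κ + q) p := by
  rw [parWeight, parWeight]
  rcases q.eq_zero_or_pos with rfl | hq
  · simp
  · have h0 : 0 ≤ p.2 - ‖p.1‖ ^ 2 := sub_nonneg.2 hp.1
    have hq' : (1 : ℝ) ≤ q := by exact_mod_cast hq
    -- On the boundary the base is zero; the exponents still add because `κ + q > 0` for `q ≥ 1`.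
    rw [Real.rpow_add' h0 (by linarith), Real.rpow_natCast]
    ring

lemma integrand_monomial (hκ : -1 < κ) (f : E → ℝ) (j q : ℕ) {p : E × ℝ} (hp : p ∈ parDomain E) :
    f p.1 * p.2 ^ j * (p.2 - ‖p.1‖ ^ 2) ^ q * parWeight b γ κ p =
      f p.1 * p.2 ^ j * parWeight b γ (κ + q) p := by
  rw [mul_assoc (f p.1 * p.2 ^ j), parWeight_mul_pow hκ q hp]

lemma integrableOn_parMean_monomial (hγ : -1 < γ) (hκ : -1 < κ)
    (hb : -1 < b + (κ + (Module.finrank ℝ E : ℝ) / 2)) (hk : PosHomogeneous k f)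
    (hf : Continuous f) (j q : ℕ) :
    IntegrableOn (fun p : E × ℝ => f p.1 * p.2 ^ j * (p.2 - ‖p.1‖ ^ 2) ^ q * parWeight b γ κ p)
      (parDomain E) (volume.prod volume) := by
  have hq : (0 : ℝ) ≤ q := q.cast_nonneg
  refine (integrableOn_congr_fun (fun p hp => integrand_monomial hκ f j q hp)
    measurableSet_parDomain).2 ?_
  exact integrableOn_parWeight hγ (by linarith) (by linarith) hf hk (hk.integrable hf)

lemma integral_eq_gaussMean (f : E → ℝ) : ∫ y, f y * Real.exp (-‖y‖ ^ 2) =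
    gaussMean f * ∫ y : E, Real.exp (-‖y‖ ^ 2) := by
  have := (integral_gaussian_pos (E := E)).ne'
  rw [gaussMean]; field_simp

/-- Apart from the factor `Γ(κ+q+1)/Γ(κ+1)` of the defect, the dimension and `κ` are felt only
through `gaussMean f` and `l`. Hence moments on the paraboloid can be matched with plane ones that
have the same `l`, that is, with `κ` replaced by `l - 1/2`. -/
lemma parMean_monomial (hγ : -1 < γ) (hκ : -1 < κ)
    (hb : -1 < b + (κ + (Module.finrank ℝ E : ℝ) / 2)) (hk : PosHomogeneous k f)
    (hf : Continuous f) (j q : ℕ) {l : ℝ} (hl : l = κ + (Module.finrank ℝ E : ℝ) / 2) :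
    parMean b γ κ (fun p : E × ℝ => f p.1 * p.2 ^ j * (p.2 - ‖p.1‖ ^ 2) ^ q) =
      gaussMean f * (Real.Gamma (κ + q + 1) / Real.Gamma (κ + 1)) *
        (Real.Gamma (l + 1) / Real.Gamma (l + 1 + q + k / 2)) *
        (betaInt γ (b + l + q + j + k / 2) / betaInt γ (b + l)) := by
  subst hl
  have hq : (0 : ℝ) ≤ q := q.cast_nonneg
  have hk0 : (0 : ℝ) ≤ k := k.cast_nonneg
  have hd : (0 : ℝ) ≤ Module.finrank ℝ E := Nat.cast_nonneg _
  have h1 : ∫ p in parDomain E, parWeight b γ κ p ∂(volume.prod volume) =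
      (∫ y : E, Real.exp (-‖y‖ ^ 2)) * (Real.Gamma (κ + 1) /
        Real.Gamma (κ + (Module.finrank ℝ E : ℝ) / 2 + 1)) *
        betaInt γ (b + (κ + (Module.finrank ℝ E : ℝ) / 2)) := by
    have h1 : PosHomogeneous 0 fun _ : E => (1 : ℝ) := fun _ _ _ => by simp
    have := integral_parWeight (b := b) (j := 0) hγ hκ (by linarith) continuous_const h1
      (h1.integrable continuous_const)
    simp only [one_mul, pow_zero] at this
    rw [this]
    congr 2
    · congr 2; push_cast; ring
    · push_cast; ring
  have h2 := setIntegral_congr_fun (μ := volume.prod volume) measurableSet_parDomain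
    (fun p (hp : p ∈ parDomain E) => integrand_monomial (b := b) (γ := γ) hκ f j q hp)
  rw [parMean, h1, h2, integral_parWeight hγ (by linarith) (by linarith) hf hk (hk.integrable hf),
    integral_eq_gaussMean]
  have hG := (integral_gaussian_pos (E := E)).ne'
  have hG1 := (Real.Gamma_pos_of_pos (show 0 < κ + 1 by linarith)).ne'
  have hG2 := (Real.Gamma_pos_of_pos
    (show 0 < κ + (Module.finrank ℝ E : ℝ) / 2 + 1 by linarith)).ne'
  have hB := (betaInt_pos hγ hb).ne'
  rw [show κ + q + 1 + ((Module.finrank ℝ E : ℝ) + k) / 2 =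
    κ + (Module.finrank ℝ E : ℝ) / 2 + 1 + q + k / 2 by ring,
    show b + (κ + q) + (Module.finrank ℝ E : ℝ) / 2 + j + k / 2 =
      b + (κ + (Module.finrank ℝ E : ℝ) / 2) + q + j + k / 2 by ring]
  field_simp

end ParMean

/-- The moments of the probability measure proportional to `(1 - u²)^(κ - 1/2)` on `[-1, 1]`. -/
def gegMoment (κ : ℝ) (i : ℕ) : ℝ :=
  gaussMoment i * (Real.Gamma (κ + 1) / Real.Gamma (κ + 1 + i / 2))

/-! ### Restricting homogeneous polynomials to lines, and the resulting Gaussian identity. -/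

section Slice

variable {E : Type*} [NormedAddCommGroup E] [InnerProductSpace ℝ E] [FiniteDimensional ℝ E]
  [MeasurableSpace E] [BorelSpace E]

/-- A family of one-variable polynomials `F y` of degree at most `k` whose value at `v` is jointly
homogeneous of degree `k` in `(y, v)`; `ℓ` is the coefficient of degree `k`. -/
structure IsSliceFamily (k : ℕ) (ℓ : ℝ) (F : E → Polynomial ℝ) : Prop where
  cont : ∀ q, Continuous fun y => (F y).coeff q
  homog : ∀ q (r : ℝ) y, r ^ q * (F (r • y)).coeff q = r ^ k * (F y).coeff q
  degree : ∀ y, (F y).natDegree ≤ k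
  lead : ∀ y, (F y).coeff k = ℓ

lemma IsSliceFamily.one : IsSliceFamily 0 1 fun _ : E => (1 : Polynomial ℝ) where
  cont _ := continuous_const
  homog q r y := by
    rcases q.eq_zero_or_pos with rfl | hq
    · simp
    · simp [Polynomial.coeff_one, hq.ne']
  degree _ := by simp
  lead _ := by simp

lemma IsSliceFamily.mul {k k' : ℕ} {ℓ ℓ' : ℝ} {F F' : E → Polynomial ℝ}
    (h : IsSliceFamily k ℓ F) (h' : IsSliceFamily k' ℓ' F') :
    IsSliceFamily (k + k') (ℓ * ℓ') fun y => F y * F' y where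
  cont q := by
    simp only [Polynomial.coeff_mul]
    exact continuous_finsetSum _ fun i _ => (h.cont _).mul (h'.cont _)
  homog q r y := by
    simp only [Polynomial.coeff_mul, Finset.mul_sum]
    refine Finset.sum_congr rfl fun i hi => ?_
    rw [← Finset.HasAntidiagonal.mem_antidiagonal.1 hi, pow_add, pow_add]
    linear_combination (r ^ i.2 * (F' (r • y)).coeff i.2) * h.homog i.1 r y +
      (r ^ k * (F y).coeff i.1) * h'.homog i.2 r y
  degree y := Polynomial.natDegree_mul_le.trans (add_le_add (h.degree y) (h'.degree y))
  lead y := by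
    rw [Polynomial.coeff_mul_add_eq_of_natDegree_le (h.degree y) (h'.degree y), h.lead, h'.lead]

lemma IsSliceFamily.linear (T : E →L[ℝ] ℝ) (a : ℝ) :
    IsSliceFamily 1 a fun y => Polynomial.C (T y) + Polynomial.X * Polynomial.C a where
  cont q := by
    rcases q with _ | _ | q
    · simpa using T.continuous
    · simpa using continuous_const
    · simpa using continuous_const
  homog q r y := by
    rcases q with _ | _ | q
    · simp
    · simp
    · simp
  degree y := by compute_degree
  lead y := by simp

lemma IsSliceFamily.pow {k : ℕ} {ℓ : ℝ} {F : E → Polynomial ℝ} (h : IsSliceFamily k ℓ F) (n : ℕ) :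
    IsSliceFamily (n * k) (ℓ ^ n) fun y => F y ^ n := by
  induction n with
  | zero => simpa using IsSliceFamily.one
  | succ n ih => simpa only [pow_succ, add_mul, one_mul] using ih.mul h

lemma IsSliceFamily.prod {ι : Type*} (s : Finset ι) {k : ι → ℕ} {ℓ : ι → ℝ}
    {F : ι → E → Polynomial ℝ} (h : ∀ i, IsSliceFamily (k i) (ℓ i) (F i)) :
    IsSliceFamily (∑ i ∈ s, k i) (∏ i ∈ s, ℓ i) fun y => ∏ i ∈ s, F i y := by
  classical
  induction s using Finset.induction_on with
  | empty => simpa using IsSliceFamily.one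
  | insert i s hi ih => simpa only [Finset.prod_insert hi, Finset.sum_insert hi] using (h i).mul ih

/-- The field `homog` carries the factor `r ^ q` on the left so that it makes sense for all `q` and
multiplies well; here the common power is cancelled. -/
lemma IsSliceFamily.coeff_smul {k : ℕ} {ℓ : ℝ} {F : E → Polynomial ℝ} (h : IsSliceFamily k ℓ F)
    {q : ℕ} (hq : q ≤ k) {r : ℝ} (hr : r ≠ 0) (y : E) :
    (F (r • y)).coeff (k - q) = r ^ q * (F y).coeff (k - q) := by
  have := h.homog (k - q) r y
  rw [show r ^ k = r ^ (k - q) * r ^ q by rw [← pow_add]; congr 1; omega, mul_assoc] at this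
  exact mul_left_cancel₀ (pow_ne_zero _ hr) this

lemma gaussMean_odd {f : E → ℝ} (hf : ∀ y, f (-y) = -f y) : gaussMean f = 0 := by
  have : ∫ y, f y * Real.exp (-‖y‖ ^ 2) = -∫ y, f y * Real.exp (-‖y‖ ^ 2) := by
    conv_lhs => rw [← integral_neg_eq_self]
    simp [hf, integral_neg]
  rw [gaussMean, show ∫ y, f y * Real.exp (-‖y‖ ^ 2) = 0 by linarith, mul_zero]

lemma IsSliceFamily.gaussMean_coeff_odd {k : ℕ} {ℓ : ℝ} {F : E → Polynomial ℝ}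
    (h : IsSliceFamily k ℓ F) {q : ℕ} (hq : q ≤ k) (ho : Odd q) :
    gaussMean (fun y => (F y).coeff (k - q)) = 0 := by
  refine gaussMean_odd fun y => ?_
  have := h.coeff_smul hq (r := -1) (by norm_num) y
  rw [ho.neg_one_pow] at this
  simpa using this

/-- The rotation identity for `H y v = f y * v ^ i`, expanded on the left by the binomial theorem
and on the right in powers of `v` along the line `v ω + T y`. -/
lemma gaussMean_slice {k : ℕ} {f : E → ℝ} (hk : PosHomogeneous k f) (hf : Continuous f) {ω : E}
    {c : ℝ} {T : E →L[ℝ] E}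
    (hT : ∀ H : E → ℝ → ℝ,
      ∫ p : E × ℝ, H p.1 (inner ℝ ω p.1 + c * p.2) *
          (Real.exp (-‖p.1‖ ^ 2) * Real.exp (-‖p.2‖ ^ 2)) ∂(volume.prod volume) =
        ∫ p : E × ℝ, H (p.2 • ω + T p.1) p.2 *
          (Real.exp (-‖p.1‖ ^ 2) * Real.exp (-‖p.2‖ ^ 2)) ∂(volume.prod volume))
    {ℓ : ℝ} {F : E → Polynomial ℝ} (hF : IsSliceFamily k ℓ F)
    (hFf : ∀ y v, f (v • ω + T y) = (F y).eval v) (i : ℕ) :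
    ∑ q ∈ Finset.range (i + 1), (i.choose q : ℝ) * c ^ q *
        gaussMean (fun y => f y * inner ℝ ω y ^ (i - q)) * gaussMoment q =
      ∑ q ∈ Finset.range (k + 1),
        gaussMean (fun y => (F y).coeff (k - q)) * gaussMoment (k - q + i) := by
  have h := hT fun y v => f y * v ^ i
  have hl (p : E × ℝ) : f p.1 * (inner ℝ ω p.1 + c * p.2) ^ i *
      (Real.exp (-‖p.1‖ ^ 2) * Real.exp (-‖p.2‖ ^ 2)) = ∑ q ∈ Finset.range (i + 1),
        (i.choose q : ℝ) * c ^ q * ((f p.1 * inner ℝ ω p.1 ^ (i - q) * Real.exp (-‖p.1‖ ^ 2)) *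
          (p.2 ^ q * Real.exp (-‖p.2‖ ^ 2))) := by
    rw [add_comm, add_pow, Finset.mul_sum, Finset.sum_mul]
    refine Finset.sum_congr rfl fun q _ => ?_
    rw [mul_pow]; ring
  have hr (p : E × ℝ) : f (p.2 • ω + T p.1) * p.2 ^ i *
      (Real.exp (-‖p.1‖ ^ 2) * Real.exp (-‖p.2‖ ^ 2)) = ∑ q ∈ Finset.range (k + 1),
        (((F p.1).coeff (k - q) * Real.exp (-‖p.1‖ ^ 2)) *
          (p.2 ^ (k - q + i) * Real.exp (-‖p.2‖ ^ 2))) := by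
    rw [hFf, Polynomial.eval_eq_sum_range' (Nat.lt_succ_of_le (hF.degree _)),
      ← Finset.sum_range_reflect, Finset.sum_mul, Finset.sum_mul]
    refine Finset.sum_congr rfl fun q _ => ?_
    rw [show k + 1 - 1 - q = k - q by omega, pow_add]; ring
  have hv (n : ℕ) : Integrable fun v : ℝ => v ^ n * Real.exp (-‖v‖ ^ 2) :=
    (posHomogeneous_pow n).integrable (by fun_prop)
  have hp (g : E → ℝ) (n : ℕ) : ∫ p : E × ℝ, (g p.1 * Real.exp (-‖p.1‖ ^ 2)) *
      (p.2 ^ n * Real.exp (-‖p.2‖ ^ 2)) ∂(volume.prod volume) =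
      gaussMean g * gaussMoment n * ((∫ y : E, Real.exp (-‖y‖ ^ 2)) *
        ∫ v : ℝ, Real.exp (-‖v‖ ^ 2)) := by
    rw [integral_prod_mul (fun y : E => g y * Real.exp (-‖y‖ ^ 2))
      (fun v : ℝ => v ^ n * Real.exp (-‖v‖ ^ 2)), integral_eq_gaussMean,
      integral_eq_gaussMean (fun v : ℝ => v ^ n), gaussMean_pow]
    ring
  simp only [hl, hr] at h
  rw [integral_finsetSum, integral_finsetSum] at h
  · rw [Finset.sum_congr rfl fun q _ => hp (fun y => (F y).coeff (k - q)) (k - q + i)] at h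
    rw [Finset.sum_congr rfl fun q _ => (integral_const_mul _ _).trans
      (congrArg _ (hp (fun y => f y * inner ℝ ω y ^ (i - q)) q))] at h
    have hG := (integral_gaussian_pos (E := E)).ne'
    have hG1 := (integral_gaussian_pos (E := ℝ)).ne'
    refine mul_right_cancel₀ (mul_ne_zero hG hG1) ?_
    rw [Finset.sum_mul, Finset.sum_mul]
    convert! h using 1
    exact Finset.sum_congr rfl fun q _ => by ring
  · intro q hq
    refine Integrable.mul_prod (f := fun y : E => (F y).coeff (k - q) * Real.exp (-‖y‖ ^ 2)) ?_
      (hv _)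
    have hq' : q ≤ k := Nat.lt_succ_iff.1 (Finset.mem_range.1 hq)
    exact PosHomogeneous.integrable (fun r y hr => hF.coeff_smul hq' hr.ne' y) (hF.cont _)
  · intro q _
    refine Integrable.const_mul ?_ _
    refine Integrable.mul_prod
      (f := fun y : E => f y * inner ℝ ω y ^ (i - q) * Real.exp (-‖y‖ ^ 2)) ?_ (hv _)
    exact (hk.mul ((posHomogeneous_inner ω).pow _)).integrable (by fun_prop)

end Slice

end Paraboloid

end

noncomputable section

namespace Paraboloid

open MvPolynomial

/-! ### The two moment functionals and their definiteness. -/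

section Functionals

variable {d : ℕ} {b γ κ l : ℝ}

lemma finset_degree_option (m : Option (Fin d) →₀ ℕ) :
    m.degree = m none + ∑ j, m (some j) := by
  rw [Finsupp.degree_eq_sum, Fintype.sum_option]

lemma eval_coordV_monomial (m : Option (Fin d) →₀ ℕ) (r : ℝ) (p : EuclideanSpace ℝ (Fin d) × ℝ) :
    eval (coordV p) (monomial m r) = r * ((∏ j, p.1 j ^ m (some j)) * p.2 ^ m none) := by
  rw [eval_monomial, Finsupp.prod_fintype _ _ (by simp), Fintype.prod_option]
  simp [coordV, mul_comm]

lemma eval_coordU_monomial (m : Fin 2 →₀ ℕ) (r : ℝ) (p : ℝ × ℝ) :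
    eval (coordU p) (monomial m r) = r * (p.1 ^ m 0 * p.2 ^ m 1) := by
  rw [eval_monomial, Finsupp.prod_fintype _ _ (by simp), Fin.prod_univ_two]
  simp [coordU]

lemma posHomogeneous_monomial (a : Fin d → ℕ) :
    PosHomogeneous (∑ j, a j) fun y : EuclideanSpace ℝ (Fin d) => ∏ j, y j ^ a j := fun r y _ => by
  simp [mul_pow, Finset.prod_mul_distrib, Finset.prod_pow_eq_pow_sum]

lemma integrableOn_parV (hγ : -1 < γ) (hκ : -1 < κ) (hb : -1 < b + (κ + (d : ℝ) / 2))
    (f : MvPolynomial (Option (Fin d)) ℝ) :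
    IntegrableOn (fun p => eval (coordV p) f * parWeight b γ κ p)
      (parDomain (EuclideanSpace ℝ (Fin d))) := by
  induction f using MvPolynomial.monomial_add_induction_on with
  | C r =>
    have := integrableOn_parMean_monomial (E := EuclideanSpace ℝ (Fin d)) (b := b) hγ hκ (by simpa using hb)
      (f := fun _ => r) (k := 0) (fun _ _ _ => by simp) continuous_const 0 0
    rw [← Measure.volume_eq_prod] at this
    simpa using this
  | monomial_add m r f _ _ ih =>
    simp only [map_add, add_mul]
    refine Integrable.add ?_ ih
    have := (integrableOn_parMean_monomial (E := EuclideanSpace ℝ (Fin d)) (b := b) hγ hκ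
      (by simpa using hb)
      (posHomogeneous_monomial fun j => m (some j)) (by fun_prop) (m none) 0).const_mul r
    rw [← Measure.volume_eq_prod] at this
    simpa [eval_coordV_monomial, mul_assoc] using this

lemma integrableOn_parU (hγ : -1 < γ) (hκ : -1 < κ) (hb : -1 < b + (κ + 1 / 2))
    (f : MvPolynomial (Fin 2) ℝ) :
    IntegrableOn (fun p => eval (coordU p) f * parWeight b γ κ p) (parDomain ℝ) := by
  induction f using MvPolynomial.monomial_add_induction_on with
  | C r =>
    have := integrableOn_parMean_monomial (E := ℝ) (b := b) hγ hκ (by simpa using hb)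
      (f := fun _ => r) (k := 0) (fun _ _ _ => by simp) continuous_const 0 0
    rw [← Measure.volume_eq_prod] at this
    simpa using this
  | monomial_add m r f _ _ ih =>
    simp only [map_add, add_mul]
    refine Integrable.add ?_ ih
    have := (integrableOn_parMean_monomial (E := ℝ) (b := b) hγ hκ (by simpa using hb)
      (posHomogeneous_pow (m 0)) (by fun_prop) (m 1) 0).const_mul r
    rw [← Measure.volume_eq_prod] at this
    simpa [eval_coordU_monomial, mul_assoc] using this

/-- The moment functional of the weight `s^b (1-s)^γ (s-‖y‖²)^κ` on the solid paraboloid. -/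
def parV (d : ℕ) (hγ : -1 < γ) (hκ : -1 < κ) (hb : -1 < b + (κ + (d : ℝ) / 2)) :
    MvPolynomial (Option (Fin d)) ℝ →ₗ[ℝ] ℝ :=
  weightFun (integrableOn_parV hγ hκ hb)

/-- The moment functional of the weight `s^b (1-s)^γ (s-v²)^κ` on the parabolic domain. -/
def parU (hγ : -1 < γ) (hκ : -1 < κ) (hb : -1 < b + (κ + 1 / 2)) :
    MvPolynomial (Fin 2) ℝ →ₗ[ℝ] ℝ :=
  weightFun (integrableOn_parU hγ hκ hb)

lemma parV_eq (hγ : -1 < γ) (hκ : -1 < κ) (hb : -1 < b + (κ + (d : ℝ) / 2)) {k : ℕ}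
    {f : EuclideanSpace ℝ (Fin d) → ℝ} (hk : PosHomogeneous k f) (hf : Continuous f) (j q : ℕ)
    (hl : l = κ + (d : ℝ) / 2) {F : MvPolynomial (Option (Fin d)) ℝ}
    (hF : ∀ p, eval (coordV p) F = f p.1 * p.2 ^ j * (p.2 - ‖p.1‖ ^ 2) ^ q) :
    parV d hγ hκ hb F = gaussMean f * (Real.Gamma (κ + q + 1) / Real.Gamma (κ + 1)) *
        (Real.Gamma (l + 1) / Real.Gamma (l + 1 + q + k / 2)) *
        (betaInt γ (b + l + q + j + k / 2) / betaInt γ (b + l)) := by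
  rw [← parMean_monomial hγ hκ (by simpa using hb) hk hf j q (by simpa using hl), parV,
    weightFun_apply, parMean]
  simp only [hF]
  rfl

lemma parU_eq (hγ : -1 < γ) (hκ : -1 < κ) (hb : -1 < b + (κ + 1 / 2)) (i j q : ℕ)
    (hl : l = κ + 1 / 2) {F : MvPolynomial (Fin 2) ℝ}
    (hF : ∀ p, eval (coordU p) F = p.1 ^ i * p.2 ^ j * (p.2 - p.1 ^ 2) ^ q) :
    parU hγ hκ hb F = gaussMoment i * (Real.Gamma (κ + q + 1) / Real.Gamma (κ + 1)) *
        (Real.Gamma (l + 1) / Real.Gamma (l + 1 + q + i / 2)) *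
        (betaInt γ (b + l + q + j + i / 2) / betaInt γ (b + l)) := by
  rw [← gaussMean_pow, ← parMean_monomial hγ hκ (by simpa using hb) (posHomogeneous_pow i)
    (by fun_prop) j q (by simpa using hl), parU, weightFun_apply, parMean]
  simp only [hF, Real.norm_eq_abs, sq_abs]
  rfl

lemma parU_monomial (hγ : -1 < γ) (hκ : -1 < κ) (hb : -1 < b + (κ + 1 / 2)) (m : Fin 2 →₀ ℕ)
    (hl : l = κ + 1 / 2) :
    parU hγ hκ hb (monomial m 1) =
      gegMoment l (m 0) * (betaInt γ (b + l + m 1 + (m 0 : ℝ) / 2) / betaInt γ (b + l)) := by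
  rw [parU_eq hγ hκ hb (m 0) (m 1) 0 hl (fun p => by rw [eval_coordU_monomial]; ring), gegMoment]
  have := (Real.Gamma_pos_of_pos (show 0 < κ + 1 by linarith)).ne'
  simp [this]

lemma continuous_coordV : Continuous (coordV (d := d)) := by
  refine continuous_pi fun i => ?_
  cases i with
  | none => exact continuous_snd
  | some j => simp only [coordV, Option.elim]; fun_prop

lemma continuous_coordU : Continuous coordU := by
  refine continuous_pi fun i => ?_
  fin_cases i
  · exact continuous_fst
  · exact continuous_snd

lemma isOpen_parInterior (E : Type*) [NormedAddCommGroup E] :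
    IsOpen {p : E × ℝ | ‖p.1‖ ^ 2 < p.2 ∧ p.2 < 1} :=
  IsOpen.inter (s := {p : E × ℝ | ‖p.1‖ ^ 2 < p.2}) (t := {p : E × ℝ | p.2 < 1})
    (isOpen_lt (by fun_prop) (by fun_prop)) (isOpen_lt (by fun_prop) (by fun_prop))

lemma parInterior_subset (E : Type*) [NormedAddCommGroup E] :
    {p : E × ℝ | ‖p.1‖ ^ 2 < p.2 ∧ p.2 < 1} ⊆ parDomain E := fun _ hp => ⟨hp.1.le, hp.2.le⟩

lemma parWeight_nonneg {E : Type*} [NormedAddCommGroup E] {p : E × ℝ} (hp : p ∈ parDomain E) :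
    0 ≤ parWeight b γ κ p := by
  have h0 : 0 ≤ p.2 := le_trans (by positivity) hp.1
  exact mul_nonneg (mul_nonneg (Real.rpow_nonneg h0 _) (Real.rpow_nonneg (sub_nonneg.2 hp.2) _))
    (Real.rpow_nonneg (sub_nonneg.2 hp.1) _)

lemma parWeight_pos {E : Type*} [NormedAddCommGroup E] {p : E × ℝ}
    (hp : p ∈ {p : E × ℝ | ‖p.1‖ ^ 2 < p.2 ∧ p.2 < 1}) : 0 < parWeight b γ κ p := by
  have h0 : 0 < p.2 := lt_of_le_of_lt (by positivity) hp.1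
  exact mul_pos (mul_pos (Real.rpow_pos_of_pos h0 _) (Real.rpow_pos_of_pos (sub_pos.2 hp.2) _))
    (Real.rpow_pos_of_pos (sub_pos.2 hp.1) _)

lemma parV_definite (hγ : -1 < γ) (hκ : -1 < κ) (hb : -1 < b + (κ + (d : ℝ) / 2))
    (f : MvPolynomial (Option (Fin d)) ℝ) (hf : parV d hγ hκ hb (f * f) = 0) : f = 0 := by
  refine weightFun_definite (integrableOn_parV hγ hκ hb) measurableSet_parDomain continuous_coordV
    (fun p hp => parWeight_nonneg hp) (isOpen_parInterior _) (parInterior_subset _)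
    (fun p hp => parWeight_pos hp)
    -- A box inside the open paraboloid: these bounds give `‖y‖² ≤ d / (2(d+1))² < 1/2 < s`.
    (fun i => i.elim (Ioo (1 / 2) 1) fun _ => Ioo 0 (1 / (2 * (d + 1)))) ?_ ?_ f hf
  · intro i
    cases i with
    | none => exact Ioo_infinite (by norm_num)
    | some j => exact Ioo_infinite (by positivity)
  · intro a ha
    refine ⟨(WithLp.toLp 2 fun j => a (some j), a none), ⟨?_, (ha none trivial).2⟩, ?_⟩
    · rw [EuclideanSpace.norm_sq_eq]
      have h1 (j : Fin d) : ‖a (some j)‖ ^ 2 ≤ (1 / (2 * (d + 1))) ^ 2 := by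
        have := ha (some j) trivial
        simp only [Option.elim, mem_Ioo] at this
        rw [Real.norm_of_nonneg this.1.le]
        exact pow_le_pow_left₀ this.1.le this.2.le 2
      have h2 : (d : ℝ) * (1 / (2 * (d + 1))) ^ 2 < 1 / 2 := by
        rw [div_pow, one_pow, mul_one_div, div_lt_div_iff₀ (by positivity) (by norm_num)]
        have : (0 : ℝ) ≤ d := d.cast_nonneg
        nlinarith
      calc ∑ j, ‖a (some j)‖ ^ 2 ≤ ∑ _j : Fin d, (1 / (2 * ((d : ℝ) + 1))) ^ 2 :=
            Finset.sum_le_sum fun j _ => h1 j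
        _ = (d : ℝ) * (1 / (2 * (d + 1))) ^ 2 := by simp
        _ < 1 / 2 := h2
        _ < a none := (ha none trivial).1
    · ext i; cases i <;> rfl

lemma parU_definite (hγ : -1 < γ) (hκ : -1 < κ) (hb : -1 < b + (κ + 1 / 2))
    (f : MvPolynomial (Fin 2) ℝ) (hf : parU hγ hκ hb (f * f) = 0) : f = 0 := by
  refine weightFun_definite (integrableOn_parU hγ hκ hb) measurableSet_parDomain continuous_coordU
    (fun p hp => parWeight_nonneg hp) (isOpen_parInterior _) (parInterior_subset _)
    (fun p hp => parWeight_pos hp) ![Ioo 0 (1 / 2), Ioo (1 / 2) 1] ?_ ?_ f hf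
  · intro i
    fin_cases i
    · exact Ioo_infinite (by norm_num)
    · exact Ioo_infinite (by norm_num)
  · intro a ha
    have h0 : a 0 ∈ Ioo (0 : ℝ) (1 / 2) := ha 0 trivial
    have h1 : a 1 ∈ Ioo (1 / 2 : ℝ) 1 := ha 1 trivial
    refine ⟨(a 0, a 1), ⟨?_, h1.2⟩, ?_⟩
    · simp only [Real.norm_eq_abs, sq_abs]
      nlinarith [h0.1, h0.2, h1.1]
    · ext i; fin_cases i <;> rfl

end Functionals

/-! ### Ball step: the average over `u` and its adjoint. -/

section BallStep

variable {d : ℕ}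

/-- The linear form `⟨ω, y⟩` as a polynomial. -/
def linForm (ω : EuclideanSpace ℝ (Fin d)) : MvPolynomial (Option (Fin d)) ℝ :=
  ∑ j, C (ω j) * X (some j)

/-- The polynomial `s - ‖y‖²`. -/
def defectV (d : ℕ) : MvPolynomial (Option (Fin d)) ℝ := X none - ∑ j, X (some j) ^ 2

lemma eval_linForm (ω : EuclideanSpace ℝ (Fin d)) (p : EuclideanSpace ℝ (Fin d) × ℝ) :
    eval (coordV p) (linForm ω) = inner ℝ ω p.1 := by
  simp [linForm, coordV, PiLp.inner_apply, mul_comm]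

lemma eval_defectV (p : EuclideanSpace ℝ (Fin d) × ℝ) :
    eval (coordV p) (defectV d) = p.2 - ‖p.1‖ ^ 2 := by
  simp [defectV, coordV, EuclideanSpace.norm_sq_eq]

lemma totalDegree_linForm (ω : EuclideanSpace ℝ (Fin d)) : (linForm ω).totalDegree ≤ 1 :=
  totalDegree_finsetSum_le fun j _ => (totalDegree_mul _ _).trans (by simp [totalDegree_X])

lemma totalDegree_defectV : (defectV d).totalDegree ≤ 2 := by
  refine (totalDegree_sub _ _).trans (max_le (by simp [totalDegree_X]) ?_)
  exact totalDegree_finsetSum_le fun j _ => (totalDegree_pow _ _).trans (by simp [totalDegree_X])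

/-- The average of `(⟨ω, y⟩ + u c √(s - ‖y‖²))^i s^l` over `u`, where `u` has the distribution
with moments `gegMoment κ`. -/
def ballAvgMonomial (ω : EuclideanSpace ℝ (Fin d)) (c κ : ℝ) (m : Fin 2 →₀ ℕ) :
    MvPolynomial (Option (Fin d)) ℝ :=
  X none ^ m 1 * ∑ q ∈ Finset.range (m 0 + 1), C ((m 0).choose q * c ^ q * gegMoment κ q) *
    (linForm ω ^ (m 0 - q) * defectV d ^ (q / 2))

lemma totalDegree_ballAvgMonomial (ω : EuclideanSpace ℝ (Fin d)) (c κ : ℝ) (m : Fin 2 →₀ ℕ) :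
    (ballAvgMonomial ω c κ m).totalDegree ≤ m.degree := by
  rw [Finsupp.degree_eq_sum, Fin.sum_univ_two, add_comm, ballAvgMonomial]
  refine (totalDegree_mul _ _).trans (add_le_add (by simp) ?_)
  refine totalDegree_finsetSum_le fun q hq => ?_
  have hq' : q ≤ m 0 := Nat.lt_succ_iff.1 (Finset.mem_range.1 hq)
  refine (totalDegree_mul _ _).trans ?_
  rw [totalDegree_C, zero_add]
  refine (totalDegree_mul _ _).trans ((add_le_add ((totalDegree_pow _ _).trans
    (Nat.mul_le_mul_left _ (totalDegree_linForm ω))) ((totalDegree_pow _ _).trans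
    (Nat.mul_le_mul_left _ totalDegree_defectV))).trans ?_)
  omega

/-- The polynomial `s^j ∑_q a_q v^(k-q) (s - v²)^(q/2)`. -/
def sliceMonomial (k j : ℕ) (a : ℕ → ℝ) : MvPolynomial (Fin 2) ℝ :=
  X 1 ^ j * ∑ q ∈ Finset.range (k + 1), C (a q) * (X 0 ^ (k - q) * (X 1 - X 0 ^ 2) ^ (q / 2))

lemma totalDegree_sliceMonomial (k j : ℕ) (a : ℕ → ℝ) :
    (sliceMonomial k j a).totalDegree ≤ j + k := by
  refine (totalDegree_mul _ _).trans (add_le_add (by simp) ?_)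
  refine totalDegree_finsetSum_le fun q hq => ?_
  have hq' : q ≤ k := Nat.lt_succ_iff.1 (Finset.mem_range.1 hq)
  refine (totalDegree_mul _ _).trans ?_
  rw [totalDegree_C, zero_add]
  have h2 : (X 1 - X 0 ^ 2 : MvPolynomial (Fin 2) ℝ).totalDegree ≤ 2 :=
    (totalDegree_sub _ _).trans (by simp [totalDegree_X])
  refine (totalDegree_mul _ _).trans ((add_le_add (totalDegree_X_pow _ _).le
    ((totalDegree_pow _ _).trans (Nat.mul_le_mul_left _ h2))).trans ?_)
  omega

section

variable {γ κ b l : ℝ}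

/-- For even `q` the power of the defect contributes `Γ(κ+1+q/2)/Γ(κ+1)`, which cancels the Gamma
quotient in `gegMoment κ q` and leaves a Gaussian moment. The remaining factors depend only on total
degrees and come out of the sum. Odd `q`, where `q / 2` is rounded down, carry a zero moment. -/
lemma parV_monomial_mul_ballAvgMonomial (hγ : -1 < γ) (hκ : -1 < κ)
    (hb : -1 < b + (κ + (d : ℝ) / 2)) (hl : l = κ + (d : ℝ) / 2) (ω : EuclideanSpace ℝ (Fin d))
    (c : ℝ) (m : Option (Fin d) →₀ ℕ) (m' : Fin 2 →₀ ℕ) {k : ℕ} (hkm : ∑ j, m (some j) = k) :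
    parV d hγ hκ hb (monomial m 1 * ballAvgMonomial ω c κ m') =
      (∑ q ∈ Finset.range (m' 0 + 1), ((m' 0).choose q : ℝ) * c ^ q *
        gaussMean (fun y => (∏ j, y j ^ m (some j)) * inner ℝ ω y ^ (m' 0 - q)) * gaussMoment q) *
      (Real.Gamma (l + 1) / Real.Gamma (l + 1 + ((k : ℝ) + m' 0) / 2) *
        (betaInt γ (b + l + ((m none : ℝ) + m' 1) + ((k : ℝ) + m' 0) / 2) /
          betaInt γ (b + l))) := by
  have hk : PosHomogeneous k fun y : EuclideanSpace ℝ (Fin d) => ∏ j, y j ^ m (some j) :=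
    hkm ▸ posHomogeneous_monomial fun j => m (some j)
  have hκ1 := (Real.Gamma_pos_of_pos (show 0 < κ + 1 by linarith)).ne'
  rw [ballAvgMonomial, Finset.mul_sum, Finset.mul_sum, map_sum, Finset.sum_mul]
  refine Finset.sum_congr rfl fun q hq => ?_
  generalize m' 0 = i at *
  have hq' : q ≤ i := Nat.lt_succ_iff.1 (Finset.mem_range.1 hq)
  rw [show monomial m (1 : ℝ) * (X none ^ m' 1 * (C (i.choose q * c ^ q * gegMoment κ q) *
    (linForm ω ^ (i - q) * defectV d ^ (q / 2)))) = (i.choose q * c ^ q * gegMoment κ q) •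
    (monomial m (1 : ℝ) * X none ^ m' 1 * linForm ω ^ (i - q) * defectV d ^ (q / 2)) by
      rw [smul_eq_C_mul]; ring, map_smul, parV_eq hγ hκ hb
      (hk.mul ((posHomogeneous_inner ω).pow (i - q))) (by fun_prop) (m none + m' 1) (q / 2) hl
      (fun p => by
        simp only [map_mul, map_pow, eval_coordV_monomial, eval_linForm, eval_defectV, eval_X]
        simp only [coordV, Option.elim]; ring), smul_eq_mul]
  rcases Nat.even_or_odd q with ⟨r, rfl⟩ | ho
  · have hr : (r + r) / 2 = r := by omega
    have hκ2 := (Real.Gamma_pos_of_pos (show 0 < κ + 1 + r by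
      have : (0 : ℝ) ≤ r := r.cast_nonneg
      linarith)).ne'
    rw [hr, gegMoment]
    push_cast [hq']
    rw [show κ + r + 1 = κ + 1 + r by ring, show ((r : ℝ) + r) / 2 = r by ring,
      show l + 1 + (r : ℝ) + ((k : ℝ) + 1 * (i - (r + r))) / 2 = l + 1 + ((k : ℝ) + i) / 2 by
        ring,
      show b + l + (r : ℝ) + ((m none : ℝ) + m' 1) + ((k : ℝ) + 1 * (i - (r + r))) / 2 =
        b + l + ((m none : ℝ) + m' 1) + ((k : ℝ) + i) / 2 by ring]
    generalize Real.Gamma (κ + 1) = A at hκ1 ⊢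
    generalize Real.Gamma (κ + 1 + r) = B at hκ2 ⊢
    field_simp
  · rw [gegMoment, gaussMoment_odd ho]; ring

/-- The Gamma quotient in `a q` cancels the contribution of `(s - v²)^(q/2)`. What remains is the
right-hand side of `gaussMean_slice`, with the same common factor as on the paraboloid. -/
lemma parU_sliceMonomial_mul_monomial (hγ : -1 < γ) (hκ' : -1 < l - 1 / 2)
    (hb' : -1 < b + (l - 1 / 2 + 1 / 2)) {k : ℕ} (j : ℕ) {g a : ℕ → ℝ} (m' : Fin 2 →₀ ℕ)
    (hg : ∀ q ≤ k, Odd q → g q = 0)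
    (ha : ∀ q, a q = g q * (Real.Gamma (l + 1 / 2) / Real.Gamma (l + 1 / 2 + (q / 2 : ℕ)))) :
    parU hγ hκ' hb' (sliceMonomial k j a * monomial m' 1) =
      (∑ q ∈ Finset.range (k + 1), g q * gaussMoment (k - q + m' 0)) *
      (Real.Gamma (l + 1) / Real.Gamma (l + 1 + ((k : ℝ) + m' 0) / 2) *
        (betaInt γ (b + l + ((j : ℝ) + m' 1) + ((k : ℝ) + m' 0) / 2) / betaInt γ (b + l))) := by
  have hl1 := (Real.Gamma_pos_of_pos (show 0 < l + 1 / 2 by linarith)).ne'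
  rw [sliceMonomial, Finset.mul_sum, Finset.sum_mul, map_sum, Finset.sum_mul]
  refine Finset.sum_congr rfl fun q hq => ?_
  have hq' : q ≤ k := Nat.lt_succ_iff.1 (Finset.mem_range.1 hq)
  rw [show X 1 ^ j * (C (a q) * (X 0 ^ (k - q) * (X 1 - X 0 ^ 2) ^ (q / 2))) *
    monomial m' (1 : ℝ) = a q • (X 1 ^ j * (X 0 ^ (k - q) *
      (X 1 - X 0 ^ 2) ^ (q / 2)) * monomial m' (1 : ℝ)) by
      rw [smul_eq_C_mul]; ring, map_smul,
    parU_eq (l := l) hγ hκ' hb' (k - q + m' 0) (j + m' 1) (q / 2) (by ring)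
      (fun p => by
        simp only [map_mul, map_pow, map_sub, eval_coordU_monomial, eval_X]
        simp only [coordU, Matrix.cons_val_zero, Matrix.cons_val_one]; ring), smul_eq_mul, ha]
  rcases Nat.even_or_odd q with ⟨r, rfl⟩ | ho
  · have hr : (r + r) / 2 = r := by omega
    have hl2 := (Real.Gamma_pos_of_pos (show 0 < l + 1 / 2 + r by
      have : (0 : ℝ) ≤ r := r.cast_nonneg
      linarith)).ne'
    rw [hr]
    push_cast [hq']
    rw [show l - 1 / 2 + r + 1 = l + 1 / 2 + r by ring,
      show l - 1 / 2 + 1 = l + 1 / 2 by ring,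
      show l + 1 + (r : ℝ) + ((k : ℝ) - (r + r) + m' 0) / 2 = l + 1 + ((k : ℝ) + m' 0) / 2 by
        ring,
      show b + l + (r : ℝ) + ((j : ℝ) + m' 1) + ((k : ℝ) - (r + r) + m' 0) / 2 =
        b + l + ((j : ℝ) + m' 1) + ((k : ℝ) + m' 0) / 2 by ring]
    generalize Real.Gamma (l + 1 / 2) = A at hl1 ⊢
    generalize Real.Gamma (l + 1 / 2 + r) = B at hl2 ⊢
    field_simp
  · rw [hg q hq' ho]; ring

/-- On the curve `v² = t` the factor `s - v²` kills every `q ≥ 2`. The term `q = 1` needs `ha`,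
because `1 / 2 = 0` in `ℕ`. -/
lemma eval_sliceMonomial {k : ℕ} (j : ℕ) {a : ℕ → ℝ} (ha : 1 ≤ k → a 1 = 0) {t : ℝ} (ht : 0 ≤ t) :
    eval (coordU (√t, t)) (sliceMonomial k j a) = a 0 * √t ^ k * t ^ j := by
  simp only [sliceMonomial, map_mul, map_sum, map_pow, map_sub, eval_X, eval_C]
  rw [Finset.sum_eq_single 0]
  · simp [coordU]; ring
  · intro q hq hq0
    have hq' : q ≤ k := Nat.lt_succ_iff.1 (Finset.mem_range.1 hq)
    rcases eq_or_ne q 1 with rfl | hq1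
    · rw [ha hq', zero_mul]
    · have : q / 2 ≠ 0 := by omega
      simp [coordU, Real.sq_sqrt ht, this]
  · simp

end

/-- On `y^m s^j` the adjoint is built from the Gaussian means of the slice coefficients of `y^m`. On
the boundary curve only the leading coefficient `∏ ω_j^(m_j)` survives, so evaluation there becomes
evaluation at `(√t ω, t)`. -/
lemma isDegreeAdjoint_ball {γ κ b l : ℝ} (hγ : -1 < γ) (hκ : -1 < κ)
    (hb : -1 < b + (κ + (d : ℝ) / 2)) (hl : l = κ + (d : ℝ) / 2) (hκ' : -1 < l - 1 / 2)
    (hb' : -1 < b + (l - 1 / 2 + 1 / 2)) (ω : EuclideanSpace ℝ (Fin d)) (c : ℝ)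
    (hω : ‖ω‖ ^ 2 + c ^ 2 = 1) :
    ∃ Q : MvPolynomial (Option (Fin d)) ℝ →ₗ[ℝ] MvPolynomial (Fin 2) ℝ,
      IsDegreeAdjoint (parV d hγ hκ hb) (parU hγ hκ' hb')
        (monoMap (ballAvgMonomial ω c κ)) Q ∧
      ∀ (f : MvPolynomial (Option (Fin d)) ℝ) (t : ℝ), 0 ≤ t →
        eval (coordU (√t, t)) (Q f) = eval (coordV (√t • ω, t)) f := by
  obtain ⟨T, hT⟩ := exists_gaussian_rotation ω c hω
  let k (m : Option (Fin d) →₀ ℕ) : ℕ := ∑ j, m (some j)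
  let F (m : Option (Fin d) →₀ ℕ) (y : EuclideanSpace ℝ (Fin d)) : Polynomial ℝ :=
    ∏ j, (Polynomial.C (T y j) + Polynomial.X * Polynomial.C (ω j)) ^ m (some j)
  have hF (m) : IsSliceFamily (k m) (∏ j, ω j ^ m (some j)) (F m) :=
    IsSliceFamily.prod _ fun j => by
      simpa using (IsSliceFamily.linear ((EuclideanSpace.proj j).comp T) (ω j)).pow (m (some j))
  have hFf (m) (y : EuclideanSpace ℝ (Fin d)) (v : ℝ) :
      ∏ j, (v • ω + T y) j ^ m (some j) = (F m y).eval v := by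
    simp only [F, Polynomial.eval_prod]
    refine Finset.prod_congr rfl fun j _ => ?_
    simp; ring
  let g (m) (q : ℕ) : ℝ := gaussMean (fun y => (F m y).coeff (k m - q))
  let a (m) (q : ℕ) : ℝ := g m q *
    (Real.Gamma (l + 1 / 2) / Real.Gamma (l + 1 / 2 + (q / 2 : ℕ)))
  have hg (m) : ∀ q ≤ k m, Odd q → g m q = 0 := fun q hq ho => (hF m).gaussMean_coeff_odd hq ho
  refine ⟨monoMap fun m => sliceMonomial (k m) (m none) (a m), isDegreeAdjoint_monoMap
    (totalDegree_ballAvgMonomial ω c κ) (fun m => ?_) (fun m m' => ?_), fun f t ht => ?_⟩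
  · rw [finset_degree_option]; exact totalDegree_sliceMonomial _ _ _
  · rw [parV_monomial_mul_ballAvgMonomial hγ hκ hb hl ω c m m' rfl,
      parU_sliceMonomial_mul_monomial hγ hκ' hb' _ m' (hg m) (fun _ => rfl),
      gaussMean_slice (posHomogeneous_monomial fun j => m (some j)) (by fun_prop) hT (hF m)
        (hFf m) (m' 0)]
  · have : evalFun (coordU (√t, t)) ∘ₗ monoMap (fun m => sliceMonomial (k m) (m none) (a m)) =
        evalFun (coordV (√t • ω, t)) := by
      refine linearMap_ext_monomial fun m => ?_
      rw [LinearMap.comp_apply, monoMap_monomial, one_smul, evalFun_apply, evalFun_apply,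
        eval_coordV_monomial, eval_sliceMonomial _ (fun h => by simp [a, hg m 1 h odd_one]) ht]
      have hG := (integral_gaussian_pos (E := EuclideanSpace ℝ (Fin d))).ne'
      have hl1 := (Real.Gamma_pos_of_pos (show 0 < l + 1 / 2 by linarith)).ne'
      have h0 : a m 0 = ∏ j, ω j ^ m (some j) := by
        simp only [a, g, Nat.sub_zero, (hF m).lead, gaussMean, integral_const_mul]
        simp only [Nat.zero_div, Nat.cast_zero, add_zero]
        rw [div_self hl1]
        field_simp
      rw [h0]
      simp only [PiLp.smul_apply, smul_eq_mul, mul_pow, Finset.prod_mul_distrib,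
        Finset.prod_pow_eq_pow_sum, one_mul, k]
      ring
    simpa only [LinearMap.comp_apply, evalFun_apply] using LinearMap.congr_fun this f

end BallStep

end Paraboloid

end

noncomputable section

namespace Paraboloid

open Polynomial

/-! ### Gegenbauer polynomials treated algebraically through their moment functional. -/

section Gegenbauer

variable {κ σ : ℝ}

lemma gegMoment_zero (hκ : -1 < κ) : gegMoment κ 0 = 1 := by
  have := (Real.Gamma_pos_of_pos (show 0 < κ + 1 by linarith)).ne'
  simp [gegMoment, gaussMoment, this]

lemma gegMoment_odd (κ : ℝ) {i : ℕ} (hi : Odd i) : gegMoment κ i = 0 := by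
  rw [gegMoment, gaussMoment_odd hi, zero_mul]

lemma gegMoment_add_two (hκ : -1 < κ) (i : ℕ) :
    (i + 2 * κ + 2) * gegMoment κ (i + 2) = (i + 1) * gegMoment κ i := by
  have hx : 0 < κ + 1 + (i : ℝ) / 2 := by
    have : (0 : ℝ) ≤ i := i.cast_nonneg
    linarith
  have hG := (Real.Gamma_pos_of_pos hx).ne'
  have h : Real.Gamma (κ + 1 + ((i + 2 : ℕ) : ℝ) / 2) =
      (κ + 1 + (i : ℝ) / 2) * Real.Gamma (κ + 1 + (i : ℝ) / 2) := by
    rw [← Real.Gamma_add_one hx.ne']; push_cast; ring_nf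
  rw [gegMoment, gegMoment, h, gaussMoment]
  have h2 : (i : ℝ) + 2 * κ + 2 = 2 * (κ + 1 + (i : ℝ) / 2) := by ring
  rw [h2]
  generalize Real.Gamma (κ + 1 + (i : ℝ) / 2) = A at *
  generalize Real.Gamma (κ + 1) = B at *
  generalize κ + 1 + (i : ℝ) / 2 = x at *
  field_simp

/-- The functional on polynomials with moments `gegMoment κ`. -/
def gegFun (κ : ℝ) : ℝ[X] →ₗ[ℝ] ℝ := lsum fun i => LinearMap.toSpanSingleton ℝ ℝ (gegMoment κ i)

lemma gegFun_monomial (κ : ℝ) (i : ℕ) (a : ℝ) : gegFun κ (monomial i a) = a * gegMoment κ i := by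
  simp [gegFun]

lemma gegFun_C_mul (κ a : ℝ) (p : ℝ[X]) : gegFun κ (C a * p) = a * gegFun κ p := by
  rw [← smul_eq_C_mul, map_smul, smul_eq_mul]

lemma gegFun_X_pow (κ : ℝ) (i : ℕ) : gegFun κ (X ^ i) = gegMoment κ i := by
  rw [X_pow_eq_monomial, gegFun_monomial, one_mul]

lemma gegFun_C_mul_X_pow (κ a : ℝ) (i : ℕ) : gegFun κ (C a * X ^ i) = a * gegMoment κ i := by
  rw [gegFun_C_mul, gegFun_X_pow]

lemma gegFun_eq_sum (κ : ℝ) {p : ℝ[X]} {n : ℕ} (hp : p.natDegree < n) :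
    gegFun κ p = ∑ i ∈ Finset.range n, p.coeff i * gegMoment κ i := by
  conv_lhs => rw [p.as_sum_range' n hp, map_sum]
  simp only [gegFun_monomial]

/-- Integration by parts against `(1 - x²)^(κ+1/2)`. Working with moments only, it holds for all `κ
> -1`, even where `(1 - x²)^(κ-1/2)` is not integrable. -/
lemma gegFun_derivative (hκ : -1 < κ) (p : ℝ[X]) :
    gegFun κ ((1 - X ^ 2) * derivative p) = (2 * κ + 1) * gegFun κ (X * p) := by
  induction p using Polynomial.induction_on' with
  | add p q hp hq => simp only [map_add, mul_add, hp, hq]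
  | monomial n a =>
    rw [← C_mul_X_pow_eq_monomial]
    rcases n with _ | n
    · have h : (X : ℝ[X]) * (C a * X ^ 0) = C a * X ^ 1 := by ring
      rw [h, gegFun_C_mul_X_pow, gegMoment_odd κ odd_one]; simp
    · have h1 : (1 - X ^ 2) * derivative (C a * X ^ (n + 1)) =
          C (a * (n + 1)) * X ^ n - C (a * (n + 1)) * X ^ (n + 2) := by
        rw [derivative_C_mul_X_pow]; push_cast; simp; ring
      have h2 : X * (C a * X ^ (n + 1)) = C a * X ^ (n + 2) := by ring
      rw [h1, h2, map_sub, gegFun_C_mul_X_pow, gegFun_C_mul_X_pow, gegFun_C_mul_X_pow]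
      linear_combination (-a) * gegMoment_add_two hκ n

/-- The Gegenbauer polynomials `C_n^σ`. -/
def geg (σ : ℝ) : ℕ → ℝ[X]
  | 0 => 1
  | 1 => C (2 * σ) * X
  | n + 2 => C ((n + 2 : ℝ)⁻¹) * (C (2 * (n + 1 + σ)) * X * geg σ (n + 1) - C (n + 2 * σ) * geg σ n)

lemma geg_add_two (σ : ℝ) (n : ℕ) : C (n + 2 : ℝ) * geg σ (n + 2) =
    C (2 * (n + 1 + σ)) * X * geg σ (n + 1) - C (n + 2 * σ) * geg σ n := by
  rw [geg, ← mul_assoc, ← C_mul, mul_inv_cancel₀ (by positivity), C_1, one_mul]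

lemma C_natCast_add_ne_zero (n : ℕ) : (C (n + 2 : ℝ) : ℝ[X]) ≠ 0 :=
  C_ne_zero.2 (by positivity)

/-- The two classical derivative relations are proved together: the inductive step differentiates
the three-term recurrence and uses both. -/
lemma geg_derivative_aux (σ : ℝ) (n : ℕ) :
    X * derivative (geg σ (n + 1)) - derivative (geg σ n) = C (n + 1 : ℝ) * geg σ (n + 1) ∧
    derivative (geg σ (n + 1)) - X * derivative (geg σ n) = C (n + 2 * σ) * geg σ n := by
  induction n with
  | zero => simp [geg]; ring
  | succ n ih =>
    obtain ⟨ha, hb⟩ := ih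
    have hr := geg_add_two σ n
    have hd := congrArg derivative hr
    simp only [derivative_mul, derivative_sub, derivative_C, derivative_X, zero_mul, zero_add,
      mul_one] at hd
    simp only [C_add, C_mul, Nat.cast_add, Nat.cast_one, C_1] at *
    have hb' : derivative (geg σ (n + 1 + 1)) - X * derivative (geg σ (n + 1)) =
        (C (n : ℝ) + 1 + C 2 * C σ) * geg σ (n + 1) := by
      refine mul_left_cancel₀ (C_natCast_add_ne_zero n) ?_
      have h2 : (C 2 : ℝ[X]) = 2 := rfl
      simp only [C_add, h2] at *
      linear_combination hd + (C (n : ℝ) + 2 * C σ) * ha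
    refine ⟨?_, hb'⟩
    have h2 : (C 2 : ℝ[X]) = 2 := rfl
    simp only [h2] at *
    linear_combination X * hb' + X * ha - hb - hr

lemma one_sub_X_sq_mul_derivative_geg (σ : ℝ) (n : ℕ) :
    (1 - X ^ 2) * derivative (geg σ (n + 1)) =
      C (n + 2 * σ) * geg σ n - C (n + 1 : ℝ) * (X * geg σ (n + 1)) := by
  obtain ⟨ha, hb⟩ := geg_derivative_aux σ n
  linear_combination hb - X * ha

/-- Integration by parts for `C_{n+1}^σ x^(i+1)`, with the derivative of `C_{n+1}^σ` eliminated. The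
index `σ` stays free: `σ = κ + 1` yields the reproducing property, `σ = κ` orthogonality. -/
lemma gegFun_geg_recurrence (hκ : -1 < κ) (σ : ℝ) (n i : ℕ) :
    (i + 1 + n + 1 + 2 * κ + 1) * gegFun κ (geg σ (n + 1) * X ^ (i + 2)) =
      (i + 1) * gegFun κ (geg σ (n + 1) * X ^ i) +
        (n + 2 * σ) * gegFun κ (geg σ n * X ^ (i + 1)) := by
  have h := gegFun_derivative hκ (geg σ (n + 1) * X ^ (i + 1))
  have h1 : (1 - X ^ 2) * derivative (geg σ (n + 1) * X ^ (i + 1)) =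
      C (n + 2 * σ) * (geg σ n * X ^ (i + 1)) - C (n + 1 : ℝ) * (geg σ (n + 1) * X ^ (i + 2)) +
      C (i + 1 : ℝ) * (geg σ (n + 1) * X ^ i) - C (i + 1 : ℝ) * (geg σ (n + 1) * X ^ (i + 2)) := by
    rw [derivative_mul, derivative_X_pow]
    simp only [Nat.add_sub_cancel, Nat.cast_add, Nat.cast_one]
    linear_combination X ^ (i + 1) * one_sub_X_sq_mul_derivative_geg σ n
  have h2 : X * (geg σ (n + 1) * X ^ (i + 1)) = geg σ (n + 1) * X ^ (i + 2) := by ring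
  rw [h1, h2, map_sub, map_add, map_sub, gegFun_C_mul, gegFun_C_mul, gegFun_C_mul,
    gegFun_C_mul] at h
  linear_combination -h

lemma gegFun_geg_recurrence_one (hκ : -1 < κ) (σ : ℝ) (n : ℕ) :
    (n + 1 + 2 * κ + 1) * gegFun κ (geg σ (n + 1) * X ^ 1) =
      (n + 2 * σ) * gegFun κ (geg σ n * X ^ 0) := by
  have h := gegFun_derivative hκ (geg σ (n + 1))
  rw [one_sub_X_sq_mul_derivative_geg, map_sub, gegFun_C_mul, gegFun_C_mul] at h
  rw [pow_zero, mul_one, pow_one, mul_comm _ X]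
  linear_combination -h

lemma gegFun_geg_recurrence_zero (κ σ : ℝ) (n : ℕ) :
    (n + 2) * gegFun κ (geg σ (n + 2) * X ^ 0) =
      2 * (n + 1 + σ) * gegFun κ (geg σ (n + 1) * X ^ 1) -
        (n + 2 * σ) * gegFun κ (geg σ n * X ^ 0) := by
  have h := congrArg (gegFun κ) (geg_add_two σ n)
  rw [gegFun_C_mul, map_sub, mul_assoc, gegFun_C_mul, gegFun_C_mul] at h
  simpa [mul_comm X] using h

/-- `C_n^{κ+1}` reproduces monomials of the same parity and degree at most `n`. -/
lemma gegFun_geg_mul_X_pow (hκ : -1 < κ) : ∀ n i : ℕ, i ≤ n →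
    gegFun κ (geg (κ + 1) n * X ^ i) = if Even (n + i) then 1 else 0 := by
  intro n
  induction n using Nat.strong_induction_on with
  | _ n ihn =>
  intro i
  induction i using Nat.strong_induction_on with
  | _ i ihi =>
  intro hi
  rcases i with _ | _ | i
  · rcases n with _ | _ | n
    · rw [geg, one_mul, gegFun_X_pow, gegMoment_zero hκ]; simp
    · rw [geg, pow_zero, mul_one, ← pow_one X, gegFun_C_mul_X_pow, gegMoment_odd κ odd_one]; simp
    · have h := gegFun_geg_recurrence_zero κ (κ + 1) n
      rw [ihn (n + 1) (by omega) 1 (by omega), ihn n (by omega) 0 (by omega)] at h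
      refine mul_left_cancel₀ (show (n + 2 : ℝ) ≠ 0 by positivity) ?_
      rw [h]
      by_cases hn : Even n
      · simp [hn, parity_simps]; ring
      · simp [hn, parity_simps]
  · rcases n with _ | n
    · omega
    · have h := gegFun_geg_recurrence_one hκ (κ + 1) n
      rw [ihn n (by omega) 0 (by omega)] at h
      have hpos : 0 < (n + 1 + 2 * κ + 1 : ℝ) := by
        have : (0 : ℝ) ≤ n := n.cast_nonneg
        linarith
      refine mul_left_cancel₀ hpos.ne' ?_
      rw [h]
      by_cases hn : Even n
      · simp [hn, parity_simps]; ring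
      · simp [hn, parity_simps]
  · rcases n with _ | n
    · omega
    -- For `σ = κ + 1` the two coefficients on the right add up to the one on the left, so the value
    -- `1` propagates.
    · have h := gegFun_geg_recurrence hκ (κ + 1) n i
      rw [ihn n (by omega) (i + 1) (by omega), ihi i (by omega) (by omega)] at h
      have hpos : 0 < (i + 1 + n + 1 + 2 * κ + 1 : ℝ) := by
        have : (0 : ℝ) ≤ n := n.cast_nonneg
        have : (0 : ℝ) ≤ i := i.cast_nonneg
        linarith
      refine mul_left_cancel₀ hpos.ne' ?_
      rw [h]
      by_cases hn : Even n <;> by_cases hi : Even i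
      all_goals simp [Nat.even_add, hn, hi, parity_simps]
      all_goals ring

/-- `C_n^κ` is orthogonal to monomials of lower degree for the weight `(1 - x²)^(κ - 1/2)`. -/
lemma gegFun_geg_mul_X_pow_of_lt (hκ : 0 < κ) : ∀ n i : ℕ, i < n →
    gegFun κ (geg κ n * X ^ i) = 0 := by
  have hκ' : -1 < κ := by linarith
  intro n
  induction n using Nat.strong_induction_on with
  | _ n ihn =>
  intro i
  induction i using Nat.strong_induction_on with
  | _ i ihi =>
  intro hi
  rcases i with _ | _ | i
  · rcases n with _ | _ | _ | n
    · omega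
    · rw [geg, pow_zero, mul_one, ← pow_one X, gegFun_C_mul_X_pow, gegMoment_odd κ odd_one,
        mul_zero]
    -- The recurrence leads to `C_1` against `x`, which is not of lower degree; here two recurrences
    -- cancel directly.
    · have h := gegFun_geg_recurrence_zero κ κ 0
      have h1 := gegFun_geg_recurrence_one hκ' κ 0
      refine mul_left_cancel₀ (show ((0 : ℕ) + 2 : ℝ) ≠ 0 by norm_num) ?_
      simp only [Nat.cast_zero, zero_add] at h h1 ⊢
      rw [h]; linear_combination h1
    · have h := gegFun_geg_recurrence_zero κ κ (n + 1)
      rw [ihn (n + 1 + 1) (by omega) 1 (by omega), ihn (n + 1) (by omega) 0 (by omega), mul_zero,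
        mul_zero, sub_zero] at h
      exact (mul_eq_zero.1 h).resolve_left (by positivity)
  · rcases n with _ | n
    · omega
    · have h := gegFun_geg_recurrence_one hκ' κ n
      rw [ihn n (by omega) 0 (by omega), mul_zero] at h
      exact (mul_eq_zero.1 h).resolve_left (by positivity)
  · rcases n with _ | n
    · omega
    · have h := gegFun_geg_recurrence hκ' κ n i
      rw [ihn n (by omega) (i + 1) (by omega), ihi i (by omega) (by omega), mul_zero, mul_zero,
        add_zero] at h
      exact (mul_eq_zero.1 h).resolve_left (by positivity)

lemma gegFun_geg_of_pos (hκ : 0 < κ) {n : ℕ} (hn : 0 < n) : gegFun κ (geg κ n) = 0 := by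
  simpa using gegFun_geg_mul_X_pow_of_lt hκ n 0 hn

/-- Polynomials of degree at most `a` all of whose exponents have the parity of `a`. -/
def HasParity (a : ℕ) (p : ℝ[X]) : Prop := ∀ i, p.coeff i ≠ 0 → i ≤ a ∧ Even (a + i)

lemma HasParity.add {a : ℕ} {p q : ℝ[X]} (hp : HasParity a p) (hq : HasParity a q) :
    HasParity a (p + q) := fun i hi => by
  by_cases h : p.coeff i = 0
  · exact hq i fun h' => hi (by rw [coeff_add, h, h', add_zero])
  · exact hp i h

lemma HasParity.C_mul {a : ℕ} {p : ℝ[X]} (r : ℝ) (hp : HasParity a p) : HasParity a (C r * p) :=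
  fun i hi => hp i fun h => hi (by rw [coeff_C_mul, h, mul_zero])

lemma HasParity.neg {a : ℕ} {p : ℝ[X]} (hp : HasParity a p) : HasParity a (-p) :=
  fun i hi => hp i fun h => hi (by rw [coeff_neg, h, neg_zero])

lemma HasParity.sub {a : ℕ} {p q : ℝ[X]} (hp : HasParity a p) (hq : HasParity a q) :
    HasParity a (p - q) := sub_eq_add_neg p q ▸ hp.add hq.neg

lemma HasParity.add_two {a : ℕ} {p : ℝ[X]} (hp : HasParity a p) : HasParity (a + 2) p :=
  fun i hi => ⟨by have := (hp i hi).1; omega, by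
    have := (hp i hi).2
    rw [show a + 2 + i = (a + i) + 2 by ring]
    exact this.add even_two⟩

lemma HasParity.X_mul {a : ℕ} {p : ℝ[X]} (hp : HasParity a p) : HasParity (a + 1) (X * p) := by
  intro i hi
  rcases i with _ | i
  · simp at hi
  · rw [coeff_X_mul] at hi
    refine ⟨by have := (hp i hi).1; omega, ?_⟩
    have := (hp i hi).2
    rw [show a + 1 + (i + 1) = (a + i) + 2 by ring]
    exact this.add even_two

lemma HasParity.natDegree_le {a : ℕ} {p : ℝ[X]} (hp : HasParity a p) : p.natDegree ≤ a :=
  natDegree_le_iff_coeff_eq_zero.2 fun i hi => by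
    by_contra h
    exact absurd (hp i h).1 (by omega)

lemma hasParity_one : HasParity 0 1 := fun i hi => by
  rw [coeff_one] at hi
  have : i = 0 := by by_contra h; simp [h] at hi
  subst this; simp

lemma hasParity_X_pow (a : ℕ) : HasParity a (X ^ a) := by
  induction a with
  | zero => simpa using hasParity_one
  | succ a ih => rw [pow_succ']; exact ih.X_mul

lemma hasParity_geg (σ : ℝ) (n : ℕ) : HasParity n (geg σ n) := by
  induction n using geg.induct with
  | case1 => exact hasParity_one
  | case2 => rw [geg, ← pow_one X]; exact (hasParity_X_pow 1).C_mul _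
  | case3 n h1 h0 =>
    rw [geg, mul_assoc (C _) X]
    exact ((h1.X_mul.C_mul _).sub (h0.add_two.C_mul _)).C_mul _

lemma gegFun_geg_mul (hκ : -1 < κ) {n a : ℕ} (h : a ≤ n) {p : ℝ[X]} (hp : HasParity a p) :
    gegFun κ (geg (κ + 1) n * p) = if Even (n + a) then p.eval 1 else 0 := by
  have hd := Nat.lt_succ_of_le hp.natDegree_le
  rw [eval_eq_sum_range' hd]
  conv_lhs => rw [p.as_sum_range_C_mul_X_pow' hd, Finset.mul_sum, map_sum]
  have : (if Even (n + a) then ∑ i ∈ Finset.range (a + 1), p.coeff i * 1 ^ i else 0) =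
      ∑ i ∈ Finset.range (a + 1), p.coeff i * if Even (n + a) then 1 else 0 := by
    split_ifs <;> simp
  rw [Nat.succ_eq_add_one, this]
  refine Finset.sum_congr rfl fun i _ => ?_
  rw [mul_left_comm, gegFun_C_mul]
  by_cases hi : p.coeff i = 0
  · rw [hi, zero_mul, zero_mul]
  · obtain ⟨h1, h2⟩ := hp i hi
    rw [gegFun_geg_mul_X_pow hκ n i (h1.trans h)]
    congr 2
    simp only [Nat.even_add] at h2 ⊢
    simp only [h2]

/-- The differences `C_a^σ - C_{a-2}^σ`. -/
def gegDiff (σ : ℝ) : ℕ → ℝ[X]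
  | 0 => geg σ 0
  | 1 => geg σ 1
  | a + 2 => geg σ (a + 2) - geg σ a

lemma hasParity_gegDiff (σ : ℝ) (a : ℕ) : HasParity a (gegDiff σ a) := by
  rcases a with _ | _ | a
  · exact hasParity_geg σ 0
  · exact hasParity_geg σ 1
  · exact (hasParity_geg σ _).sub (hasParity_geg σ a).add_two

/-- `gegDiff (κ+1) a` is the reproducing kernel at `1` in degree `a`, and `C_n^{κ+1}` is the sum of
these kernels over degrees `n, n-2, …`. For `a > n` of equal parity, both terms of the difference
pair with `C_n^{κ+1}` to its value at `1` and cancel. -/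
lemma gegFun_geg_mul_gegDiff (hκ : -1 < κ) (n a : ℕ) :
    gegFun κ (geg (κ + 1) n * gegDiff (κ + 1) a) =
      if a ≤ n ∧ Even (n + a) then (gegDiff (κ + 1) a).eval 1 else 0 := by
  rcases le_or_gt a n with h | h
  · rw [gegFun_geg_mul hκ h (hasParity_gegDiff _ _)]; simp [h]
  · rw [if_neg (fun h' => absurd h'.1 (by omega))]
    rcases a with _ | _ | a
    · omega
    · obtain rfl : n = 0 := by omega
      rw [gegDiff, mul_comm, gegFun_geg_mul hκ zero_le_one (hasParity_geg _ 0)]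
      simp
    · rw [gegDiff, mul_sub, map_sub, mul_comm, gegFun_geg_mul hκ h.le (hasParity_geg _ n)]
      rcases Nat.lt_or_ge a n with h' | h'
      · obtain rfl : n = a + 1 := by omega
        rw [gegFun_geg_mul hκ (by omega) (hasParity_geg _ a)]
        by_cases ha : Even a <;> simp [Nat.even_add, ha]
      · rw [mul_comm, gegFun_geg_mul hκ h' (hasParity_geg _ n)]
        simp [Nat.even_add, parity_simps]

lemma geg_eval_one (σ : ℝ) (n : ℕ) :
    (n + 1) * (geg σ (n + 1)).eval 1 = (n + 2 * σ) * (geg σ n).eval 1 := by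
  induction n with
  | zero => simp [geg]
  | succ n ih =>
    have h := congrArg (eval 1) (geg_add_two σ n)
    simp only [eval_mul, eval_sub, eval_C, eval_X, mul_one] at h
    push_cast
    linear_combination h + ih

lemma geg_eval_one_pos (hσ : 0 < σ) (n : ℕ) : 0 < (geg σ n).eval 1 := by
  induction n with
  | zero => simp [geg]
  | succ n ih =>
    have h := geg_eval_one σ n
    have : 0 < (n + 1 : ℝ) * (geg σ (n + 1)).eval 1 := by rw [h]; positivity
    exact pos_of_mul_pos_right this (by positivity)

lemma geg_eval_one_lt (hσ : 1 / 2 < σ) (n : ℕ) :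
    (geg σ n).eval 1 < (geg σ (n + 1)).eval 1 := by
  have h := geg_eval_one σ n
  have h0 := geg_eval_one_pos (show 0 < σ by linarith) n
  have hn : (0 : ℝ) ≤ n := n.cast_nonneg
  nlinarith

lemma gegDiff_eval_one_pos (hσ : 1 / 2 < σ) (a : ℕ) : 0 < (gegDiff σ a).eval 1 := by
  have h0 : 0 < σ := by linarith
  rcases a with _ | _ | a
  · exact geg_eval_one_pos h0 0
  · exact geg_eval_one_pos h0 1
  · rw [gegDiff, eval_sub, sub_pos]
    exact (geg_eval_one_lt hσ a).trans (geg_eval_one_lt hσ (a + 1))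

lemma geg_lead_pos (hσ : 0 < σ) (n : ℕ) : 0 < (geg σ n).coeff n := by
  induction n using geg.induct with
  | case1 => simp [geg]
  | case2 => simpa [geg] using hσ
  | case3 n h1 _ =>
    have h0 : (geg σ n).coeff (n + 2) = 0 := by
      by_contra h
      exact absurd (hasParity_geg σ n _ h).1 (by omega)
    rw [geg, coeff_C_mul, coeff_sub, mul_assoc, coeff_C_mul, coeff_X_mul, coeff_C_mul, h0]
    simp only [mul_zero, sub_zero]
    positivity

lemma gegDiff_lead (σ : ℝ) (a : ℕ) : (gegDiff σ a).coeff a = (geg σ a).coeff a := by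
  rcases a with _ | _ | a
  · rfl
  · rfl
  · have h0 : (geg σ a).coeff (a + 2) = 0 := by
      by_contra h
      exact absurd (hasParity_geg σ a _ h).1 (by omega)
    rw [gegDiff, coeff_sub, h0, sub_zero]

lemma linearMap_ext_geg (hσ : 0 < σ) {l l' : ℝ[X] →ₗ[ℝ] ℝ}
    (h : ∀ n, l (geg σ n) = l' (geg σ n)) : l = l' := by
  have key : ∀ n, ∀ p : ℝ[X], p.natDegree < n → l p = l' p := by
    intro n
    induction n with
    | zero => intro p hp; omega
    | succ n ih =>
      intro p hp
      have hk := (geg_lead_pos hσ n).ne'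
      set q := p - C (p.coeff n / (geg σ n).coeff n) * geg σ n with hq
      have hlq : l q = l' q := by
        rcases n with _ | n
        · have : q = 0 := by
            rw [hq, eq_C_of_natDegree_le_zero (show p.natDegree ≤ 0 by omega)]
            simp [geg]
          rw [this, map_zero, map_zero]
        · refine ih q (Nat.lt_succ_of_le (natDegree_le_iff_coeff_eq_zero.2 fun i hi => ?_))
          rw [hq, coeff_sub, coeff_C_mul]
          rcases eq_or_ne i (n + 1) with rfl | hne
          · field_simp; ring
          · have h1 : p.natDegree < i := by omega
            have h2 : (geg σ (n + 1)).natDegree < i :=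
              (hasParity_geg σ (n + 1)).natDegree_le.trans_lt (by omega)
            rw [coeff_eq_zero_of_natDegree_lt h1, coeff_eq_zero_of_natDegree_lt h2]
            ring
      have hp' : p = q + (p.coeff n / (geg σ n).coeff n) • geg σ n := by
        rw [hq, smul_eq_C_mul]; ring
      rw [hp', map_add, map_add, map_smul, map_smul, h, hlq]
  exact LinearMap.ext fun p => key _ p (Nat.lt_succ_self _)

/-- If `A` maps `C_n^{l+β+1}` to `C_n^{l+1}`, then its adjoint with respect to the functionals
`gegFun l` and `gegFun (l+β)` preserves degree, parity and the value at `1`. -/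
lemma exists_adjoint {l β : ℝ} (hl : -1 / 2 < l) (hβ : 0 ≤ β) {A : ℝ[X] →ₗ[ℝ] ℝ[X]}
    (hA : ∀ n, A (geg (l + β + 1) n) = geg (l + 1) n) (a : ℕ) :
    ∀ p, HasParity a p → ∃ b, HasParity a b ∧ b.eval 1 = p.eval 1 ∧
      ∀ g, gegFun l (p * A g) = gegFun (l + β) (b * g) := by
  -- It suffices to test on `g = C_n^{l+β+1}`. Then both pairings are nonzero for the same `n` and
  -- equal values at `1`; the quotient of these values aligns them and also makes the adjoint
  -- preserve the value at `1`.
  have hZ (a : ℕ) (g : ℝ[X]) : gegFun l (gegDiff (l + 1) a * A g) =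
      gegFun (l + β) (C ((gegDiff (l + 1) a).eval 1 / (gegDiff (l + β + 1) a).eval 1) *
        gegDiff (l + β + 1) a * g) := by
    have hne := (gegDiff_eval_one_pos (show 1 / 2 < l + β + 1 by linarith) a).ne'
    set r := (gegDiff (l + 1) a).eval 1 / (gegDiff (l + β + 1) a).eval 1
    have : gegFun l ∘ₗ LinearMap.mulLeft ℝ (gegDiff (l + 1) a) ∘ₗ A =
        gegFun (l + β) ∘ₗ LinearMap.mulLeft ℝ (C r * gegDiff (l + β + 1) a) := by
      refine linearMap_ext_geg (σ := l + β + 1) (by linarith) fun n => ?_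
      simp only [LinearMap.comp_apply, LinearMap.mulLeft_apply, hA]
      rw [mul_comm, gegFun_geg_mul_gegDiff (by linarith), mul_assoc, gegFun_C_mul, mul_comm _ (geg _ n),
        gegFun_geg_mul_gegDiff (by linarith)]
      split_ifs
      · simp only [r]; field_simp
      · simp
    simpa only [LinearMap.comp_apply, LinearMap.mulLeft_apply] using LinearMap.congr_fun this g
  induction a using Nat.strong_induction_on with
  | _ a ih =>
  intro p hp
  have hk := (geg_lead_pos (show 0 < l + 1 by linarith) a).ne'
  set c := p.coeff a / (geg (l + 1) a).coeff a with hc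
  set q := p - C c * gegDiff (l + 1) a with hq
  have hqp : HasParity a q := hp.sub ((hasParity_gegDiff _ a).C_mul c)
  have hqa : q.coeff a = 0 := by
    rw [hq, coeff_sub, coeff_C_mul, gegDiff_lead, hc]; field_simp; ring
  have hb' : ∃ b, HasParity a b ∧ b.eval 1 = q.eval 1 ∧
      ∀ g, gegFun l (q * A g) = gegFun (l + β) (b * g) := by
    -- The top coefficient of `q` is gone, so by parity its degree is at most `a - 2`.
    rcases Nat.lt_or_ge a 2 with h2 | h2
    · have hq0 : q = 0 := by
        ext i
        by_contra h
        obtain ⟨h3, h4⟩ := hqp i h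
        have : i ≠ a := fun h' => h (by rw [h', hqa, coeff_zero])
        obtain rfl : i = 0 := by omega
        obtain rfl : a = 1 := by omega
        simp at h4
      exact ⟨0, fun i hi => by simp at hi, by simp [hq0], by simp [hq0]⟩
    · obtain ⟨a, rfl⟩ := Nat.exists_eq_add_of_le' h2
      have hqp' : HasParity a q := fun i hi => by
        obtain ⟨h3, h4⟩ := hqp i hi
        have h5 : i ≠ a + 2 := fun h' => hi (h' ▸ hqa)
        refine ⟨?_, by rw [Nat.even_add] at h4 ⊢; rw [← h4]; simp [parity_simps]⟩
        rw [Nat.even_iff] at h4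
        omega
      obtain ⟨b, hb1, hb2, hb3⟩ := ih a (by omega) q hqp'
      exact ⟨b, hb1.add_two, hb2, hb3⟩
  obtain ⟨b, hb1, hb2, hb3⟩ := hb'
  refine ⟨C c * (C ((gegDiff (l + 1) a).eval 1 / (gegDiff (l + β + 1) a).eval 1) *
    gegDiff (l + β + 1) a) + b, (((hasParity_gegDiff _ a).C_mul _).C_mul c).add hb1, ?_, fun g => ?_⟩
  · have hne := (gegDiff_eval_one_pos (show 1 / 2 < l + β + 1 by linarith) a).ne'
    simp only [eval_add, eval_mul, eval_C, hb2, hq, eval_sub]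
    field_simp; ring
  · have hp' : p = C c * gegDiff (l + 1) a + q := by rw [hq]; ring
    conv_lhs => rw [hp', add_mul, map_add, mul_assoc, gegFun_C_mul, hZ, hb3]
    rw [add_mul, map_add, mul_assoc (C c), gegFun_C_mul]

end Gegenbauer

end Paraboloid

end

noncomputable section

namespace Paraboloid

open Polynomial

/-! ### Means with respect to the Beta distribution. -/

section Beta

variable {a b : ℝ}

lemma integral_jacobi_eq (a b : ℝ) (φ : ℝ → ℝ) :
    ∫ z in I, φ ((1 - z) / 2) * ((1 - z) ^ a * (1 + z) ^ b) =
      2 ^ (a + b + 1) * ∫ s in Icc (0 : ℝ) 1, φ s * (s ^ a * (1 - s) ^ b) := by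
  have h := intervalIntegral.integral_comp_sub_mul (a := -1) (b := 1)
    (fun s : ℝ => φ s * (s ^ a * (1 - s) ^ b)) (show (1 / 2 : ℝ) ≠ 0 by norm_num) (1 / 2)
  norm_num at h
  rw [intervalIntegral.integral_of_le (by norm_num), intervalIntegral.integral_of_le (by norm_num),
    ← integral_Icc_eq_integral_Ioc, ← integral_Icc_eq_integral_Ioc] at h
  have h2 : ∀ z ∈ I, φ ((1 - z) / 2) * ((1 - z) ^ a * (1 + z) ^ b) = 2 ^ (a + b) *
      (φ (1 / 2 - 1 / 2 * z) * ((1 / 2 - 1 / 2 * z) ^ a * (1 - (1 / 2 - 1 / 2 * z)) ^ b)) := by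
    intro z hz
    have e1 : 1 - z = 2 * (1 / 2 - 1 / 2 * z) := by ring
    have e2 : 1 + z = 2 * (1 - (1 / 2 - 1 / 2 * z)) := by ring
    rw [e1, e2, Real.mul_rpow (by norm_num) (by linarith [hz.2]),
      Real.mul_rpow (by norm_num) (by linarith [hz.1]), Real.rpow_add (by norm_num),
      mul_div_cancel_left₀ _ (two_ne_zero)]
    ring
  rw [I] at *
  rw [setIntegral_congr_fun measurableSet_Icc h2, integral_const_mul, h,
    Real.rpow_add (by norm_num) (a + b), Real.rpow_one]
  ring

lemma integrableOn_jacobi (ha : -1 < a) (hb : -1 < b) :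
    IntegrableOn (fun z : ℝ => (1 - z) ^ a * (1 + z) ^ b) I := by
  have h1 : IntervalIntegrable (fun s : ℝ => s ^ a * (1 - s) ^ b) volume 0 1 :=
    (intervalIntegrable_iff_integrableOn_Icc_of_le zero_le_one).2 (integrableOn_betaInt hb ha)
  have h2 := (h1.comp_sub_left (1 / 2)).comp_mul_left (c := 1 / 2)
  norm_num at h2
  have h3 := (intervalIntegrable_iff_integrableOn_Icc_of_le (by norm_num)).1 h2.symm
  refine (integrableOn_congr_fun (fun z hz => ?_) measurableSet_Icc).1 (h3.const_mul (2 ^ (a + b)))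
  have e1 : 1 - z = 2 * (1 / 2 - 1 / 2 * z) := by ring
  have e2 : 1 + z = 2 * (1 - (1 / 2 - 1 / 2 * z)) := by ring
  rw [e1, e2, Real.mul_rpow (by norm_num) (by linarith [hz.2]),
    Real.mul_rpow (by norm_num) (by linarith [hz.1]), Real.rpow_add (by norm_num)]
  ring

lemma integrableOn_mul_jacobi (ha : -1 < a) (hb : -1 < b) {φ : ℝ → ℝ} (hφ : Continuous φ) :
    IntegrableOn (fun z : ℝ => φ z * ((1 - z) ^ a * (1 + z) ^ b)) I :=
  (integrableOn_jacobi ha hb).continuousOn_mul hφ.continuousOn isCompact_Icc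

/-- The expectation of `φ B` where `B` has the Beta distribution with parameters `σ₁`, `σ₂`,
written as an integral over `z = 1 - 2 B`. -/
def betaMean (σ₁ σ₂ : ℝ) (φ : ℝ → ℝ) : ℝ :=
  jacobiConst (σ₁ - 1) (σ₂ - 1) *
    ∫ z in I, φ ((1 - z) / 2) * ((1 - z) ^ (σ₁ - 1) * (1 + z) ^ (σ₂ - 1))

/-- The moment of `B^j (1-B)^q` for the Beta distribution. -/
def betaMoment (σ₁ σ₂ : ℝ) (j q : ℕ) : ℝ :=
  Real.Gamma (σ₁ + j) * Real.Gamma (σ₂ + q) * Real.Gamma (σ₁ + σ₂) /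
    (Real.Gamma σ₁ * Real.Gamma σ₂ * Real.Gamma (σ₁ + σ₂ + (j + q)))

variable {σ₁ σ₂ : ℝ}

lemma betaMean_monomial (h1 : 0 < σ₁) (h2 : 0 < σ₂) (j q : ℕ) :
    betaMean σ₁ σ₂ (fun s => s ^ j * (1 - s) ^ q) = betaMoment σ₁ σ₂ j q := by
  have hj : (0 : ℝ) ≤ j := j.cast_nonneg
  have hq : (0 : ℝ) ≤ q := q.cast_nonneg
  rw [betaMean, integral_jacobi_eq (φ := fun s => s ^ j * (1 - s) ^ q)]
  have h : ∫ s in Icc (0 : ℝ) 1, s ^ j * (1 - s) ^ q * (s ^ (σ₁ - 1) * (1 - s) ^ (σ₂ - 1)) =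
      betaInt (σ₂ - 1 + q) (σ₁ - 1 + j) := by
    rw [betaInt, integral_Icc_eq_integral_Ioo, integral_Icc_eq_integral_Ioo]
    refine setIntegral_congr_fun measurableSet_Ioo fun s hs => ?_
    have hs1 : 0 < 1 - s := sub_pos.2 hs.2
    rw [Real.rpow_add hs.1, Real.rpow_add hs1, Real.rpow_natCast, Real.rpow_natCast]
    ring
  rw [h, betaInt_eq (by linarith) (by linarith), jacobiConst, betaMoment,
    show σ₁ - 1 + j + 1 = σ₁ + j by ring, show σ₂ - 1 + q + 1 = σ₂ + q by ring,
    show σ₁ - 1 + j + (σ₂ - 1 + q) + 2 = σ₁ + σ₂ + (j + q) by ring,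
    show σ₁ - 1 + (σ₂ - 1) + 2 = σ₁ + σ₂ by ring, show σ₁ - 1 + 1 = σ₁ by ring,
    show σ₂ - 1 + 1 = σ₂ by ring]
  have h3 : (2 : ℝ) ^ (-(σ₁ - 1) - (σ₂ - 1) - 1) * 2 ^ (σ₁ - 1 + (σ₂ - 1) + 1) = 1 := by
    rw [← Real.rpow_add (by norm_num)]; ring_nf; simp
  generalize (2 : ℝ) ^ (-(σ₁ - 1) - (σ₂ - 1) - 1) = A at *
  generalize (2 : ℝ) ^ (σ₁ - 1 + (σ₂ - 1) + 1) = B at *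
  have h4 : A * (Real.Gamma (σ₁ + σ₂) / (Real.Gamma σ₁ * Real.Gamma σ₂)) *
      (B * (Real.Gamma (σ₁ + j) * Real.Gamma (σ₂ + q) / Real.Gamma (σ₁ + σ₂ + (j + q)))) =
      A * B * ((Real.Gamma (σ₁ + σ₂) / (Real.Gamma σ₁ * Real.Gamma σ₂)) *
      ((Real.Gamma (σ₁ + j) * Real.Gamma (σ₂ + q) / Real.Gamma (σ₁ + σ₂ + (j + q))))) := by ring
  rw [h4, h3, one_mul, div_mul_div_comm]
  ring_nf

lemma betaMean_sum (h1 : 0 < σ₁) (h2 : 0 < σ₂) {ι : Type*} (s : Finset ι) {φ : ι → ℝ → ℝ}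
    (hφ : ∀ i, Continuous (φ i)) :
    betaMean σ₁ σ₂ (fun B => ∑ i ∈ s, φ i B) = ∑ i ∈ s, betaMean σ₁ σ₂ (φ i) := by
  simp only [betaMean, Finset.sum_mul]
  rw [integral_finsetSum, Finset.mul_sum]
  intro i _
  exact integrableOn_mul_jacobi (by linarith) (by linarith)
    ((hφ i).comp (by fun_prop : Continuous fun z : ℝ => (1 - z) / 2))

lemma betaMean_const_mul (σ₁ σ₂ r : ℝ) (φ : ℝ → ℝ) :
    betaMean σ₁ σ₂ (fun B => r * φ B) = r * betaMean σ₁ σ₂ φ := by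
  simp only [betaMean, mul_assoc, integral_const_mul]; ring

end Beta

/-! ### The Gegenbauer generating function by truncated binomial series. -/

section GeneratingFunction

/-- The coefficients of the binomial series `(1 - h)^(-σ)`. -/
def risingCoeff (σ : ℝ) (m : ℕ) : ℝ := Real.Gamma (σ + m) / (Real.Gamma σ * m.factorial)

variable {σ : ℝ}

lemma risingCoeff_zero (hσ : 0 < σ) : risingCoeff σ 0 = 1 := by
  simp [risingCoeff, (Real.Gamma_pos_of_pos hσ).ne']

lemma risingCoeff_succ (hσ : 0 < σ) (m : ℕ) :
    (m + 1) * risingCoeff σ (m + 1) = (σ + m) * risingCoeff σ m := by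
  have h : 0 < σ + m := by positivity
  have hG := (Real.Gamma_pos_of_pos hσ).ne'
  rw [risingCoeff, risingCoeff, Nat.cast_add, Nat.cast_one, ← add_assoc, Real.Gamma_add_one h.ne',
    Nat.factorial_succ]
  push_cast
  have : (m.factorial : ℝ) ≠ 0 := by positivity
  field_simp

/-- The polynomial `2 x r - r²` in `r`. -/
def genBase (x : ℝ) : ℝ[X] := C (2 * x) * X - X ^ 2

/-- The partial sums of the binomial series of `(1 - 2 x r + r²)^(-σ)`. -/
def genSum (σ x : ℝ) (N : ℕ) : ℝ[X] := ∑ m ∈ Finset.range N, C (risingCoeff σ m) * genBase x ^ m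

lemma coeff_genBase_pow {x : ℝ} {m k : ℕ} (h : k < m) : (genBase x ^ m).coeff k = 0 := by
  rw [show genBase x = X * (C (2 * x) - X) by rw [genBase]; ring, mul_pow, coeff_X_pow_mul',
    if_neg (by omega)]

/-- A truncated form of `(1 - w) G' = σ w' G` for `G = (1 - w)^(-σ)`. The error is a multiple of
`w^M`, hence of `r^M`, and leaves the lower coefficients untouched. -/
lemma derivative_genSum (hσ : 0 < σ) (x : ℝ) (M : ℕ) :
    (1 - genBase x) * derivative (genSum σ x (M + 1)) = derivative (genBase x) *
      (C σ * genSum σ x (M + 1) - C ((σ + M) * risingCoeff σ M) * genBase x ^ M) := by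
  induction M with
  | zero => simp [genSum, risingCoeff_zero hσ]
  | succ M ih =>
    have h1 : genSum σ x (M + 1 + 1) =
        genSum σ x (M + 1) + C (risingCoeff σ (M + 1)) * genBase x ^ (M + 1) := by
      rw [genSum, Finset.sum_range_succ, ← genSum]
    have h2 := congrArg C (risingCoeff_succ hσ M)
    rw [h1, derivative_add, derivative_C_mul, derivative_pow]
    simp only [map_mul, map_add, map_one, Nat.add_sub_cancel, Nat.cast_add, Nat.cast_one,
      map_natCast] at *
    linear_combination ih + genBase x ^ M * derivative (genBase x) * h2

lemma coeff_genSum_recurrence (hσ : 0 < σ) (x : ℝ) {M n : ℕ} (h : n + 1 < M) :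
    (n + 2) * (genSum σ x (M + 1)).coeff (n + 2) =
      2 * (n + 1 + σ) * x * (genSum σ x (M + 1)).coeff (n + 1) -
        (n + 2 * σ) * (genSum σ x (M + 1)).coeff n := by
  have hd := congrArg (fun p => coeff p (n + 1)) (derivative_genSum hσ x M)
  set G := genSum σ x (M + 1)
  have e1 : (1 - genBase x) * derivative G =
      derivative G - C (2 * x) * (X * derivative G) + X * (X * derivative G) := by
    rw [genBase]; ring
  have e2 : derivative (genBase x) = C (2 * x) - C 2 * X := by
    rw [genBase, show (C 2 : ℝ[X]) = 2 from rfl]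
    simp [show (1 : ℝ[X]) + 1 = 2 by norm_num]
  have e3 : derivative (genBase x) * (C σ * G - C ((σ + M) * risingCoeff σ M) * genBase x ^ M) =
      C (2 * x * σ) * G - C (2 * σ) * (X * G) -
        C ((σ + M) * risingCoeff σ M) * (C (2 * x) * genBase x ^ M - C 2 * (X * genBase x ^ M)) := by
    rw [e2]; simp only [map_mul]; ring
  have e4 : (X * (X * derivative G)).coeff (n + 1) = n * G.coeff n := by
    rw [coeff_X_mul]
    rcases n with _ | n
    · simp
    · rw [coeff_X_mul, coeff_derivative]; push_cast; ring
  rw [e1, e3] at hd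
  simp only [coeff_add, coeff_sub, coeff_C_mul, e4] at hd
  rw [coeff_genBase_pow h, coeff_X_mul, coeff_X_mul, coeff_X_mul, coeff_genBase_pow (by omega),
    coeff_derivative, coeff_derivative] at hd
  push_cast at hd
  linear_combination hd

lemma coeff_genSum_one (hσ : 0 < σ) (x : ℝ) {M : ℕ} (h : 0 < M) :
    (genSum σ x (M + 1)).coeff 1 = 2 * σ * x * (genSum σ x (M + 1)).coeff 0 := by
  have hd := congrArg (fun p => coeff p 0) (derivative_genSum hσ x M)
  simp only [mul_coeff_zero, coeff_sub, coeff_genBase_pow h, coeff_derivative] at hd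
  simp [genBase] at hd
  linear_combination hd

lemma coeff_genSum_zero (hσ : 0 < σ) (x : ℝ) (M : ℕ) : (genSum σ x (M + 1)).coeff 0 = 1 := by
  rw [genSum, Finset.sum_range_succ', coeff_add, finsetSum_coeff, Finset.sum_eq_zero]
  · simp [risingCoeff_zero hσ]
  · intro m _
    rw [coeff_C_mul, coeff_genBase_pow (by omega), mul_zero]

lemma coeff_genSum (hσ : 0 < σ) (x : ℝ) (M : ℕ) : ∀ n ≤ M,
    (genSum σ x (M + 1)).coeff n = (geg σ n).eval x := by
  intro n
  induction n using geg.induct with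
  | case1 => intro _; simp [coeff_genSum_zero hσ, geg]
  | case2 =>
    intro h
    rw [coeff_genSum_one hσ x (by omega), coeff_genSum_zero hσ]; simp [geg]
  | case3 n h1 h0 =>
    intro h
    have hr := coeff_genSum_recurrence hσ x (show n + 1 < M by omega)
    have hg := congrArg (eval x) (geg_add_two σ n)
    simp only [eval_mul, eval_sub, eval_C, eval_X] at hg
    rw [h1 (by omega), h0 (by omega)] at hr
    refine mul_left_cancel₀ (show (n + 2 : ℝ) ≠ 0 by positivity) ?_
    linear_combination hr - hg

end GeneratingFunction

end Paraboloid

end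

noncomputable section

namespace Paraboloid

open Polynomial

/-! ### Beta averages of Gegenbauer polynomials. -/

section ProductFormula

variable {σ₁ σ₂ : ℝ}

/-- The coefficient form of the statement that the Beta mean of `(1 - B w₁ - (1-B) w₂)^(-σ₁-σ₂)` is
`(1-w₁)^(-σ₁) (1-w₂)^(-σ₂)`. It applies because `genBase x` is affine in `x` (`genBase_mix`). -/
lemma risingCoeff_mul_betaMoment (h1 : 0 < σ₁) (h2 : 0 < σ₂) (j q : ℕ) :
    risingCoeff (σ₁ + σ₂) (j + q) * (((j + q).choose j : ℝ) * betaMoment σ₁ σ₂ j q) =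
      risingCoeff σ₁ j * risingCoeff σ₂ q := by
  have hA := (Real.Gamma_pos_of_pos h1).ne'
  have hB := (Real.Gamma_pos_of_pos h2).ne'
  have hC := (Real.Gamma_pos_of_pos (add_pos h1 h2)).ne'
  have hD := (Real.Gamma_pos_of_pos (show 0 < σ₁ + σ₂ + (j + q) by positivity)).ne'
  have hch : ((j + q).choose j : ℝ) * (j.factorial * q.factorial) = (j + q).factorial := by
    have := Nat.add_choose_mul_factorial_mul_factorial j q
    rw [← Nat.choose_symm_add] at this
    rw [mul_assoc] at this
    exact_mod_cast this
  have hj : (j.factorial : ℝ) ≠ 0 := by positivity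
  have hq : (q.factorial : ℝ) ≠ 0 := by positivity
  have hjq : ((j + q).factorial : ℝ) ≠ 0 := by positivity
  rw [risingCoeff, risingCoeff, risingCoeff, betaMoment, Nat.cast_add]
  generalize Real.Gamma (σ₁ + σ₂ + (j + q)) = D at *
  generalize Real.Gamma (σ₁ + σ₂) = E at *
  generalize Real.Gamma (σ₁ + j) = F at *
  generalize Real.Gamma (σ₂ + q) = G at *
  generalize Real.Gamma σ₁ = H at *
  generalize Real.Gamma σ₂ = K at *
  field_simp
  rw [← hch]; ring

lemma genBase_mix (x z B : ℝ) :
    genBase (B * x + (1 - B) * z) = C B * genBase x + C (1 - B) * genBase z := by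
  simp only [genBase, mul_add, map_add, map_mul, map_sub, map_one]; ring

lemma coeff_genSum_mix (x z B : ℝ) (n : ℕ) :
    (genSum (σ₁ + σ₂) (B * x + (1 - B) * z) (n + 1)).coeff n =
      ∑ m ∈ Finset.range (n + 1), ∑ j ∈ Finset.range (m + 1),
        risingCoeff (σ₁ + σ₂) m * (m.choose j) * (genBase x ^ j * genBase z ^ (m - j)).coeff n *
          (B ^ j * (1 - B) ^ (m - j)) := by
  rw [genSum, finsetSum_coeff]
  refine Finset.sum_congr rfl fun m _ => ?_
  rw [coeff_C_mul, genBase_mix, add_pow, finsetSum_coeff, Finset.mul_sum]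
  refine Finset.sum_congr rfl fun j _ => ?_
  have : (C B * genBase x) ^ j * (C (1 - B) * genBase z) ^ (m - j) * (m.choose j : ℝ[X]) =
      C (B ^ j * (1 - B) ^ (m - j) * m.choose j) * (genBase x ^ j * genBase z ^ (m - j)) := by
    simp only [map_mul, map_pow, map_natCast]; ring
  rw [this, coeff_C_mul]
  ring

/-- The Gegenbauer polynomials with index `σ₁ + σ₂`, averaged over a Beta distributed point of
the segment from `z` to `x`. -/
lemma betaMean_geg (h1 : 0 < σ₁) (h2 : 0 < σ₂) (x z : ℝ) (n : ℕ) :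
    betaMean σ₁ σ₂ (fun B => (geg (σ₁ + σ₂) n).eval (B * x + (1 - B) * z)) =
      ∑ p ∈ Finset.HasAntidiagonal.antidiagonal n, (geg σ₁ p.1).eval x * (geg σ₂ p.2).eval z := by
  have hl : betaMean σ₁ σ₂ (fun B => (geg (σ₁ + σ₂) n).eval (B * x + (1 - B) * z)) =
      ∑ m ∈ Finset.range (n + 1), ∑ j ∈ Finset.range (m + 1),
        risingCoeff σ₁ j * risingCoeff σ₂ (m - j) *
          (genBase x ^ j * genBase z ^ (m - j)).coeff n := by
    simp_rw [← coeff_genSum (add_pos h1 h2) _ n n le_rfl, coeff_genSum_mix]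
    rw [betaMean_sum h1 h2 _ (fun m => by fun_prop)]
    refine Finset.sum_congr rfl fun m _ => ?_
    rw [betaMean_sum h1 h2 _ (fun m => by fun_prop)]
    refine Finset.sum_congr rfl fun j hj => ?_
    have hjm : j + (m - j) = m := by have := Finset.mem_range.1 hj; omega
    rw [betaMean_const_mul, betaMean_monomial h1 h2]
    have := risingCoeff_mul_betaMoment h1 h2 j (m - j)
    rw [hjm] at this
    rw [← this]; ring
  have hr : ∑ p ∈ Finset.HasAntidiagonal.antidiagonal n, (geg σ₁ p.1).eval x * (geg σ₂ p.2).eval z =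
      ∑ j ∈ Finset.range (n + 1), ∑ q ∈ Finset.range (n + 1),
        risingCoeff σ₁ j * risingCoeff σ₂ q * (genBase x ^ j * genBase z ^ q).coeff n := by
    have : ∑ p ∈ Finset.HasAntidiagonal.antidiagonal n, (geg σ₁ p.1).eval x * (geg σ₂ p.2).eval z =
        (genSum σ₁ x (n + 1) * genSum σ₂ z (n + 1)).coeff n := by
      rw [coeff_mul]
      refine Finset.sum_congr rfl fun p hp => ?_
      have := Finset.HasAntidiagonal.mem_antidiagonal.1 hp
      rw [coeff_genSum h1 x n _ (by omega), coeff_genSum h2 z n _ (by omega)]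
    rw [this, genSum, genSum, Finset.sum_mul_sum, finsetSum_coeff]
    refine Finset.sum_congr rfl fun j _ => ?_
    rw [finsetSum_coeff]
    refine Finset.sum_congr rfl fun q _ => ?_
    rw [mul_mul_mul_comm, ← C_mul, coeff_C_mul]
  rw [hl, hr, Finset.sum_range_diag_flip (n + 1) fun j q =>
    risingCoeff σ₁ j * risingCoeff σ₂ q * (genBase x ^ j * genBase z ^ q).coeff n]
  -- The triangle `j + q ≤ n` may be enlarged to a square: the other terms are divisible by
  -- `r^(j+q)` with `j + q > n`.
  refine Finset.sum_congr rfl fun j _ => Finset.sum_subset (by simp) fun q _ hq => ?_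
  have hq' : n < j + q := by simp at hq; omega
  have h (x : ℝ) : genBase x = X * (C (2 * x) - X) := by rw [genBase]; ring
  rw [h x, h z, mul_pow, mul_pow, mul_mul_mul_comm, ← pow_add, coeff_X_pow_mul', if_neg (by omega),
    mul_zero]

end ProductFormula

/-! ### The one-variable average that lowers the Gegenbauer index. -/

section Average

/-- The linear map with prescribed values on powers of `X`. -/
def powMap (φ : ℕ → ℝ[X]) : ℝ[X] →ₗ[ℝ] ℝ[X] := lsum fun i => LinearMap.toSpanSingleton ℝ ℝ[X] (φ i)

lemma powMap_monomial (φ : ℕ → ℝ[X]) (i : ℕ) (a : ℝ) : powMap φ (monomial i a) = a • φ i := by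
  simp [powMap]

/-- The coefficient of `x^(i-q) z^q` in the mean of `(B x + (1 - B) z)^i`. -/
def mixCoeff (σ₁ σ₂ : ℝ) (i q : ℕ) : ℝ := i.choose q * betaMoment σ₁ σ₂ (i - q) q

/-- The mean of `(B x + (1 - B) z)^i` as a polynomial in `z`. -/
def mixPoly (σ₁ σ₂ x : ℝ) (i : ℕ) : ℝ[X] :=
  ∑ q ∈ Finset.range (i + 1), C (mixCoeff σ₁ σ₂ i q * x ^ (i - q)) * X ^ q

variable {σ₁ σ₂ : ℝ}

lemma betaMean_mix_pow (h1 : 0 < σ₁) (h2 : 0 < σ₂) (x z : ℝ) (i : ℕ) :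
    betaMean σ₁ σ₂ (fun B => (B * x + (1 - B) * z) ^ i) =
      ∑ q ∈ Finset.range (i + 1), mixCoeff σ₁ σ₂ i q * x ^ (i - q) * z ^ q := by
  have : (fun B : ℝ => (B * x + (1 - B) * z) ^ i) = fun B => ∑ q ∈ Finset.range (i + 1),
      (i.choose q * x ^ (i - q) * z ^ q) * (B ^ (i - q) * (1 - B) ^ q) := by
    funext B
    rw [add_comm, add_pow]
    refine Finset.sum_congr rfl fun q _ => ?_
    rw [mul_pow, mul_pow]; ring
  rw [this, betaMean_sum h1 h2 _ (fun m => by fun_prop)]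
  refine Finset.sum_congr rfl fun q _ => ?_
  rw [betaMean_const_mul, betaMean_monomial h1 h2, mixCoeff]; ring

lemma eval_powMap_mixPoly (h1 : 0 < σ₁) (h2 : 0 < σ₂) (x z : ℝ) (p : ℝ[X]) :
    (powMap (mixPoly σ₁ σ₂ x) p).eval z =
      betaMean σ₁ σ₂ (fun B => p.eval (B * x + (1 - B) * z)) := by
  simp_rw [eval_eq_sum_range (p := p)]
  rw [betaMean_sum h1 h2 _ (fun m => by fun_prop)]
  conv_lhs => rw [p.as_sum_range, map_sum, eval_finsetSum]
  refine Finset.sum_congr rfl fun i _ => ?_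
  rw [betaMean_const_mul, betaMean_mix_pow h1 h2, powMap_monomial, eval_smul, smul_eq_mul, mixPoly,
    eval_finsetSum]
  simp

/-- The average of a polynomial over a random point of the segment from `x` to a random `z`,
the distribution of `z` being that of the weight `(1 - z²)^(β - 1/2)`. -/
def gegAvg (l β : ℝ) : ℝ[X] →ₗ[ℝ] ℝ[X] :=
  powMap fun i => ∑ q ∈ Finset.range (i + 1),
    C (mixCoeff (l + 1) β i q * gegMoment β q) * X ^ (i - q)

lemma eval_gegAvg (l β x : ℝ) (p : ℝ[X]) :
    (gegAvg l β p).eval x = gegFun β (powMap (mixPoly (l + 1) β x) p) := by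
  induction p using Polynomial.induction_on' with
  | add p q hp hq => simp only [map_add, eval_add, hp, hq]
  | monomial i a =>
    rw [gegAvg, powMap_monomial, powMap_monomial, map_smul, eval_smul, mixPoly, map_sum,
      eval_finsetSum]
    congr 1
    refine Finset.sum_congr rfl fun q _ => ?_
    rw [gegFun_C_mul_X_pow]; simp; ring

/-- The Beta mean gives `∑ C_i^{l+1}(x) C_j^β(z)` over `i + j = n`; averaging over `z` kills every
term with `j > 0`. -/
lemma gegAvg_geg {l β : ℝ} (hl : -1 / 2 < l) (hβ : 0 < β) (n : ℕ) :
    gegAvg l β (geg (l + β + 1) n) = geg (l + 1) n := by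
  refine Polynomial.funext fun x => ?_
  have h : powMap (mixPoly (l + 1) β x) (geg (l + β + 1) n) =
      ∑ p ∈ Finset.HasAntidiagonal.antidiagonal n, C ((geg (l + 1) p.1).eval x) * geg β p.2 := by
    refine Polynomial.funext fun z => ?_
    rw [eval_powMap_mixPoly (by linarith) hβ, show l + β + 1 = l + 1 + β by ring,
      betaMean_geg (by linarith) hβ, eval_finsetSum]
    simp
  rw [eval_gegAvg, h, map_sum, Finset.sum_eq_single (n, 0)]
  · rw [gegFun_C_mul]
    simp [geg]
    rw [← pow_zero X, gegFun_X_pow, gegMoment_zero, mul_one]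
    linarith
  · rintro ⟨i, j⟩ hp hne
    have hp' := Finset.HasAntidiagonal.mem_antidiagonal.1 hp
    have hj : j ≠ 0 := by rintro rfl; exact hne (by simpa using hp')
    rw [gegFun_C_mul, gegFun_geg_of_pos hβ (by omega), mul_zero]
  · intro h; simp at h

end Average

end Paraboloid

end

noncomputable section

namespace Paraboloid

open MvPolynomial

/-! ### Segment step: the average over `z` and its adjoint. -/

section SegmentStep

variable {γ κ b l β : ℝ}

/-- The exponent vector of `v^i s^j`. -/
def expo (i j : ℕ) : Fin 2 →₀ ℕ := Finsupp.single 0 i + Finsupp.single 1 j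

@[simp] lemma expo_zero (i j : ℕ) : expo i j 0 = i := by simp [expo]

@[simp] lemma expo_one (i j : ℕ) : expo i j 1 = j := by simp [expo]

lemma degree_expo (i j : ℕ) : (expo i j).degree = i + j := by simp [expo]

lemma degree_fin_two (m : Fin 2 →₀ ℕ) : m.degree = m 0 + m 1 := by
  rw [Finsupp.degree_eq_sum, Fin.sum_univ_two]

lemma totalDegree_monomial_expo_le {i j n : ℕ} (h : i + j ≤ n) (r : ℝ) :
    (monomial (expo i j) r).totalDegree ≤ n :=
  (totalDegree_monomial_le _ _).trans ((degree_expo i j).le.trans h)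

lemma parU_monomial' (hγ : -1 < γ) (hκ : -1 < κ) (hb : -1 < b + (κ + 1 / 2)) (m : Fin 2 →₀ ℕ)
    (hl : l = κ + 1 / 2) (r : ℝ) :
    parU hγ hκ hb (monomial m r) =
      r * (gegMoment l (m 0) * (betaInt γ (b + l + m 1 + (m 0 : ℝ) / 2) / betaInt γ (b + l))) := by
  rw [← parU_monomial hγ hκ hb m hl, ← smul_eq_mul, ← map_smul, smul_monomial, smul_eq_mul, mul_one]

/-- The average of `v'^i s^j` over a random point `v'` of the segment from `v` to `√s z`, where
`z` has the distribution with moments `gegMoment β`. -/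
def segAvgMonomial (l β : ℝ) (m : Fin 2 →₀ ℕ) : MvPolynomial (Fin 2) ℝ :=
  ∑ q ∈ Finset.range (m 0 + 1),
    monomial (expo (m 0 - q) (m 1 + q / 2)) (mixCoeff (l + 1) β (m 0) q * gegMoment β q)

lemma totalDegree_segAvgMonomial (l β : ℝ) (m : Fin 2 →₀ ℕ) :
    (segAvgMonomial l β m).totalDegree ≤ m.degree := by
  refine totalDegree_finsetSum_le fun q hq => totalDegree_monomial_expo_le ?_ _
  have := Finset.mem_range.1 hq
  rw [degree_fin_two]
  omega

lemma gegFun_X_pow_mul_gegAvg (l β : ℝ) (a i : ℕ) :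
    gegFun l (Polynomial.X ^ a * gegAvg l β (Polynomial.X ^ i)) =
      ∑ q ∈ Finset.range (i + 1), mixCoeff (l + 1) β i q * gegMoment β q *
        gegMoment l (a + (i - q)) := by
  rw [Polynomial.X_pow_eq_monomial (n := i), gegAvg, powMap_monomial, one_smul, Finset.mul_sum,
    map_sum]
  refine Finset.sum_congr rfl fun q _ => ?_
  rw [mul_left_comm, ← pow_add, gegFun_C_mul_X_pow]

/-- Under `v = √s u` the functional factors into `gegFun l` in `u` and a moment in `s` that sees
only degrees. -/
lemma parU_monomial_mul_segAvgMonomial (hγ : -1 < γ) (hκ : -1 < l - 1 / 2)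
    (hb : -1 < b + (l - 1 / 2 + 1 / 2)) (m m' : Fin 2 →₀ ℕ) :
    parU hγ hκ hb (monomial m 1 * segAvgMonomial l β m') =
      gegFun l (Polynomial.X ^ m 0 * gegAvg l β (Polynomial.X ^ m' 0)) *
        (betaInt γ (b + l + (m 1 + m' 1) + ((m 0 : ℝ) + m' 0) / 2) / betaInt γ (b + l)) := by
  rw [gegFun_X_pow_mul_gegAvg, segAvgMonomial, Finset.mul_sum, map_sum, Finset.sum_mul]
  refine Finset.sum_congr rfl fun q hq => ?_
  have hq' : q ≤ m' 0 := Nat.lt_succ_iff.1 (Finset.mem_range.1 hq)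
  rw [monomial_mul, one_mul, parU_monomial' (l := l) hγ hκ hb _ (by ring)]
  simp only [Finsupp.add_apply, expo_zero, expo_one]
  rcases Nat.even_or_odd q with ⟨r, rfl⟩ | ho
  · rw [show (r + r) / 2 = r by omega]
    push_cast [hq']
    rw [show b + l + ((m 1 : ℝ) + (m' 1 + r)) + ((m 0 : ℝ) + (m' 0 - (r + r))) / 2 =
      b + l + (m 1 + m' 1) + ((m 0 : ℝ) + m' 0) / 2 by ring]
    ring
  · rw [gegMoment_odd β ho]; ring

/-- The polynomial `s^j ∑_i p_i v^i s^((a-i)/2)`. -/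
def segAdjMonomial (p : Polynomial ℝ) (a j : ℕ) : MvPolynomial (Fin 2) ℝ :=
  ∑ i ∈ Finset.range (a + 1), monomial (expo i (j + (a - i) / 2)) (p.coeff i)

lemma totalDegree_segAdjMonomial (p : Polynomial ℝ) (a j : ℕ) :
    (segAdjMonomial p a j).totalDegree ≤ a + j := by
  refine totalDegree_finsetSum_le fun i hi => totalDegree_monomial_expo_le ?_ _
  have := Finset.mem_range.1 hi
  omega

lemma HasParity.exists_half {a i : ℕ} {p : Polynomial ℝ} (hp : HasParity a p)
    (hi : p.coeff i ≠ 0) : ∃ r, a = i + (r + r) := by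
  obtain ⟨h1, h2⟩ := hp i hi
  obtain ⟨r, hr⟩ := h2
  exact ⟨r - i, by omega⟩

lemma parU_segAdjMonomial_mul_monomial (hγ : -1 < γ) (hκ : -1 < l - 1 / 2)
    (hb : -1 < b + (l - 1 / 2 + 1 / 2)) {p : Polynomial ℝ} {a : ℕ} (hp : HasParity a p) (j : ℕ)
    (m' : Fin 2 →₀ ℕ) :
    parU hγ hκ hb (segAdjMonomial p a j * monomial m' 1) =
      gegFun l (p * Polynomial.X ^ m' 0) *
        (betaInt γ (b + l + (j + m' 1) + ((a : ℝ) + m' 0) / 2) / betaInt γ (b + l)) := by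
  have h : p * Polynomial.X ^ m' 0 =
      ∑ i ∈ Finset.range (a + 1), Polynomial.C (p.coeff i) * Polynomial.X ^ (i + m' 0) := by
    conv_lhs => rw [p.as_sum_range_C_mul_X_pow' (n := a + 1) (Nat.lt_succ_of_le hp.natDegree_le)]
    rw [Finset.sum_mul]
    exact Finset.sum_congr rfl fun i _ => by rw [mul_assoc, pow_add]
  rw [h, map_sum, segAdjMonomial, Finset.sum_mul, map_sum, Finset.sum_mul]
  refine Finset.sum_congr rfl fun i _ => ?_
  by_cases hi : p.coeff i = 0
  · rw [hi]; simp
  obtain ⟨r, rfl⟩ := hp.exists_half hi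
  rw [monomial_mul, mul_one, parU_monomial' (l := l) hγ hκ hb _ (by ring), gegFun_C_mul_X_pow]
  simp only [Finsupp.add_apply, expo_zero, expo_one]
  rw [show (i + (r + r) - i) / 2 = r by omega]
  push_cast
  rw [show b + l + ((j : ℝ) + r + m' 1) + ((i : ℝ) + m' 0) / 2 =
    b + l + (j + m' 1) + ((i : ℝ) + (r + r) + m' 0) / 2 by ring]
  ring

lemma eval_segAdjMonomial {p : Polynomial ℝ} {a : ℕ} (hp : HasParity a p) (j : ℕ) {t : ℝ}
    (ht : 0 ≤ t) : eval (coordU (√t, t)) (segAdjMonomial p a j) = p.eval 1 * (√t ^ a * t ^ j) := by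
  rw [Polynomial.eval_eq_sum_range' (Nat.lt_succ_of_le hp.natDegree_le), segAdjMonomial, map_sum,
    Finset.sum_mul]
  refine Finset.sum_congr rfl fun i _ => ?_
  by_cases hi : p.coeff i = 0
  · rw [hi]; simp
  obtain ⟨r, rfl⟩ := hp.exists_half hi
  rw [eval_coordU_monomial, expo_zero, expo_one, show (i + (r + r) - i) / 2 = r by omega]
  have : √t ^ (i + (r + r)) = √t ^ i * t ^ r := by
    rw [pow_add, ← two_mul, pow_mul, Real.sq_sqrt ht]
  simp only [this]
  ring

/-- Both weights have the same value `l + β` of `b + κ + 1/2`, so the moments in `s` agree and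
`exists_adjoint` for `X ^ a` gives the identity in `u`. Keeping the value at `1` becomes keeping the
value at `(√t, t)`. -/
lemma isDegreeAdjoint_segment (hγ : -1 < γ) (hl : -1 / 2 < l) (hβ : 0 < β)
    (hκ : -1 < l - 1 / 2) (hb : -1 < β + (l - 1 / 2 + 1 / 2))
    (hκ' : -1 < l + β - 1 / 2) (hb' : -1 < 0 + (l + β - 1 / 2 + 1 / 2)) :
    ∃ Q : MvPolynomial (Fin 2) ℝ →ₗ[ℝ] MvPolynomial (Fin 2) ℝ,
      IsDegreeAdjoint (parU hγ hκ hb) (parU hγ hκ' hb') (monoMap (segAvgMonomial l β)) Q ∧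
      ∀ (f : MvPolynomial (Fin 2) ℝ) (t : ℝ), 0 ≤ t →
        eval (coordU (√t, t)) (Q f) = eval (coordU (√t, t)) f := by
  choose p hp1 hp2 hp3 using fun a =>
    exists_adjoint hl hβ.le (gegAvg_geg hl hβ) a _ (hasParity_X_pow a)
  refine ⟨monoMap fun m => segAdjMonomial (p (m 0)) (m 0) (m 1), isDegreeAdjoint_monoMap
    (totalDegree_segAvgMonomial l β) (fun m => ?_) (fun m m' => ?_), fun f t ht => ?_⟩
  · rw [degree_fin_two]; exact totalDegree_segAdjMonomial _ _ _
  · rw [parU_monomial_mul_segAvgMonomial, parU_segAdjMonomial_mul_monomial hγ hκ' hb' (hp1 _), hp3,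
      show (0 : ℝ) + (l + β) = β + l by ring]
  · have : evalFun (coordU (√t, t)) ∘ₗ
        monoMap (fun m => segAdjMonomial (p (m 0)) (m 0) (m 1)) = evalFun (coordU (√t, t)) := by
      refine linearMap_ext_monomial fun m => ?_
      rw [LinearMap.comp_apply, monoMap_monomial, one_smul, evalFun_apply, evalFun_apply,
        eval_coordU_monomial, eval_segAdjMonomial (hp1 _) _ ht, hp2]
      simp
    simpa only [LinearMap.comp_apply, evalFun_apply] using LinearMap.congr_fun this f

end SegmentStep

/-! ### The kernel at the vertex `t = 0`. -/

section Vertex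

variable {γ κ b : ℝ}

/-- The average over `v = √s u`, where `u` has the distribution with moments `gegMoment l`. -/
def radialAvgMonomial (l : ℝ) (m : Fin 2 →₀ ℕ) : MvPolynomial (Fin 2) ℝ :=
  monomial (expo 0 (m 1 + m 0 / 2)) (gegMoment l (m 0))

lemma totalDegree_radialAvgMonomial (l : ℝ) (m : Fin 2 →₀ ℕ) :
    (radialAvgMonomial l m).totalDegree ≤ m.degree := by
  refine totalDegree_monomial_expo_le ?_ _
  rw [degree_fin_two]; omega

/-- Averaging over `v` at fixed `s` is a conditional expectation, hence self-adjoint. -/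
lemma isDegreeAdjoint_radial (hγ : -1 < γ) (hκ : -1 < κ) (hb : -1 < b + (κ + 1 / 2)) :
    IsDegreeAdjoint (parU hγ hκ hb) (parU hγ hκ hb) (monoMap (radialAvgMonomial (κ + 1 / 2)))
      (monoMap (radialAvgMonomial (κ + 1 / 2))) := by
  refine isDegreeAdjoint_monoMap (totalDegree_radialAvgMonomial _)
    (totalDegree_radialAvgMonomial _) fun m m' => ?_
  rw [radialAvgMonomial, radialAvgMonomial, monomial_mul, monomial_mul, parU_monomial' hγ hκ hb _ rfl,
    parU_monomial' hγ hκ hb _ rfl]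
  simp only [Finsupp.add_apply, expo_zero, expo_one, add_zero, zero_add, one_mul, mul_one]
  rcases Nat.even_or_odd (m 0) with ⟨i, hi⟩ | ho
  · rcases Nat.even_or_odd (m' 0) with ⟨i', hi'⟩ | ho'
    · rw [hi, hi', show (i + i) / 2 = i by omega, show (i' + i') / 2 = i' by omega]
      push_cast
      rw [show b + (κ + 1 / 2) + ((m 1 : ℝ) + (m' 1 + i')) + ((i : ℝ) + i) / 2 =
        b + (κ + 1 / 2) + (m 1 + i + m' 1) + ((i' : ℝ) + i') / 2 by ring]
      ring
    · rw [gegMoment_odd _ ho']; simp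
  · rw [gegMoment_odd _ ho]; simp

lemma eval_radialAvg_vertex {l : ℝ} (hl : -1 < l) (f : MvPolynomial (Fin 2) ℝ) :
    eval (coordU (0, 0)) (monoMap (radialAvgMonomial l) f) = eval (coordU (0, 0)) f := by
  have : evalFun (coordU (0, 0)) ∘ₗ monoMap (radialAvgMonomial l) = evalFun (coordU (0, 0)) := by
    refine linearMap_ext_monomial fun m => ?_
    rw [LinearMap.comp_apply, monoMap_monomial, one_smul, evalFun_apply, evalFun_apply,
      eval_coordU_monomial, radialAvgMonomial, eval_coordU_monomial, expo_zero, expo_one]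
    simp only
    rcases Nat.even_or_odd (m 0) with ⟨i, hi⟩ | ho
    · rcases Nat.eq_zero_or_pos i with rfl | h
      · simp [hi, gegMoment_zero hl]
      · have : i + i ≠ 0 := by omega
        have h2 : m 1 + (i + i) / 2 ≠ 0 := by omega
        rw [hi, zero_pow this, zero_pow h2]; simp
    · rw [gegMoment_odd _ ho]; simp [ho.pos.ne']
  simpa only [LinearMap.comp_apply, evalFun_apply] using LinearMap.congr_fun this f

lemma eval_radialAvg (l v v' s : ℝ) (f : MvPolynomial (Fin 2) ℝ) :
    eval (coordU (v, s)) (monoMap (radialAvgMonomial l) f) =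
      eval (coordU (v', s)) (monoMap (radialAvgMonomial l) f) := by
  have : evalFun (coordU (v, s)) ∘ₗ monoMap (radialAvgMonomial l) =
      evalFun (coordU (v', s)) ∘ₗ monoMap (radialAvgMonomial l) := by
    refine linearMap_ext_monomial fun m => ?_
    simp [monoMap_monomial, evalFun_apply, radialAvgMonomial, eval_coordU_monomial]
  simpa only [LinearMap.comp_apply, evalFun_apply] using LinearMap.congr_fun this f

/-- An orthogonal polynomial that represents evaluation at the vertex does not depend on `v`. -/
lemma eval_eq_of_repr_vertex (hγ : -1 < γ) (hκ : -1 < κ) (hb : -1 < b + (κ + 1 / 2)) {n : ℕ}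
    {k : MvPolynomial (Fin 2) ℝ} (hk : k ∈ orthoSubmodule (parU hγ hκ hb) n)
    (h : ∀ f ∈ orthoSubmodule (parU hγ hκ hb) n,
      parU hγ hκ hb (f * k) = evalFun (coordU (0, 0)) f) (v v' s : ℝ) :
    eval (coordU (v, s)) k = eval (coordU (v', s)) k := by
  obtain ⟨h1, h2⟩ := (isDegreeAdjoint_radial hγ hκ hb).repr hk h
  -- Radial averaging does not change evaluation at the vertex, so `k` and its average represent the
  -- same functional.
  have : k = monoMap (radialAvgMonomial (κ + 1 / 2)) k :=
    orthoSubmodule_eq_of_repr n (parU_definite hγ hκ hb) hk h1 fun f hf => by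
      rw [h f hf, h2 f hf, evalFun_apply, evalFun_apply, eval_radialAvg_vertex (by linarith)]
  rw [this]
  exact eval_radialAvg _ _ _ _ _

end Vertex

/-! ### The polynomial averages as functionals of one-variable slices. -/

section Slices

/-- The polynomial `v ↦ f (v, s)`. -/
def sliceU (s : ℝ) : MvPolynomial (Fin 2) ℝ →ₐ[ℝ] Polynomial ℝ :=
  aeval ![Polynomial.X, Polynomial.C s]

lemma eval_sliceU (s v : ℝ) (f : MvPolynomial (Fin 2) ℝ) :
    (sliceU s f).eval v = eval (coordU (v, s)) f := by
  have : (Polynomial.aeval v).comp (sliceU s) = aeval (coordU (v, s)) := by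
    refine algHom_ext fun i => ?_
    fin_cases i <;> simp [sliceU, coordU]
  simpa [aeval_eq_eval] using AlgHom.congr_fun this f

lemma sliceU_monomial (s : ℝ) (m : Fin 2 →₀ ℕ) :
    sliceU s (monomial m 1) = Polynomial.C (s ^ m 1) * Polynomial.X ^ m 0 := by
  refine Polynomial.funext fun v => ?_
  rw [eval_sliceU, eval_coordU_monomial]; simp [mul_comm]

/-- Odd moments vanish, so `√s` occurs only in even powers; this is why the average is again a
polynomial in `s`. The same holds for the square root of the defect in `eval_ballAvg`. -/
lemma eval_segAvg (l β : ℝ) {s : ℝ} (hs : 0 ≤ s) (v : ℝ) (f : MvPolynomial (Fin 2) ℝ) :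
    eval (coordU (v, s)) (monoMap (segAvgMonomial l β) f) =
      gegFun β ((powMap (mixPoly (l + 1) β v) (sliceU s f)).comp
        (Polynomial.C √s * Polynomial.X)) := by
  have : evalFun (coordU (v, s)) ∘ₗ monoMap (segAvgMonomial l β) =
      gegFun β ∘ₗ (Polynomial.aeval (Polynomial.C √s * Polynomial.X)).toLinearMap ∘ₗ
        powMap (mixPoly (l + 1) β v) ∘ₗ (sliceU s).toLinearMap := by
    refine linearMap_ext_monomial fun m => ?_
    simp only [LinearMap.comp_apply, AlgHom.toLinearMap_apply, monoMap_monomial, one_smul,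
      evalFun_apply, sliceU_monomial, Polynomial.C_mul_X_pow_eq_monomial, powMap_monomial, map_smul,
      smul_eq_mul]
    simp only [mixPoly, map_sum, segAvgMonomial, eval_coordU_monomial, expo_zero, expo_one,
      Finset.mul_sum]
    refine Finset.sum_congr rfl fun q _ => ?_
    rw [map_mul (Polynomial.aeval _), Polynomial.aeval_C, map_pow, Polynomial.aeval_X, mul_pow, ← Polynomial.C_pow,
      Polynomial.algebraMap_eq, gegFun_C_mul, gegFun_C_mul_X_pow]
    rcases Nat.even_or_odd q with ⟨r, rfl⟩ | ho
    · rw [show (r + r) / 2 = r by omega, ← two_mul, pow_mul, Real.sq_sqrt hs]; ring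
    · rw [gegMoment_odd β ho]; ring
  simpa only [LinearMap.comp_apply, AlgHom.toLinearMap_apply, evalFun_apply,
    ← Polynomial.comp_eq_aeval] using LinearMap.congr_fun this f

lemma eval_ballAvg {d : ℕ} (ω : EuclideanSpace ℝ (Fin d)) (c κ : ℝ)
    {p : EuclideanSpace ℝ (Fin d) × ℝ} (hp : ‖p.1‖ ^ 2 ≤ p.2) (f : MvPolynomial (Fin 2) ℝ) :
    eval (coordV p) (monoMap (ballAvgMonomial ω c κ) f) =
      gegFun κ ((sliceU p.2 f).comp (Polynomial.C (inner ℝ ω p.1) +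
        Polynomial.C (c * √(p.2 - ‖p.1‖ ^ 2)) * Polynomial.X)) := by
  have hs : 0 ≤ p.2 - ‖p.1‖ ^ 2 := sub_nonneg.2 hp
  have : evalFun (coordV p) ∘ₗ monoMap (ballAvgMonomial ω c κ) =
      gegFun κ ∘ₗ (Polynomial.aeval (Polynomial.C (inner ℝ ω p.1) +
        Polynomial.C (c * √(p.2 - ‖p.1‖ ^ 2)) * Polynomial.X)).toLinearMap ∘ₗ
        (sliceU p.2).toLinearMap := by
    refine linearMap_ext_monomial fun m => ?_
    simp only [LinearMap.comp_apply, AlgHom.toLinearMap_apply, monoMap_monomial, one_smul,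
      evalFun_apply, sliceU_monomial, map_mul, map_pow, Polynomial.aeval_C, Polynomial.aeval_X,
      ballAvgMonomial, map_sum, eval_C, eval_X, eval_linForm, eval_defectV,
      Polynomial.algebraMap_eq]
    rw [← Polynomial.C_pow, gegFun_C_mul, add_comm (Polynomial.C (inner ℝ ω p.1)), add_pow, map_sum]
    simp only [coordV, Option.elim]
    congr 1
    refine Finset.sum_congr rfl fun q _ => ?_
    have : (Polynomial.C c * Polynomial.C √(p.2 - ‖p.1‖ ^ 2) * Polynomial.X) ^ q *
        Polynomial.C (inner ℝ ω p.1) ^ (m 0 - q) * ((m 0).choose q : Polynomial ℝ) =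
        Polynomial.C (c ^ q * √(p.2 - ‖p.1‖ ^ 2) ^ q * inner ℝ ω p.1 ^ (m 0 - q) *
          (m 0).choose q) * Polynomial.X ^ q := by
      simp only [map_mul, map_pow, map_natCast]; ring
    rw [this, gegFun_C_mul_X_pow]
    rcases Nat.even_or_odd q with ⟨r, rfl⟩ | ho
    · have h2 : √(p.2 - ‖p.1‖ ^ 2) ^ (r + r) = (p.2 - ‖p.1‖ ^ 2) ^ r := by
        rw [← two_mul, pow_mul, Real.sq_sqrt hs]
      rw [show (r + r) / 2 = r by omega, h2]; ring
    · rw [gegMoment_odd κ ho]; ring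
  simpa only [LinearMap.comp_apply, AlgHom.toLinearMap_apply, evalFun_apply,
    ← Polynomial.comp_eq_aeval] using LinearMap.congr_fun this f

end Slices

end Paraboloid

end

noncomputable section

namespace Paraboloid

/-! ### `gegFun` as an integral, and its limit at `κ = -1/2`. -/

section GegenbauerIntegral

open Polynomial

variable {κ : ℝ}

lemma isCompact_I : IsCompact I := isCompact_Icc

lemma measurableSet_I : MeasurableSet I := measurableSet_Icc

lemma integrableOn_gegWeight (hκ : -1 / 2 < κ) :
    IntegrableOn (fun u : ℝ => (1 - u ^ 2) ^ (κ - 1 / 2)) I := by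
  refine (integrableOn_congr_fun (fun u hu => ?_) measurableSet_Icc).1
    (integrableOn_jacobi (a := κ - 1 / 2) (b := κ - 1 / 2) (by linarith) (by linarith))
  rw [← Real.mul_rpow (by linarith [hu.2]) (by linarith [hu.1])]
  ring_nf

lemma integrableOn_mul_gegWeight (hκ : -1 / 2 < κ) {f : ℝ → ℝ} (hf : Continuous f) :
    IntegrableOn (fun u : ℝ => f u * (1 - u ^ 2) ^ (κ - 1 / 2)) I :=
  (integrableOn_gegWeight hκ).continuousOn_mul hf.continuousOn isCompact_I

/-- The interval is the unit ball of `ℝ`, so this is `integral_ballFun` with exponent `κ - 1/2`. -/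
lemma integral_pow_mul_gegWeight (hκ : -1 / 2 < κ) (i : ℕ) :
    gegenbauerConst κ * ∫ u in I, u ^ i * (1 - u ^ 2) ^ (κ - 1 / 2) = gegMoment κ i := by
  have hI : {y : ℝ | ‖y‖ ^ 2 ≤ 1} = I := by
    ext y
    simp [I, abs_le]
  have h := integral_ballFun (E := ℝ) (κ := κ - 1 / 2) (by linarith) (f := fun u : ℝ => u ^ i)
    (by fun_prop) (posHomogeneous_pow i) ((posHomogeneous_pow i).integrable (by fun_prop))
  have hm := gaussMean_pow i
  have hπ : ∫ v : ℝ, Real.exp (-‖v‖ ^ 2) = Real.Gamma (1 / 2) := by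
    rw [Real.Gamma_one_half_eq]
    simpa using integral_gaussian 1
  rw [gaussMean, hπ] at hm
  have hG := (Real.Gamma_pos_of_pos (show (0 : ℝ) < 1 / 2 by norm_num)).ne'
  have hG2 := (Real.Gamma_pos_of_pos (show 0 < κ + 1 / 2 by linarith)).ne'
  simp only [ballFun, hI] at h
  rw [integral_indicator measurableSet_I] at h
  simp only [Real.norm_eq_abs, sq_abs] at h hm
  rw [h, gegenbauerConst, gegMoment, ← hm, Module.finrank_self, Nat.cast_one,
    show κ - 1 / 2 + 1 = κ + 1 / 2 by ring,
    show κ + 1 / 2 + (1 + (i : ℝ)) / 2 = κ + 1 + i / 2 by ring]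
  generalize Real.Gamma (κ + 1 / 2) = A at *
  generalize Real.Gamma (1 / 2) = B at *
  generalize Real.Gamma (κ + 1 + i / 2) = D at *
  generalize Real.Gamma (κ + 1) = E at *
  field_simp

lemma gegFun_eq_integral (hκ : -1 / 2 < κ) (p : ℝ[X]) :
    gegFun κ p = gegenbauerConst κ * ∫ u in I, p.eval u * (1 - u ^ 2) ^ (κ - 1 / 2) := by
  induction p using Polynomial.induction_on' with
  | add p q hp hq =>
    simp only [map_add, eval_add, add_mul]
    rw [integral_add (integrableOn_mul_gegWeight hκ p.continuous)
      (integrableOn_mul_gegWeight hκ q.continuous), hp, hq, mul_add]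
  | monomial i a =>
    simp only [gegFun_monomial, eval_monomial, mul_assoc]
    rw [integral_const_mul, ← integral_pow_mul_gegWeight hκ]; ring

/-- At `κ = -1/2` the moment recurrence reads `m_{i+2} = m_i`: these are the moments of half the sum
of the point masses at `±1`. -/
lemma gegMoment_neg_half (i : ℕ) : gegMoment (-1 / 2) i = if Even i then 1 else 0 := by
  induction i using Nat.twoStepInduction with
  | zero => simp [gegMoment_zero (show (-1 : ℝ) < -1 / 2 by norm_num)]
  | one => simp [gegMoment_odd (-1 / 2) odd_one]
  | more i ih _ =>
    have h := gegMoment_add_two (show (-1 : ℝ) < -1 / 2 by norm_num) i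
    have h2 : (i : ℝ) + 1 ≠ 0 := by positivity
    have : gegMoment (-1 / 2) (i + 2) = gegMoment (-1 / 2) i :=
      mul_left_cancel₀ h2 (by linear_combination h)
    rw [this, ih]
    simp [Nat.even_add]

lemma gegFun_neg_half (p : ℝ[X]) : gegFun (-1 / 2) p = (p.eval 1 + p.eval (-1)) / 2 := by
  induction p using Polynomial.induction_on' with
  | add p q hp hq => simp only [map_add, eval_add, hp, hq]; ring
  | monomial i a =>
    rw [gegFun_monomial, gegMoment_neg_half, eval_monomial, eval_monomial]
    split_ifs with h
    · simp [h.neg_one_pow]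
    · simp [(Nat.not_even_iff_odd.1 h).neg_one_pow]

lemma tendsto_gegMoment (i : ℕ) :
    Tendsto (fun ν : ℝ => gegMoment (ν - 1 / 2) i) (𝓝[>] 0) (𝓝 (gegMoment (-1 / 2) i)) := by
  have hi : (0 : ℝ) ≤ i := i.cast_nonneg
  have hc (x : ℝ) (hx : 0 < x) : ContinuousAt Real.Gamma x :=
    (Real.differentiableAt_Gamma fun m => by
      have : (0 : ℝ) ≤ m := m.cast_nonneg
      linarith).continuousAt
  have : ContinuousAt (fun ν : ℝ => gegMoment (ν - 1 / 2) i) 0 := by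
    refine continuousAt_const.mul (ContinuousAt.div ?_ ?_ ?_)
    · exact ContinuousAt.comp (f := fun ν : ℝ => ν - 1 / 2 + 1) (hc _ (by norm_num)) (by fun_prop)
    · exact ContinuousAt.comp (f := fun ν : ℝ => ν - 1 / 2 + 1 + (i : ℝ) / 2)
        (hc _ (by norm_num; positivity)) (by fun_prop)
    · exact (Real.Gamma_pos_of_pos (by norm_num; positivity)).ne'
  have h2 := this.tendsto.mono_left (nhdsWithin_le_nhds (s := Ioi 0))
  convert! h2 using 3
  norm_num

lemma tendsto_gegFun (p : ℝ[X]) :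
    Tendsto (fun ν : ℝ => gegFun (ν - 1 / 2) p) (𝓝[>] 0) (𝓝 (gegFun (-1 / 2) p)) := by
  simp only [fun κ => gegFun_eq_sum κ (Nat.lt_succ_self p.natDegree)]
  exact tendsto_finsetSum _ fun i _ => (tendsto_gegMoment i).const_mul _

end GegenbauerIntegral

/-! ### Product weights on compact sets. -/

section Fubini

lemma integrableOn_mul_prod {α β : Type*} [MeasureSpace α] [MeasureSpace β]
    [TopologicalSpace α] [TopologicalSpace β] [OpensMeasurableSpace (α × β)] [T2Space (α × β)]
    [SFinite (volume : Measure α)] [SFinite (volume : Measure β)] {s : Set α} {t : Set β}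
    (hs : IsCompact s) (ht : IsCompact t) {v : α → ℝ} {w : β → ℝ} (hv : IntegrableOn v s)
    (hw : IntegrableOn w t) {F : α × β → ℝ} (hF : Continuous F) :
    IntegrableOn (fun q => F q * (v q.1 * w q.2)) (s ×ˢ t) := by
  have h : IntegrableOn (fun q : α × β => v q.1 * w q.2) (s ×ˢ t) := by
    rw [IntegrableOn, Measure.volume_eq_prod, ← Measure.prod_restrict]
    exact Integrable.mul_prod hv hw
  exact h.continuousOn_mul hF.continuousOn (hs.prod ht)

lemma integrableOn_prod_iff {α β : Type*} [MeasureSpace α] [MeasureSpace β]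
    [SFinite (volume : Measure α)] [SFinite (volume : Measure β)] {s : Set α} {t : Set β}
    {G : α × β → ℝ} : IntegrableOn G (s ×ˢ t) ↔
      Integrable G ((volume.restrict s).prod (volume.restrict t)) := by
  rw [IntegrableOn, Measure.volume_eq_prod, ← Measure.prod_restrict]

lemma setIntegral_prod_right {α β : Type*} [MeasureSpace α] [MeasureSpace β]
    [SFinite (volume : Measure α)] [SFinite (volume : Measure β)] {s : Set α} {t : Set β}
    {G : α × β → ℝ} (hG : IntegrableOn G (s ×ˢ t)) :
    ∫ q in s ×ˢ t, G q = ∫ y in t, ∫ x in s, G (x, y) := by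
  rw [Measure.volume_eq_prod, ← Measure.prod_restrict,
    integral_prod_symm _ (integrableOn_prod_iff.1 hG)]

end Fubini

/-! ### The segment average as a double and triple integral. -/

section SegmentIntegral

open MvPolynomial

variable {l β κ : ℝ}

lemma continuous_eval_coordU (f : MvPolynomial (Fin 2) ℝ) :
    Continuous fun p : ℝ × ℝ => eval (coordU p) f :=
  (MvPolynomial.continuous_eval f).comp continuous_coordU

/-- The first coordinate of a point on the segment from `v` to `√s z₂`. -/
def segPoint (s z₁ z₂ v : ℝ) : ℝ := (1 - z₁) / 2 * v + (1 + z₁) / 2 * (√s * z₂)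

lemma eval_segAvg_eq_iterated (hl : -1 < l) (hβ : 0 < β) {s : ℝ} (hs : 0 ≤ s) (v : ℝ)
    (f : MvPolynomial (Fin 2) ℝ) :
    eval (coordU (v, s)) (monoMap (segAvgMonomial l β) f) =
      jacobiConst l (β - 1) * gegenbauerConst β *
        ∫ z₂ in I, (∫ z₁ in I, eval (coordU (segPoint s z₁ z₂ v, s)) f *
          ((1 - z₁) ^ l * (1 + z₁) ^ (β - 1))) * (1 - z₂ ^ 2) ^ (β - 1 / 2) := by
  rw [eval_segAvg l β hs, gegFun_eq_integral (by linarith), mul_comm (jacobiConst _ _), mul_assoc,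
    ← integral_const_mul (jacobiConst _ _)]
  congr 2
  ext z₂
  rw [Polynomial.eval_comp, eval_powMap_mixPoly (by linarith) hβ, betaMean, mul_assoc]
  simp only [Polynomial.eval_mul, Polynomial.eval_C, Polynomial.eval_X, eval_sliceU,
    add_sub_cancel_right, segPoint, show ∀ z : ℝ, 1 - (1 - z) / 2 = (1 + z) / 2 by intro z; ring]

lemma integrableOn_segment (hl : -1 < l) (hβ : 0 < β) (s v : ℝ) (f : MvPolynomial (Fin 2) ℝ) :
    IntegrableOn (fun q : ℝ × ℝ => eval (coordU (segPoint s q.1 q.2 v, s)) f *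
      ((1 - q.1) ^ l * (1 + q.1) ^ (β - 1) * (1 - q.2 ^ 2) ^ (β - 1 / 2))) (I ×ˢ I) := by
  have hc := continuous_eval_coordU f
  exact integrableOn_mul_prod isCompact_I isCompact_I
    (integrableOn_jacobi hl (by linarith)) (integrableOn_gegWeight (by linarith))
    (F := fun q : ℝ × ℝ => eval (coordU (segPoint s q.1 q.2 v, s)) f)
    (hc.comp (by unfold segPoint; fun_prop))

lemma eval_segAvg_eq_integral (hl : -1 < l) (hβ : 0 < β) {s : ℝ} (hs : 0 ≤ s) (v : ℝ)
    (f : MvPolynomial (Fin 2) ℝ) :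
    eval (coordU (v, s)) (monoMap (segAvgMonomial l β) f) =
      jacobiConst l (β - 1) * gegenbauerConst β *
        ∫ q in I ×ˢ I, eval (coordU (segPoint s q.1 q.2 v, s)) f *
          ((1 - q.1) ^ l * (1 + q.1) ^ (β - 1) * (1 - q.2 ^ 2) ^ (β - 1 / 2)) := by
  rw [eval_segAvg_eq_iterated hl hβ hs, setIntegral_prod_right (integrableOn_segment hl hβ s v f)]
  simp only [← integral_mul_const, mul_assoc]

lemma integrableOn_triple (hl : -1 < l) (hβ : 0 < β) (hκ : -1 / 2 < κ) (s a b : ℝ)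
    (f : MvPolynomial (Fin 2) ℝ) :
    IntegrableOn (fun q : ℝ × ℝ × ℝ => eval (coordU (segPoint s q.1 q.2.1 (a + b * q.2.2), s)) f *
      ((1 - q.1) ^ l * (1 + q.1) ^ (β - 1) * ((1 - q.2.1 ^ 2) ^ (β - 1 / 2) *
        (1 - q.2.2 ^ 2) ^ (κ - 1 / 2)))) (I ×ˢ I ×ˢ I) := by
  have hc := continuous_eval_coordU f
  have h2 : IntegrableOn (fun q : ℝ × ℝ => (1 - q.1 ^ 2) ^ (β - 1 / 2) *
      (1 - q.2 ^ 2) ^ (κ - 1 / 2)) (I ×ˢ I) := by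
    rw [integrableOn_prod_iff]
    exact Integrable.mul_prod (integrableOn_gegWeight (by linarith)) (integrableOn_gegWeight hκ)
  exact integrableOn_mul_prod isCompact_I (isCompact_I.prod isCompact_I)
    (integrableOn_jacobi hl (by linarith)) h2
    (F := fun q : ℝ × ℝ × ℝ => eval (coordU (segPoint s q.1 q.2.1 (a + b * q.2.2), s)) f)
    (hc.comp (by unfold segPoint; fun_prop))

lemma gegFun_segAvg_eq_integral (hl : -1 < l) (hβ : 0 < β) (hκ : -1 / 2 < κ) {s : ℝ} (hs : 0 ≤ s)
    (a b : ℝ) (f : MvPolynomial (Fin 2) ℝ) :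
    gegFun κ ((sliceU s (monoMap (segAvgMonomial l β) f)).comp
      (Polynomial.C a + Polynomial.C b * Polynomial.X)) =
      jacobiConst l (β - 1) * gegenbauerConst β * gegenbauerConst κ *
        ∫ q in I ×ˢ I ×ˢ I, eval (coordU (segPoint s q.1 q.2.1 (a + b * q.2.2), s)) f *
          ((1 - q.1) ^ l * (1 + q.1) ^ (β - 1) * ((1 - q.2.1 ^ 2) ^ (β - 1 / 2) *
            (1 - q.2.2 ^ 2) ^ (κ - 1 / 2))) := by
  have h := integrableOn_triple hl hβ hκ s a b f
  rw [setIntegral_prod_right h, setIntegral_prod_right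
    (integrableOn_prod_iff.1 h).integral_prod_right, gegFun_eq_integral hκ,
    mul_comm _ (gegenbauerConst κ), mul_assoc, ← integral_const_mul (jacobiConst _ _ * _)]
  congr 2
  ext u
  rw [Polynomial.eval_comp, eval_sliceU, eval_segAvg_eq_iterated hl hβ hs]
  simp only [← integral_mul_const, mul_assoc, Polynomial.eval_add, Polynomial.eval_mul,
    Polynomial.eval_C, Polynomial.eval_X]

end SegmentIntegral

end Paraboloid

end

noncomputable section

namespace Paraboloid

open MvPolynomial

/-! ### The kernel identities in terms of `gegFun`. -/

section Kernels

variable {d n : ℕ} {a b β γ μ l : ℝ}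
  {KW : EuclideanSpace ℝ (Fin d) × ℝ → EuclideanSpace ℝ (Fin d) × ℝ → ℝ}
  {KU : ℝ × ℝ → ℝ × ℝ → ℝ}

lemma domainV_eq (d : ℕ) : domainV d = parDomain (EuclideanSpace ℝ (Fin d)) := by
  ext p
  exact ⟨fun h => ⟨h.1, h.2.2⟩, fun h => ⟨h.1, (sq_nonneg _).trans h.1, h.2⟩⟩

lemma isKernelW_iff : IsKernelW β γ μ n KW ↔
    IsReproducingKernel coordV (parDomain (EuclideanSpace ℝ (Fin d)))
      (parWeight β γ (μ - 1 / 2)) n KW := by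
  rw [IsKernelW, domainV_eq]
  rfl

lemma isKernelU_iff : IsKernelU a b n KU ↔
    IsReproducingKernel coordU (parDomain ℝ) (parWeight 0 a (b - 1 / 2)) n KU := by
  have hD : domainU = parDomain ℝ := by
    ext p; simp [domainU, parDomain]
  have hw : weightU a b = parWeight 0 a (b - 1 / 2) := by
    ext p; simp [weightU, parWeight]
  rw [IsKernelU, hD, hw]

lemma existsUnique_kernelW (hγ : -1 < γ) (hμ : -1 < μ - 1 / 2)
    (hb : -1 < β + (μ - 1 / 2 + (d : ℝ) / 2)) (n : ℕ) :
    ∃! KW : EuclideanSpace ℝ (Fin d) × ℝ → EuclideanSpace ℝ (Fin d) × ℝ → ℝ,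
      IsKernelW β γ μ n KW := by
  simp only [isKernelW_iff]
  exact existsUnique_kernel (integrableOn_parV hγ hμ hb) (parV_definite hγ hμ hb) n

lemma existsUnique_kernelU (hγ : -1 < γ) (hb : -1 / 2 < b) (n : ℕ) :
    ∃! KU : ℝ × ℝ → ℝ × ℝ → ℝ, IsKernelU γ b n KU := by
  simp only [isKernelU_iff]
  exact existsUnique_kernel (integrableOn_parU hγ (by linarith) (by linarith))
    (parU_definite hγ (by linarith) (by linarith)) n

/-- For `t > 0` take `ω = x / √t` and `c = √(t - ‖x‖²) / √t`; then `√s ξ₀` is linear in `u` with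
coefficients read off from `(ω, c)`. For `t = 0` the choice `(0, 1)` serves, and nothing is claimed
about `ξ₀`. -/
lemma exists_direction (x : EuclideanSpace ℝ (Fin d)) {t : ℝ} (hx : ‖x‖ ^ 2 ≤ t) :
    ∃ (ω : EuclideanSpace ℝ (Fin d)) (c : ℝ), ‖ω‖ ^ 2 + c ^ 2 = 1 ∧ √t • ω = x ∧
      (0 < t → ∀ (y : EuclideanSpace ℝ (Fin d)) (s : ℝ), ‖y‖ ^ 2 ≤ s → ∀ u,
        √s * xi0 x t y s u = inner ℝ ω y + c * √(s - ‖y‖ ^ 2) * u) := by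
  rcases ((sq_nonneg _).trans hx).eq_or_lt with h0 | h0
  · subst h0
    have : x = 0 := by simpa using hx
    exact ⟨0, 1, by simp, by simp [this], fun h => (lt_irrefl _ h).elim⟩
  · have ht : √t ≠ 0 := (Real.sqrt_pos.2 h0).ne'
    refine ⟨(√t)⁻¹ • x, √(t - ‖x‖ ^ 2) / √t, ?_, by rw [smul_inv_smul₀ ht], fun _ y s hy u => ?_⟩
    · rw [norm_smul, mul_pow, div_pow, norm_inv, inv_pow, Real.norm_of_nonneg (Real.sqrt_nonneg _),
        Real.sq_sqrt h0.le, Real.sq_sqrt (sub_nonneg.2 hx)]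
      field_simp
      ring
    · rcases ((sq_nonneg _).trans hy).eq_or_lt with hs | hs
      · subst hs
        have : y = 0 := by simpa using hy
        simp [this]
      · have hs' : √s ≠ 0 := (Real.sqrt_pos.2 hs).ne'
        rw [xi0, Real.sqrt_mul hs.le, inner_smul_left]
        simp only [conj_trivial]
        field_simp

lemma IsKernelU.exists_repr (hγ : -1 < γ) (hκ : -1 < b - 1 / 2)
    (hb : -1 < 0 + (b - 1 / 2 + 1 / 2)) (hU : IsKernelU γ b n KU) (p : ℝ × ℝ) :
    ∃ k ∈ orthoSubmodule (parU hγ hκ hb) n, (∀ q, KU p q = eval (coordU q) k) ∧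
      ∀ f ∈ orthoSubmodule (parU hγ hκ hb) n, parU hγ hκ hb (f * k) = evalFun (coordU p) f :=
  (isReproducingKernel_iff (integrableOn_parU hγ hκ hb)).1 (isKernelU_iff.1 hU) p

lemma IsKernelW.eq_eval (hγ : -1 < γ) (hκ : -1 < μ - 1 / 2)
    (hb : -1 < β + (μ - 1 / 2 + (d : ℝ) / 2)) (hW : IsKernelW β γ μ n KW)
    {k : MvPolynomial (Option (Fin d)) ℝ} (hk : k ∈ orthoSubmodule (parV d hγ hκ hb) n)
    {p : EuclideanSpace ℝ (Fin d) × ℝ}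
    (h : ∀ f ∈ orthoSubmodule (parV d hγ hκ hb) n, parV d hγ hκ hb (f * k) = eval (coordV p) f)
    (q : EuclideanSpace ℝ (Fin d) × ℝ) : KW p q = eval (coordV q) k :=
  IsReproducingKernel.eq_eval (integrableOn_parV hγ hκ hb) (parV_definite hγ hκ hb)
    (isKernelW_iff.1 hW) hk (fun f hf => (h f hf).trans (evalFun_apply _ f).symm) q

/-- The kernel of the solid paraboloid for `β = 0` as an average of the kernel of the parabolic
domain. -/
lemma exists_kernel_average (hγ : -1 < γ) (hμ : 0 ≤ μ) (hl : l = μ + ((d : ℝ) - 1) / 2)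
    (hl0 : -1 / 2 < l) (hW : IsKernelW 0 γ μ n KW) (hU : IsKernelU γ l n KU)
    {x y : EuclideanSpace ℝ (Fin d)} {t s : ℝ} (hx : ‖x‖ ^ 2 ≤ t) (hy : ‖y‖ ^ 2 ≤ s) :
    ∃ (a b : ℝ) (k : MvPolynomial (Fin 2) ℝ),
      KW (x, t) (y, s) = gegFun (μ - 1 / 2)
        ((sliceU s k).comp (Polynomial.C a + Polynomial.C b * Polynomial.X)) ∧
      ∀ u, KU (√t, t) (√s * xi0 x t y s u, s) = eval (coordU (a + b * u, s)) k := by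
  have hκ : -1 < μ - 1 / 2 := by linarith
  have hκ' : -1 < l - 1 / 2 := by linarith
  have hbV : -1 < 0 + (μ - 1 / 2 + (d : ℝ) / 2) := by linarith
  have hbU : -1 < 0 + (l - 1 / 2 + 1 / 2) := by linarith
  have ht : 0 ≤ t := (sq_nonneg _).trans hx
  obtain ⟨ω, c, hω, hωx, hξ⟩ := exists_direction x hx
  obtain ⟨k, hk, hKU, hrep⟩ := hU.exists_repr hγ hκ' hbU (√t, t)
  obtain ⟨Q, hQ, hQe⟩ := isDegreeAdjoint_ball hγ hκ hbV (by rw [hl]; ring) hκ' hbU ω c hω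
  obtain ⟨h1, h2⟩ := hQ.repr hk hrep
  refine ⟨inner ℝ ω y, c * √(s - ‖y‖ ^ 2), k, ?_, fun u => ?_⟩
  · rw [hW.eq_eval hγ hκ hbV h1 (fun f hf => by rw [h2 f hf, evalFun_apply, hQe f t ht, hωx])]
    exact eval_ballAvg ω c _ (p := (y, s)) hy k
  · rw [hKU]
    -- At `t = 0` the quotient in `xi0` is a default value, harmless since the representative at the
    -- vertex does not depend on the first coordinate.
    rcases ht.eq_or_lt with h0 | h0
    · subst h0
      rw [Real.sqrt_zero] at hrep
      exact eval_eq_of_repr_vertex hγ hκ' hbU hk hrep _ _ _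
    · rw [hξ h0 y s hy u]

/-- The kernel of the solid paraboloid for `β > 0` as an average of the kernel of the parabolic
domain. -/
lemma exists_kernel_segment_average (hγ : -1 < γ) (hμ : 0 ≤ μ) (hβ : 0 < β)
    (hl : l = μ + ((d : ℝ) - 1) / 2) (hl0 : -1 / 2 < l) (hW : IsKernelW β γ μ n KW)
    (hU : IsKernelU γ (l + β) n KU) {x y : EuclideanSpace ℝ (Fin d)} {t s : ℝ}
    (hx : ‖x‖ ^ 2 ≤ t) (hy : ‖y‖ ^ 2 ≤ s) :
    ∃ (a b : ℝ) (k : MvPolynomial (Fin 2) ℝ),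
      KW (x, t) (y, s) = gegFun (μ - 1 / 2) ((sliceU s (monoMap (segAvgMonomial l β) k)).comp
        (Polynomial.C a + Polynomial.C b * Polynomial.X)) ∧
      ∀ z₁ z₂ u, KU (√t, t) (√s * xi x t y s z₁ z₂ u, s) =
        eval (coordU (segPoint s z₁ z₂ (a + b * u), s)) k := by
  have hκ : -1 < μ - 1 / 2 := by linarith
  have hκ' : -1 < l - 1 / 2 := by linarith
  have hκ'' : -1 < l + β - 1 / 2 := by linarith
  have hbV : -1 < β + (μ - 1 / 2 + (d : ℝ) / 2) := by linarith
  have hbS : -1 < β + (l - 1 / 2 + 1 / 2) := by linarith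
  have hbU : -1 < 0 + (l + β - 1 / 2 + 1 / 2) := by linarith
  have ht : 0 ≤ t := (sq_nonneg _).trans hx
  obtain ⟨ω, c, hω, hωx, hξ⟩ := exists_direction x hx
  obtain ⟨k, hk, hKU, hrep⟩ := hU.exists_repr hγ hκ'' hbU (√t, t)
  obtain ⟨Q, hQ, hQe⟩ := isDegreeAdjoint_ball hγ hκ hbV (by rw [hl]; ring) hκ' hbS ω c hω
  obtain ⟨Q', hQ', hQe'⟩ := isDegreeAdjoint_segment hγ hl0 hβ hκ' hbS hκ'' hbU
  -- The composed adjoint first moves evaluation at `(x, t)` to `(√t, t)` and then keeps it there.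
  obtain ⟨h1, h2⟩ := (hQ.comp hQ').repr hk hrep
  refine ⟨inner ℝ ω y, c * √(s - ‖y‖ ^ 2), k, ?_, fun z₁ z₂ u => ?_⟩
  · rw [hW.eq_eval hγ hκ hbV h1 (fun f hf => by
      rw [h2 f hf, evalFun_apply, LinearMap.comp_apply, hQe' _ t ht, hQe f t ht, hωx]),
      LinearMap.comp_apply]
    exact eval_ballAvg ω c _ (p := (y, s)) hy (monoMap (segAvgMonomial l β) k)
  · rw [hKU]
    rcases ht.eq_or_lt with h0 | h0
    · subst h0
      rw [Real.sqrt_zero] at hrep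
      exact eval_eq_of_repr_vertex hγ hκ'' hbU hk hrep _ _ _
    · rw [← hξ h0 y s hy u, segPoint, xi]
      ring_nf

end Kernels

/-! ### Translation of `gegFun` into the integrals of the theorem. -/

section Integrals

variable {d : ℕ} {β μ ν l : ℝ}

lemma gegFun_slice_eq_integral (hν : 0 < ν) (s a b : ℝ) (k : MvPolynomial (Fin 2) ℝ) :
    IntegrableOn (fun u : ℝ => eval (coordU (a + b * u, s)) k * (1 - u ^ 2) ^ (ν - 1)) I ∧
    gegFun (ν - 1 / 2) ((sliceU s k).comp (Polynomial.C a + Polynomial.C b * Polynomial.X)) =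
      gegenbauerConst (ν - 1 / 2) *
        ∫ u in I, eval (coordU (a + b * u, s)) k * (1 - u ^ 2) ^ (ν - 1) := by
  have he : ν - 1 / 2 - 1 / 2 = ν - 1 := by ring
  have hi := integrableOn_mul_gegWeight (κ := ν - 1 / 2) (by linarith)
    (f := fun u => eval (coordU (a + b * u, s)) k)
    ((continuous_eval_coordU k).comp (by fun_prop : Continuous fun u : ℝ => (a + b * u, s)))
  have h := gegFun_eq_integral (κ := ν - 1 / 2) (by linarith)
    ((sliceU s k).comp (Polynomial.C a + Polynomial.C b * Polynomial.X))
  rw [he] at hi h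
  refine ⟨hi, ?_⟩
  rw [h]
  simp [Polynomial.eval_comp, eval_sliceU]

lemma gegFun_neg_half_slice (s a b : ℝ) (k : MvPolynomial (Fin 2) ℝ) :
    gegFun (-1 / 2) ((sliceU s k).comp (Polynomial.C a + Polynomial.C b * Polynomial.X)) =
      (eval (coordU (a + b * 1, s)) k + eval (coordU (a + b * -1, s)) k) / 2 := by
  rw [gegFun_neg_half]
  simp [Polynomial.eval_comp, eval_sliceU]

/-- The exponent `ν` of the `u`-weight is kept apart from `μ`: the limit case needs `μ = 0` in
`zWeight` with `ν → 0⁺`. -/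
lemma gegFun_segment_eq_integral (hν : 0 < ν) (hβ : 0 < β) (hl : -1 < μ + ((d : ℝ) - 1) / 2)
    {s : ℝ} (hs : 0 ≤ s) (a b : ℝ) (k : MvPolynomial (Fin 2) ℝ) :
    IntegrableOn (fun q : ℝ × ℝ × ℝ => eval (coordU (segPoint s q.1 q.2.1 (a + b * q.2.2), s)) k *
      zWeight d β μ q.1 q.2.1 * (1 - q.2.2 ^ 2) ^ (ν - 1)) (I ×ˢ I ×ˢ I) ∧
    gegFun (ν - 1 / 2) ((sliceU s (monoMap (segAvgMonomial (μ + ((d : ℝ) - 1) / 2) β) k)).comp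
      (Polynomial.C a + Polynomial.C b * Polynomial.X)) =
      jacobiConst (μ + ((d : ℝ) - 1) / 2) (β - 1) * gegenbauerConst β *
        gegenbauerConst (ν - 1 / 2) *
        ∫ q in I ×ˢ I ×ˢ I, eval (coordU (segPoint s q.1 q.2.1 (a + b * q.2.2), s)) k *
          zWeight d β μ q.1 q.2.1 * (1 - q.2.2 ^ 2) ^ (ν - 1) := by
  have he : ν - 1 / 2 - 1 / 2 = ν - 1 := by ring
  have hi := integrableOn_triple hl hβ (κ := ν - 1 / 2) (by linarith) s a b k
  have h := gegFun_segAvg_eq_integral hl hβ (κ := ν - 1 / 2) (by linarith) hs a b k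
  simp only [he] at hi h
  simp only [zWeight]
  simp only [mul_assoc] at hi h ⊢
  exact ⟨hi, h⟩

lemma gegFun_neg_half_segment_eq_integral (hβ : 0 < β) (hl : -1 < μ + ((d : ℝ) - 1) / 2)
    {s : ℝ} (hs : 0 ≤ s) (a b : ℝ) (k : MvPolynomial (Fin 2) ℝ) :
    IntegrableOn (fun q : ℝ × ℝ => (eval (coordU (segPoint s q.1 q.2 (a + b * 1), s)) k +
      eval (coordU (segPoint s q.1 q.2 (a + b * -1), s)) k) / 2 * zWeight d β μ q.1 q.2)
      (I ×ˢ I) ∧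
    gegFun (-1 / 2) ((sliceU s (monoMap (segAvgMonomial (μ + ((d : ℝ) - 1) / 2) β) k)).comp
      (Polynomial.C a + Polynomial.C b * Polynomial.X)) =
      jacobiConst (μ + ((d : ℝ) - 1) / 2) (β - 1) * gegenbauerConst β *
        ∫ q in I ×ˢ I, (eval (coordU (segPoint s q.1 q.2 (a + b * 1), s)) k +
          eval (coordU (segPoint s q.1 q.2 (a + b * -1), s)) k) / 2 * zWeight d β μ q.1 q.2 := by
  have h1 := integrableOn_segment hl hβ s (a + b * 1) k
  have h2 := integrableOn_segment hl hβ s (a + b * -1) k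
  have he : (fun q : ℝ × ℝ => (eval (coordU (segPoint s q.1 q.2 (a + b * 1), s)) k +
      eval (coordU (segPoint s q.1 q.2 (a + b * -1), s)) k) / 2 * zWeight d β μ q.1 q.2) =
      fun q : ℝ × ℝ => (eval (coordU (segPoint s q.1 q.2 (a + b * 1), s)) k *
        ((1 - q.1) ^ (μ + ((d : ℝ) - 1) / 2) * (1 + q.1) ^ (β - 1) *
          (1 - q.2 ^ 2) ^ (β - 1 / 2)) +
        eval (coordU (segPoint s q.1 q.2 (a + b * -1), s)) k *
        ((1 - q.1) ^ (μ + ((d : ℝ) - 1) / 2) * (1 + q.1) ^ (β - 1) *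
          (1 - q.2 ^ 2) ^ (β - 1 / 2))) / 2 := by
    ext q; rw [zWeight]; ring
  rw [he, gegFun_neg_half_slice, eval_segAvg_eq_integral hl hβ hs, eval_segAvg_eq_integral hl hβ hs,
    integral_div, integral_add h1 h2]
  exact ⟨(h1.add h2).div_const 2, by ring⟩

end Integrals

end Paraboloid

end

/-! ### The theorem. -/

theorem mainTheorem3 (d : ℕ) (hd : 2 ≤ d) (n : ℕ) (β γ μ : ℝ) (hβ : 0 ≤ β) (hγ : -1 < γ)
    (hμ : 0 ≤ μ) :
    -- both reproducing kernels exist and are unique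
    (∃! KW : EuclideanSpace ℝ (Fin d) × ℝ → EuclideanSpace ℝ (Fin d) × ℝ → ℝ,
      Paraboloid.IsKernelW β γ μ n KW) ∧
    (∃! KU : ℝ × ℝ → ℝ × ℝ → ℝ, Paraboloid.IsKernelU γ (β + μ + ((d : ℝ) - 1) / 2) n KU) ∧
    ∀ (KW : EuclideanSpace ℝ (Fin d) × ℝ → EuclideanSpace ℝ (Fin d) × ℝ → ℝ)
      (KU : ℝ × ℝ → ℝ × ℝ → ℝ),
      Paraboloid.IsKernelW β γ μ n KW →
      Paraboloid.IsKernelU γ (β + μ + ((d : ℝ) - 1) / 2) n KU →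
      ∀ (x : EuclideanSpace ℝ (Fin d)) (t : ℝ) (y : EuclideanSpace ℝ (Fin d)) (s : ℝ),
        (x, t) ∈ Paraboloid.domainV d → (y, s) ∈ Paraboloid.domainV d →
        -- `β > 0`, `μ > 0`: a triple integral over `(z₁, z₂, u)`
        (0 < β → 0 < μ →
          IntegrableOn (fun q : ℝ × ℝ × ℝ =>
              KU (√t, t) (√s * Paraboloid.xi x t y s q.1 q.2.1 q.2.2, s) *
                Paraboloid.zWeight d β μ q.1 q.2.1 * (1 - q.2.2 ^ 2) ^ (μ - 1))
            (Paraboloid.I ×ˢ Paraboloid.I ×ˢ Paraboloid.I) ∧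
          KW (x, t) (y, s) =
            Paraboloid.jacobiConst (μ + ((d : ℝ) - 1) / 2) (β - 1) *
              Paraboloid.gegenbauerConst β * Paraboloid.gegenbauerConst (μ - 1 / 2) *
              ∫ q in Paraboloid.I ×ˢ Paraboloid.I ×ˢ Paraboloid.I,
                KU (√t, t) (√s * Paraboloid.xi x t y s q.1 q.2.1 q.2.2, s) *
                  Paraboloid.zWeight d β μ q.1 q.2.1 * (1 - q.2.2 ^ 2) ^ (μ - 1)) ∧
        -- `β = 0`, `μ > 0`: a single integral over `u`
        (β = 0 → 0 < μ →
          IntegrableOn (fun u : ℝ =>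
              KU (√t, t) (√s * Paraboloid.xi0 x t y s u, s) * (1 - u ^ 2) ^ (μ - 1))
            Paraboloid.I ∧
          KW (x, t) (y, s) =
            Paraboloid.gegenbauerConst (μ - 1 / 2) *
              ∫ u in Paraboloid.I,
                KU (√t, t) (√s * Paraboloid.xi0 x t y s u, s) * (1 - u ^ 2) ^ (μ - 1)) ∧
        -- `β > 0`, `μ = 0`: the limit of the triple integral as the exponent of `u` tends to `-1`,
        -- and the value of that limit
        (0 < β → μ = 0 →
          (∀ ν : ℝ, 0 < ν → IntegrableOn (fun q : ℝ × ℝ × ℝ =>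
              KU (√t, t) (√s * Paraboloid.xi x t y s q.1 q.2.1 q.2.2, s) *
                Paraboloid.zWeight d β 0 q.1 q.2.1 * (1 - q.2.2 ^ 2) ^ (ν - 1))
            (Paraboloid.I ×ˢ Paraboloid.I ×ˢ Paraboloid.I)) ∧
          Tendsto (fun ν : ℝ =>
              Paraboloid.jacobiConst (((d : ℝ) - 1) / 2) (β - 1) *
                Paraboloid.gegenbauerConst β * Paraboloid.gegenbauerConst (ν - 1 / 2) *
                ∫ q in Paraboloid.I ×ˢ Paraboloid.I ×ˢ Paraboloid.I,
                  KU (√t, t) (√s * Paraboloid.xi x t y s q.1 q.2.1 q.2.2, s) *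
                    Paraboloid.zWeight d β 0 q.1 q.2.1 * (1 - q.2.2 ^ 2) ^ (ν - 1))
            (𝓝[>] 0) (𝓝 (KW (x, t) (y, s))) ∧
          IntegrableOn (fun q : ℝ × ℝ =>
              (KU (√t, t) (√s * Paraboloid.xi x t y s q.1 q.2 1, s) +
                KU (√t, t) (√s * Paraboloid.xi x t y s q.1 q.2 (-1), s)) / 2 *
                Paraboloid.zWeight d β 0 q.1 q.2)
            (Paraboloid.I ×ˢ Paraboloid.I) ∧
          KW (x, t) (y, s) =
            Paraboloid.jacobiConst (((d : ℝ) - 1) / 2) (β - 1) *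
              Paraboloid.gegenbauerConst β *
              ∫ q in Paraboloid.I ×ˢ Paraboloid.I,
                (KU (√t, t) (√s * Paraboloid.xi x t y s q.1 q.2 1, s) +
                  KU (√t, t) (√s * Paraboloid.xi x t y s q.1 q.2 (-1), s)) / 2 *
                  Paraboloid.zWeight d β 0 q.1 q.2) ∧
        -- `β = 0`, `μ = 0`: the limit of the single integral, and its value
        (β = 0 → μ = 0 →
          (∀ ν : ℝ, 0 < ν → IntegrableOn (fun u : ℝ =>
              KU (√t, t) (√s * Paraboloid.xi0 x t y s u, s) * (1 - u ^ 2) ^ (ν - 1))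
            Paraboloid.I) ∧
          Tendsto (fun ν : ℝ =>
              Paraboloid.gegenbauerConst (ν - 1 / 2) *
                ∫ u in Paraboloid.I,
                  KU (√t, t) (√s * Paraboloid.xi0 x t y s u, s) * (1 - u ^ 2) ^ (ν - 1))
            (𝓝[>] 0) (𝓝 (KW (x, t) (y, s))) ∧
          KW (x, t) (y, s) =
            (KU (√t, t) (√s * Paraboloid.xi0 x t y s 1, s) +
              KU (√t, t) (√s * Paraboloid.xi0 x t y s (-1), s)) / 2) := by
  have hd' : (2 : ℝ) ≤ d := by exact_mod_cast hd
  have hl0 : 0 < μ + ((d : ℝ) - 1) / 2 := by linarith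
  refine ⟨Paraboloid.existsUnique_kernelW hγ (by linarith) (by linarith) n,
    Paraboloid.existsUnique_kernelU hγ (by linarith) n, fun KW KU hW hU x t y s hx hy => ?_⟩
  have hs : 0 ≤ s := hy.2.1
  have key₀ (h : β = 0) := by
    subst h
    rw [show (0 : ℝ) + μ + ((d : ℝ) - 1) / 2 = μ + ((d : ℝ) - 1) / 2 by ring] at hU
    exact Paraboloid.exists_kernel_average hγ hμ rfl (by linarith) hW hU hx.1 hy.1
  rw [show β + μ + ((d : ℝ) - 1) / 2 = μ + ((d : ℝ) - 1) / 2 + β by ring] at hU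
  have key (h : 0 < β) :=
    Paraboloid.exists_kernel_segment_average hγ hμ h rfl (by linarith) hW hU hx.1 hy.1
  refine ⟨fun hβ' hμ' => ?_, fun hβ' hμ' => ?_, fun hβ' hμ' => ?_, fun hβ' hμ' => ?_⟩
  · obtain ⟨a, b, k, h1, h2⟩ := key hβ'
    simp only [h1, h2]
    exact Paraboloid.gegFun_segment_eq_integral hμ' hβ' (by linarith) hs a b k
  · obtain ⟨a, b, k, h1, h2⟩ := key₀ hβ'
    simp only [h1, h2]
    exact Paraboloid.gegFun_slice_eq_integral hμ' s a b k
  · obtain ⟨a, b, k, h1, h2⟩ := key hβ'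
    subst hμ'
    have h3 (ν : ℝ) (hν : 0 < ν) := Paraboloid.gegFun_segment_eq_integral hν hβ'
      (show -1 < 0 + ((d : ℝ) - 1) / 2 by linarith) hs a b k
    have h4 := Paraboloid.gegFun_neg_half_segment_eq_integral hβ' (show -1 < 0 + ((d : ℝ) - 1) / 2 by
      linarith) hs a b k
    rw [show (0 : ℝ) - 1 / 2 = -1 / 2 by ring] at h1
    rw [zero_add] at h1 h4
    simp only [zero_add (((d : ℝ) - 1) / 2)] at h3
    simp only [h1, h2]
    refine ⟨fun ν hν => (h3 ν hν).1, ?_, h4.1, h4.2⟩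
    -- The polynomial under `gegFun` does not depend on `ν`, so continuity of finitely many moments
    -- gives the limit.
    refine (Paraboloid.tendsto_gegFun _).congr' ?_
    filter_upwards [self_mem_nhdsWithin] with ν hν
    exact (h3 ν hν).2
  · obtain ⟨a, b, k, h1, h2⟩ := key₀ hβ'
    subst hμ'
    rw [show (0 : ℝ) - 1 / 2 = -1 / 2 by ring] at h1
    simp only [h1, h2]
    refine ⟨fun ν hν => (Paraboloid.gegFun_slice_eq_integral hν s a b k).1, ?_,
      Paraboloid.gegFun_neg_half_slice s a b k⟩
    refine (Paraboloid.tendsto_gegFun _).congr' ?_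
    filter_upwards [self_mem_nhdsWithin] with ν hν
    exact (Paraboloid.gegFun_slice_eq_integral hν s a b k).2
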